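/- Let $\alpha>0$. \textbf{KMP process.} For $\eta\in\mathbb{R}_+^{\mathbb{Z}}$, $x\in\mathbb{Z}$ and $p\in(0,1)$, let $\eta^{x,p}$ be the configuration that equals $p(\eta(x)+\eta(x+1))$ at $x$, equals $(1-p)(\eta(x)+\eta(x+1))$ at $x+1$, and agrees with $\eta$ elsewhere. The KMP process with parameter $\alpha$ is the càdlàg Markov process $(\eta(t,x)_{x\in\mathbb{Z}})_{t\ge 0}$ on $\mathbb{R}_+^{\mathbb{Z}}$ (product topology) whose generator acts on bounded continuous functions $f$ of finitely many coordinates by $$\mathcal{L}f(\eta)=\sum_{x\in\mathbb{Z}}\int_0^1\bigl[f(\eta^{x,p})-f(\eta)\bigr]\frac{p^{\alpha-1}(1-p)^{\alpha-1}}{\mathrm{B}(\alpha,\alpha)}\,dp,$$ in the sense that $f(\eta(t,\cdot))-\int_0^t\mathcal{L}f(\eta(s,\cdot))\,ds$ is a martingale in the natural filtration of $\eta$ for every such $f$. \textbf{Random walk in random environment.} On a probability space, attach to each bond $(x,x+1)$ of $\mathbb{Z}$ the points $T^{(0)}_{x,x+1}<T^{(1)}_{x,x+1}<\cdots$ of a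 Poisson process of rate $1$ on $(0,\infty)$, independently over bonds, and, independently of these, i.i.d. $\mathrm{Beta}(\alpha,\alpha)$ variables $B^{(j)}_{x,x+1}$. Given this environment, a walker at site $x$ waits for the first Poisson time, after the current time, of the two bonds $(x-1,x)$ and $(x,x+1)$. At that time, if $B$ is the Beta variable attached to it, the walker moves, independently of its past choices, to the left endpoint of the ringing bond with probability $B$ and to the right endpoint with probability $1-B$; it then continues in the same way. For a fixed environment let $K_t(y,x)$ be the (quenched) probability that the walk started at $y$ at time $0$ is at $x$ at time $t$. \textbf{Proposition.} Let $\rho_0:\mathbb{Z}\to\mathbb{R}_+$ be bounded, and let $\eta$ be a KMP process with parameter $\alpha$ and initial condition $\eta(0,\cdot)=\rho_0$ almost surely. Put $$\rho_t(x)=\sum_{y\in\mathbb{Z}}\rho_0(y)K_t(y,x).$$ Then, for almost every environment, these series converge for all $t\ge 0$ and $x\in\mathbb{Z}$ and $t\mapsto\rho_t$ is càdlàg, and the processes $(\eta(t,\cdot))_{t\ge 0}$ and $(\rho_t)_{t\ge 0}$ have the same law on the Skorokhod space $D(\mathbb{R}_+,\mathbb{R}_+^{\mathbb{Z}})$, with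 the Borel $\sigma$-algebra of the Skorokhod ($J_1$) topology. -/

import Mathlib

open MeasureTheory ProbabilityTheory Filter Topology
open scoped NNReal ENNReal BoundedContinuousFunction

noncomputable section

namespace KMP

/-! ### The Skorokhod space `D(ℝ₊, E)` -/

/-- Right-continuous paths with left limits. -/
def IsCadlag {E : Type*} [TopologicalSpace E] (f : ℝ≥0 → E) : Prop :=
  ∀ t, ContinuousWithinAt f (Set.Ici t) t ∧ ∃ l, Tendsto f (𝓝[<] t) (𝓝 l)

/-- The space of càdlàg paths `ℝ₊ → E`. -/
def SkorokhodSpace (E : Type*) [TopologicalSpace E] : Type _ :=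
  {f : ℝ≥0 → E // IsCadlag f}

instance {E : Type*} [TopologicalSpace E] : CoeFun (SkorokhodSpace E) (fun _ => ℝ≥0 → E) :=
  ⟨fun f => f.1⟩

/-- `g` is close to `f` on `[0, T]` after a time change: there is an increasing bijection `φ` of
`ℝ₊` such that, for all `s ≤ T`, `|φ s - s| < ε` and `g (φ s)` is `V`-close to `f s`. -/
def SkorokhodClose {E : Type*} [TopologicalSpace E] (T : ℝ≥0) (ε : ℝ) (V : Set (E × E))
    (f g : SkorokhodSpace E) : Prop :=
  ∃ φ : ℝ≥0 ≃o ℝ≥0, ∀ s ≤ T, dist (φ s) s < ε ∧ (f s, g (φ s)) ∈ V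

/-- The Skorokhod (`J₁`) topology: the sets `{g | SkorokhodClose T ε V f g}` form a basis of
neighbourhoods of `f`. -/
instance {E : Type*} [UniformSpace E] : TopologicalSpace (SkorokhodSpace E) where
  IsOpen U := ∀ f ∈ U, ∃ T : ℝ≥0, ∃ ε : ℝ, 0 < ε ∧ ∃ V ∈ uniformity E,
    ∀ g, SkorokhodClose T ε V f g → g ∈ U
  isOpen_univ := fun _ _ => ⟨0, 1, one_pos, Set.univ, univ_mem, fun _ _ => trivial⟩
  isOpen_inter := by
    rintro U₁ U₂ h₁ h₂ f ⟨hf₁, hf₂⟩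
    obtain ⟨T₁, ε₁, hε₁, V₁, hV₁, H₁⟩ := h₁ f hf₁
    obtain ⟨T₂, ε₂, hε₂, V₂, hV₂, H₂⟩ := h₂ f hf₂
    refine ⟨max T₁ T₂, min ε₁ ε₂, lt_min hε₁ hε₂, V₁ ∩ V₂, inter_mem hV₁ hV₂, ?_⟩
    rintro g ⟨φ, hφ⟩
    refine ⟨H₁ g ⟨φ, fun s hs => ?_⟩, H₂ g ⟨φ, fun s hs => ?_⟩⟩
    · have h := hφ s (hs.trans (le_max_left _ _))
      exact ⟨h.1.trans_le (min_le_left _ _), h.2.1⟩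
    · have h := hφ s (hs.trans (le_max_right _ _))
      exact ⟨h.1.trans_le (min_le_right _ _), h.2.2⟩
  isOpen_sUnion := by
    rintro S hS f ⟨U, hU, hfU⟩
    obtain ⟨T, ε, hε, V, hV, H⟩ := hS U hU f hfU
    exact ⟨T, ε, hε, V, hV, fun g hg => ⟨U, hU, H g hg⟩⟩

/-- The Borel σ-algebra of the Skorokhod topology. -/
instance {E : Type*} [UniformSpace E] : MeasurableSpace (SkorokhodSpace E) := borel _

instance {E : Type*} [UniformSpace E] : BorelSpace (SkorokhodSpace E) := ⟨rfl⟩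

/-! ### The KMP process -/

/-- Energy configurations on `ℤ`, with the product topology. -/
abbrev Config : Type := ℤ → ℝ≥0

/-- Redistribution on the bond `(x, x+1)`: the total energy `e` of the bond is replaced by
`(p e, (1 - p) e)`. Only `p ∈ (0, 1)` matters. -/
def redistribute (x : ℤ) (p : ℝ) (η : Config) : Config :=
  Function.update (Function.update η x (p.toNNReal * (η x + η (x + 1))))
    (x + 1) ((1 - p).toNNReal * (η x + η (x + 1)))

/-- The bond generator `𝓛_{x,x+1}`: redistribution at rate `1`, with a `Beta(α, α)` proportion. -/
def bondGenerator (α : ℝ) (x : ℤ) (f : Config → ℝ) (η : Config) : ℝ :=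
  ∫ p, (f (redistribute x p η) - f η) ∂(betaMeasure α α)

/-- The generator `𝓛 = ∑ₓ 𝓛_{x,x+1}`. For a local `f` only finitely many terms are nonzero. -/
def generator (α : ℝ) (f : Config → ℝ) (η : Config) : ℝ :=
  ∑' x : ℤ, bondGenerator α x f η

/-- `f` depends on finitely many coordinates only. -/
def IsLocal (f : Config → ℝ) : Prop :=
  ∃ Λ : Finset ℤ, DependsOn f (Λ : Set ℤ)

/-- A càdlàg process `η` is a KMP process with parameter `α` if it has generator `𝓛`, in the sense
of the martingale problem: for every bounded continuous local function `f`, the process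
`f(η_t) - ∫₀ᵗ 𝓛f(η_s) ds` is a martingale in the natural filtration of `η`. -/
structure IsKMPProcess (α : ℝ) {Ω : Type*} [MeasurableSpace Ω] (P : Measure Ω)
    (η : Ω → SkorokhodSpace Config) : Prop where
  measurable_eval : ∀ t : ℝ≥0, Measurable (fun ω => η ω t)
  martingale : ∀ f : Config →ᵇ ℝ, IsLocal f →
    Martingale
      (fun (t : ℝ≥0) ω => f (η ω t) - ∫ s in (0 : ℝ)..t, generator α f (η ω s.toNNReal))
      (Filtration.natural (fun (t : ℝ≥0) ω => η ω t)
        (fun t => (measurable_eval t).stronglyMeasurable)) P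

/-! ### The environment -/

/-- A realization of the environment: `ring x j` is the `j`-th Poisson time of the bond `(x, x+1)`
and `mark x j` the Beta variable attached to it. -/
structure Environment where
  ring : ℤ → ℕ → ℝ
  mark : ℤ → ℕ → ℝ

/-- The random times `T 0 < T 1 < ⋯` are the points of a Poisson process of rate `1` on `(0, ∞)`,
i.e. their counting process has independent Poisson increments. -/
structure IsPoissonTimes {Ω : Type*} [MeasurableSpace Ω] (P : Measure Ω)
    (T : ℕ → Ω → ℝ) : Prop where
  measurable : ∀ j, Measurable (T j)
  pos : ∀ᵐ ω ∂P, 0 < T 0 ω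
  strictMono : ∀ᵐ ω ∂P, StrictMono (fun j => T j ω)
  tendsto : ∀ᵐ ω ∂P, Tendsto (fun j => T j ω) atTop atTop
  indep_increments :
    HasIndepIncrements (fun (t : ℝ≥0) ω => Set.ncard {j | T j ω ≤ t}) P
  law_increments : ∀ s t : ℝ≥0, s ≤ t →
    HasLaw (fun ω => Set.ncard {j | T j ω ≤ t} - Set.ncard {j | T j ω ≤ s})
      (poissonMeasure (t - s)) P

/-- A random environment: independent rate-one Poisson processes on the bonds and, independently of
them, i.i.d. `Beta(α, α)` marks. -/
structure IsBetaEnvironment (α : ℝ) {Ω : Type*} [MeasurableSpace Ω] (P : Measure Ω)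
    (env : Ω → Environment) : Prop where
  poisson : ∀ x, IsPoissonTimes P (fun j ω => (env ω).ring x j)
  indep_ring : iIndepFun (fun (x : ℤ) ω => (env ω).ring x) P
  measurable_mark : ∀ x j, Measurable (fun ω => (env ω).mark x j)
  law_mark : ∀ x j, HasLaw (fun ω => (env ω).mark x j) (betaMeasure α α) P
  indep_mark : iIndepFun (fun (i : ℤ × ℕ) ω => (env ω).mark i.1 i.2) P
  indep_ring_mark : IndepFun (fun ω => (env ω).ring) (fun ω => (env ω).mark) P

/-! ### The random walk in a fixed environment and its quenched kernel -/

/-- Index of the first Poisson time after `s` on the bond `(x, x+1)`. -/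
def Environment.nextIndex (e : Environment) (x : ℤ) (s : ℝ) : ℕ :=
  sInf {j | s < e.ring x j}

/-- First Poisson time after `s` on the bond `(x, x+1)`. -/
def Environment.nextRing (e : Environment) (x : ℤ) (s : ℝ) : ℝ :=
  e.ring x (e.nextIndex x s)

/-- The Beta variable of the first Poisson time after `s` on the bond `(x, x+1)`. -/
def Environment.nextMark (e : Environment) (x : ℤ) (s : ℝ) : ℝ :=
  e.mark x (e.nextIndex x s)

/-- One step of the walk, from time and position `p`, with a uniform variable `u`. The walker waits
for the first Poisson time on the two bonds touching its site; if `B` is the Beta variable of that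
time, it moves to the left endpoint of the ringing bond when `u < B`, and to the right endpoint
otherwise. -/
def walkStep (e : Environment) (u : ℝ) (p : ℝ × ℤ) : ℝ × ℤ :=
  if e.nextRing (p.2 - 1) p.1 < e.nextRing p.2 p.1 then
    (e.nextRing (p.2 - 1) p.1, if u < e.nextMark (p.2 - 1) p.1 then p.2 - 1 else p.2)
  else
    (e.nextRing p.2 p.1, if u < e.nextMark p.2 p.1 then p.2 else p.2 + 1)

/-- The successive (time, position) pairs of the walk started at time `s` from site `y`. -/
def walkChain (e : Environment) (s : ℝ) (y : ℤ) (u : ℕ → unitInterval) : ℕ → ℝ × ℤ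
  | 0 => (s, y)
  | n + 1 => walkStep e (u n) (walkChain e s y u n)

/-- The position `X(t)` of the walk started at time `s` from `y`: the position after the last
step taken up to time `t`. -/
def walk (e : Environment) (s : ℝ) (y : ℤ) (u : ℕ → unitInterval) (t : ℝ) : ℤ :=
  (walkChain e s y u (sInf {n | t < (walkChain e s y u (n + 1)).1})).2

/-- The law of a sequence of independent uniform variables on `[0, 1]`, which drives the walk in
a fixed environment. -/
def quenchedMeasure : Measure (ℕ → unitInterval) :=
  Measure.infinitePi (fun _ => (volume : Measure unitInterval))

/-- The quenched transition kernel `K_{s,t}(y, x) = P^{e}(X(t) = x | X(s) = y)`. -/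
def quenchedKernel (e : Environment) (s t : ℝ) (y x : ℤ) : ℝ :=
  quenchedMeasure.real {u | walk e s y u t = x}

end KMP

end

noncomputable section

namespace KMP

/-! ### Measurability in the Skorokhod space -/

section Skorokhod

variable {E : Type*} [UniformSpace E]

/-! Both processes solve the same forward equation, and that equation determines finite-dimensional
laws. `SolvesForward` asks, for bounded continuous local `f` and bounded `G` measurable at time `s`,
that `E[G f(X_{s+h})]` be Lipschitz in `h`, with right derivative `E[G 𝓛f(X_s)]` at `h = 0`.

Uniqueness: if `f` lives on `(-M, M)`, then `𝓛f` lives on the next larger window and has norm at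
most `4M‖f‖`, because only `2M` bonds matter (`exists_generator`). Compare two solutions that agree
at time `s` and iterate the equation `k` times. The difference at time `s + r` is at most a constant
times `4^k M(M+1)⋯(M+k-1) r^k / k!` (`SolvesForward.abs_sub_le`). The rising factorial over `k!` is
a binomial coefficient, so this is geometric in `k` with ratio `8r`, and it vanishes in the limit if
`r ≤ 1/16`. The time step does not depend on `M`, so it can be repeated (`Matched.of_le`). Since `G`
is arbitrary, observations at successive times are absorbed into it one by one, which gives the
finite-dimensional laws (`SolvesForward.integral_prod_eq`).

For the KMP process the equation is the martingale property tested against `G`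
(`IsKMPProcess.solvesForward`). For the averaged profile, let the bond `(x, x+1)` ring with mark
`B`: every walker on the bond goes to `x` with probability `B` and to `x+1` with probability `1 -
B`, whichever end it came from. So each kernel `K_t(y, ·)`, and by linearity the profile, is
redistributed on that bond with proportion `B` (`profile_of_ringsOnce`). The next mark has the Beta
law and is independent of the past; the number of rings in `(s, s+t]` is Poisson and independent of
the past and of all marks. Two rings in a window cost `O(t²)`, whence the first-order expansion
`abs_integral_profile_sub_le` and the same equation. Bonds silent up to time `t` exist almost surely
on both sides of every site; they confine the walks to finite blocks, so all sums are finite and the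
profile is càdlàg.

Finally, a càdlàg path is the Skorokhod limit of step paths that sample it on finer and finer grids,
so the Borel σ-algebra is contained in the one generated by the evaluations
(`measurable_skorokhodSpace`), and finite-dimensional laws determine the law
(`identDistrib_skorokhodSpace`). -/

theorem SkorokhodClose.mono {T T' : ℝ≥0} {ε ε' : ℝ} {V V' : Set (E × E)} {f g : SkorokhodSpace E}
    (h : SkorokhodClose T ε V f g) (hT : T' ≤ T) (hε : ε ≤ ε') (hV : V ⊆ V') :
    SkorokhodClose T' ε' V' f g := by
  obtain ⟨φ, hφ⟩ := h
  exact ⟨φ, fun s hs => ⟨(hφ s (hs.trans hT)).1.trans_le hε, hV (hφ s (hs.trans hT)).2⟩⟩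

theorem SkorokhodClose.refl {T : ℝ≥0} {ε : ℝ} (hε : 0 < ε) {V : Set (E × E)}
    (hV : V ∈ uniformity E) (f : SkorokhodSpace E) : SkorokhodClose T ε V f f :=
  ⟨OrderIso.refl _, fun s _ => ⟨by simpa using hε, by simpa using refl_mem_uniformity hV⟩⟩

/-- The inverse time change works. Up to time `T` it may take values beyond `T`, but not beyond `T +
1` since `ε ≤ 1`; hence the longer horizon in the hypothesis. The same loss occurs in
`SkorokhodClose.comp`. -/
theorem SkorokhodClose.symm {T : ℝ≥0} {ε : ℝ} (hε : ε ≤ 1) {V : Set (E × E)}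
    {f g : SkorokhodSpace E} (h : SkorokhodClose (T + 1) ε V f g) :
    SkorokhodClose T ε (Prod.swap ⁻¹' V) g f := by
  obtain ⟨φ, hφ⟩ := h
  refine ⟨φ.symm, fun s hs => ?_⟩
  have hr : φ.symm s ≤ T + 1 := by
    by_contra! hlt
    have h1 : φ (T + 1) < s := by simpa using φ.strictMono hlt
    have h2 := (hφ (T + 1) le_rfl).1
    rw [NNReal.dist_eq, abs_lt] at h2
    have h3 : (φ (T + 1) : ℝ) < s := h1
    have h4 : (s : ℝ) ≤ T := hs
    push_cast at h2
    linarith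
  have h := hφ _ hr
  simp only [OrderIso.apply_symm_apply] at h
  exact ⟨by rw [dist_comm]; exact h.1, h.2⟩

theorem SkorokhodClose.comp {T : ℝ≥0} {ε : ℝ} (hε : ε ≤ 1) {V : SetRel E E}
    {f g h : SkorokhodSpace E} (h₁ : SkorokhodClose (T + 1) ε V f g)
    (h₂ : SkorokhodClose (T + 1) ε V g h) : SkorokhodClose T (2 * ε) (SetRel.comp V V) f h := by
  obtain ⟨φ, hφ⟩ := h₁
  obtain ⟨ψ, hψ⟩ := h₂
  refine ⟨φ.trans ψ, fun s hs => ?_⟩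
  have h1 := hφ s (hs.trans (by simp))
  have h2 : φ s ≤ T + 1 := by
    have h3 := h1.1
    rw [NNReal.dist_eq, abs_lt] at h3
    have h4 : (s : ℝ) ≤ T := hs
    rw [← NNReal.coe_le_coe]
    push_cast
    linarith
  have h3 := hψ _ h2
  refine ⟨?_, g (φ s), h1.2, h3.2⟩
  calc dist (ψ (φ s)) s ≤ dist (ψ (φ s)) (φ s) + dist (φ s) s := dist_triangle _ _ _
    _ < 2 * ε := by linarith [h1.1, h3.1]

/-- The entourages of the Skorokhod uniformity. -/
def skorokhodEntourage (T : ℝ≥0) (ε : ℝ) (V : Set (E × E)) :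
    Set (SkorokhodSpace E × SkorokhodSpace E) :=
  {p | SkorokhodClose T ε V p.1 p.2}

/-- The basis of the Skorokhod uniformity. -/
def skorokhodBasis (E : Type*) [UniformSpace E] :
    FilterBasis (SkorokhodSpace E × SkorokhodSpace E) where
  sets := {S | ∃ (T : ℝ≥0) (ε : ℝ) (V : Set (E × E)), 0 < ε ∧ V ∈ uniformity E ∧
    S = skorokhodEntourage T ε V}
  nonempty := ⟨_, 0, 1, Set.univ, one_pos, univ_mem, rfl⟩
  inter_sets := by
    rintro _ _ ⟨T₁, ε₁, V₁, hε₁, hV₁, rfl⟩ ⟨T₂, ε₂, V₂, hε₂, hV₂, rfl⟩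
    refine ⟨_, ⟨max T₁ T₂, min ε₁ ε₂, V₁ ∩ V₂, lt_min hε₁ hε₂, inter_mem hV₁ hV₂, rfl⟩, ?_⟩
    intro p hp
    exact ⟨SkorokhodClose.mono hp (le_max_left _ _) (min_le_left _ _) Set.inter_subset_left,
      SkorokhodClose.mono hp (le_max_right _ _) (min_le_right _ _) Set.inter_subset_right⟩

/-- The uniformity that induces the Skorokhod topology. -/
def skorokhodCore (E : Type*) [UniformSpace E] : UniformSpace.Core (SkorokhodSpace E) :=
  UniformSpace.Core.mkOfBasis (skorokhodBasis E)
    (by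
      rintro _ ⟨T, ε, V, hε, hV, rfl⟩ f
      exact SkorokhodClose.refl hε hV f)
    (by
      rintro _ ⟨T, ε, V, hε, hV, rfl⟩
      refine ⟨_, ⟨T + 1, min ε 1, Prod.swap ⁻¹' V, lt_min hε one_pos,
        tendsto_swap_uniformity hV, rfl⟩, ?_⟩
      intro p hp
      have h := SkorokhodClose.symm (min_le_right _ _) hp
      exact h.mono le_rfl (min_le_left _ _) (by intro x hx; simpa using hx))
    (by
      rintro _ ⟨T, ε, V, hε, hV, rfl⟩
      obtain ⟨W, hW, hWV⟩ := comp_mem_uniformity_sets hV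
      refine ⟨_, ⟨T + 1, min (ε / 2) 1, W, lt_min (half_pos hε) one_pos, hW, rfl⟩, ?_⟩
      rintro ⟨f, h⟩ ⟨g, hfg, hgh⟩
      exact (SkorokhodClose.comp (min_le_right _ _) hfg hgh).mono le_rfl
        (by linarith [min_le_left (ε / 2) 1]) hWV)

/-- The topology was given by its open sets only. That the sets of close paths are neighbourhoods
comes from the symmetry and composition laws used to build `skorokhodCore`. -/
theorem skorokhodTopology_eq :
    (inferInstance : TopologicalSpace (SkorokhodSpace E)) =
      (skorokhodCore E).toTopologicalSpace := by
  ext U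
  refine Iff.trans ?_ (@isOpen_iff_mem_nhds _ (skorokhodCore E).toTopologicalSpace U).symm
  refine forall₂_congr fun f _ => ?_
  rw [UniformSpace.Core.nhds_toTopologicalSpace]
  have hb : (skorokhodCore E).uniformity.HasBasis (· ∈ skorokhodBasis E) id :=
    (skorokhodBasis E).hasBasis
  rw [(hb.comap (Prod.mk f)).mem_iff]
  constructor
  · rintro ⟨T, ε, hε, V, hV, h⟩
    exact ⟨_, ⟨T, ε, V, hε, hV, rfl⟩, fun g hg => h g hg⟩
  · rintro ⟨_, ⟨T, ε, V, hε, hV, rfl⟩, h⟩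
    exact ⟨T, ε, hε, V, hV, fun g hg => h hg⟩

/-- The Skorokhod uniform structure. -/
abbrev skorokhodUniformSpace (E : Type*) [UniformSpace E] : UniformSpace (SkorokhodSpace E) :=
  UniformSpace.ofCoreEq (skorokhodCore E) inferInstance skorokhodTopology_eq

theorem isCountablyGenerated_skorokhodCore [(uniformity E).IsCountablyGenerated] :
    (skorokhodCore E).uniformity.IsCountablyGenerated := by
  obtain ⟨V, hV⟩ := (uniformity E).exists_antitone_basis
  refine Filter.HasCountableBasis.isCountablyGenerated (ι := ℕ) (p := fun _ => True)
    (s := fun n : ℕ => skorokhodEntourage (n : ℝ≥0) (1 / ((n : ℝ) + 1)) (V n)) ⟨⟨fun S => ?_⟩,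
      Set.to_countable _⟩
  have hb : (skorokhodCore E).uniformity.HasBasis (· ∈ skorokhodBasis E) id :=
    (skorokhodBasis E).hasBasis
  rw [hb.mem_iff]
  constructor
  · rintro ⟨_, ⟨T, ε, W, hε, hW, rfl⟩, hS⟩
    obtain ⟨m, hm⟩ := hV.mem_iff.1 hW
    obtain ⟨k, hk⟩ := exists_nat_one_div_lt hε
    obtain ⟨l, hl⟩ := exists_nat_ge T
    refine ⟨max m (max k l), trivial, fun p hp => hS (SkorokhodClose.mono hp ?_ ?_ ?_)⟩
    · exact hl.trans (by exact_mod_cast (le_max_right k l).trans (le_max_right _ _))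
    · refine le_trans ?_ hk.le
      apply one_div_le_one_div_of_le (by positivity)
      have : (k : ℝ) ≤ (max m (max k l) : ℕ) := by
        exact_mod_cast (le_max_left k l).trans (le_max_right _ _)
      linarith
    · exact (hV.antitone (le_max_left _ _)).trans hm
  · rintro ⟨n, -, hS⟩
    exact ⟨_, ⟨n, 1 / ((n : ℝ) + 1), V n, by positivity, hV.mem n, rfl⟩, hS⟩

/-- Needed so that pointwise limits of measurable maps into the Skorokhod space are measurable. It
rests on the countable basis of entourages with horizon `n`, tolerance `1 / (n + 1)` and the `n`-th
entourage of an antitone basis. -/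
theorem pseudoMetrizableSpace_skorokhodSpace [(uniformity E).IsCountablyGenerated] :
    TopologicalSpace.PseudoMetrizableSpace (SkorokhodSpace E) := by
  let := skorokhodUniformSpace E
  have : (uniformity (SkorokhodSpace E)).IsCountablyGenerated :=
    isCountablyGenerated_skorokhodCore
  exact UniformSpace.pseudoMetrizableSpace

/-! ### Approximation of càdlàg paths by step paths -/

/-- The path that is constant equal to `a k` on `[k / (n + 1), (k + 1) / (n + 1))`. -/
def stepPath {E : Type*} [TopologicalSpace E] (n : ℕ) (a : ℕ → E) : SkorokhodSpace E :=
  ⟨fun t => a ⌊((n : ℝ≥0) + 1) * t⌋₊, by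
    intro t
    have hn : (0 : ℝ≥0) < (n : ℝ≥0) + 1 := by positivity
    constructor
    · refine ContinuousWithinAt.congr_of_eventuallyEq
        (continuousWithinAt_const (b := a ⌊((n : ℝ≥0) + 1) * t⌋₊)) ?_ rfl
      have h1 : ∀ᶠ s in 𝓝 t, ((n : ℝ≥0) + 1) * s < ⌊((n : ℝ≥0) + 1) * t⌋₊ + 1 :=
        (Continuous.tendsto (by fun_prop) t).eventually (gt_mem_nhds (Nat.lt_floor_add_one _))
      filter_upwards [self_mem_nhdsWithin, mem_nhdsWithin_of_mem_nhds h1] with s hs hs'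
      congr 1
      rw [Nat.floor_eq_iff (by positivity)]
      exact ⟨(Nat.floor_le (by positivity)).trans (mul_le_mul_right hs _), hs'⟩
    -- Just before `t > 0` the floor equals the ceiling at `t` minus one, whether or not `t` is a
    -- grid point. At `t = 0` the left filter is trivial.
    · refine ⟨a (⌈((n : ℝ≥0) + 1) * t⌉₊ - 1), ?_⟩
      rcases eq_or_ne t 0 with rfl | ht
      · simp
      have htp : 0 < ((n : ℝ≥0) + 1) * t := mul_pos hn (pos_iff_ne_zero.2 ht)
      obtain ⟨c, hc⟩ := Nat.exists_eq_succ_of_ne_zero (Nat.ceil_pos.2 htp).ne'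
      have h2 : (c : ℝ≥0) < ((n : ℝ≥0) + 1) * t := by
        rw [← Nat.lt_ceil, hc]; exact Nat.lt_succ_self c
      have h3 : ((n : ℝ≥0) + 1) * t ≤ c + 1 := by
        have := Nat.le_ceil (((n : ℝ≥0) + 1) * t)
        rw [hc] at this; simpa using this
      have h1 : ∀ᶠ s in 𝓝 t, (c : ℝ≥0) < ((n : ℝ≥0) + 1) * s :=
        (Continuous.tendsto (by fun_prop) t).eventually (lt_mem_nhds h2)
      refine tendsto_const_nhds.congr' ?_
      filter_upwards [self_mem_nhdsWithin, mem_nhdsWithin_of_mem_nhds h1] with s hs hs'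
      congr 1
      rw [hc, Nat.succ_sub_one, eq_comm, Nat.floor_eq_iff (by positivity)]
      exact ⟨hs'.le, ((mul_lt_mul_iff_right₀ hn).2 hs).trans_le h3⟩⟩

/-- Up to time `T` only finitely many values `a k` are seen, and the identity time change is enough.
-/
theorem continuous_stepPath (n : ℕ) : Continuous (stepPath (E := E) n) := by
  refine continuous_def.2 fun U hU => isOpen_iff_mem_nhds.2 fun a ha => ?_
  obtain ⟨T, ε, hε, V, hV, h⟩ := hU _ ha
  have h1 : ∀ᶠ b in 𝓝 a, ∀ k ∈ Finset.range (⌊((n : ℝ≥0) + 1) * T⌋₊ + 1), (a k, b k) ∈ V := by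
    rw [Filter.eventually_all_finset]
    intro k _
    exact (continuous_apply k).tendsto a (UniformSpace.ball_mem_nhds _ hV)
  filter_upwards [h1] with b hb
  refine h _ ⟨OrderIso.refl _, fun s hs => ⟨by simpa using hε, hb _ ?_⟩⟩
  rw [Finset.mem_range, Nat.lt_succ_iff]
  exact Nat.floor_le_floor (mul_le_mul_right hs _)

theorem exists_pos_forall_le_dist (F : Finset ℝ≥0) :
    ∃ δ : ℝ, 0 < δ ∧ ∀ p ∈ F, ∀ q ∈ F, p ≠ q → δ ≤ dist p q := by
  have h : ∀ᶠ δ : ℝ in 𝓝[>] 0, ∀ p ∈ F, ∀ q ∈ F, p ≠ q → δ ≤ dist p q := by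
    simp_rw [Filter.eventually_all_finset]
    intro p _ q _
    by_cases hpq : p = q
    · simp [hpq]
    · filter_upwards [mem_nhdsWithin_of_mem_nhds (gt_mem_nhds (dist_pos.2 hpq))] with δ hδ _
      exact hδ.le
  obtain ⟨δ, hδ, h0⟩ := (h.and self_mem_nhdsWithin).exists
  exact ⟨δ, h0, hδ⟩

/-- A small displacement of finitely many points extends to a small time change. -/
theorem exists_timeChange (F : Finset ℝ≥0) {ε : ℝ} (hε : 0 < ε) :
    ∃ κ : ℝ, 0 < κ ∧ ∀ c : ℝ≥0 → ℝ≥0, c 0 = 0 → (∀ p ∈ F, dist (c p) p ≤ κ) →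
      ∃ φ : ℝ≥0 ≃o ℝ≥0, (∀ s, dist (φ s) s < ε) ∧ ∀ p ∈ F, φ p = c p := by
  obtain ⟨δ, hδ, hsep⟩ := exists_pos_forall_le_dist (insert 0 F)
  have hN : (0 : ℝ) < 2 * ((F.card : ℝ) + 1) := by positivity
  -- With this `κ` the displacements sum to less than `min δ ε`: the bound by `ε` makes the time
  -- change small, the bound by the separation `δ` makes it increasing.
  refine ⟨min δ ε / (2 * ((F.card : ℝ) + 1)), div_pos (lt_min hδ hε) hN, fun c hc0 hc => ?_⟩
  set d : ℝ≥0 → ℝ := fun p => (c p : ℝ) - p with hd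
  have hsum : ∑ p ∈ F, |d p| < min δ ε := by
    have h1 : ∑ p ∈ F, |d p| ≤ ∑ p ∈ F, min δ ε / (2 * ((F.card : ℝ) + 1)) :=
      Finset.sum_le_sum fun p hp => by
        have := hc p hp
        rwa [NNReal.dist_eq] at this
    refine h1.trans_lt ?_
    rw [Finset.sum_const, nsmul_eq_mul, ← mul_div_assoc, div_lt_iff₀ hN]
    nlinarith [lt_min hδ hε, (Nat.cast_nonneg F.card : (0 : ℝ) ≤ F.card)]
  -- The time change is the identity plus a tent of height `d p` over each `p ∈ F`. Tents have
  -- half-width `δ`, so they vanish at the other points of `insert 0 F`, and the sum of all of them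
  -- has Lipschitz constant below `1`.
  set tent : ℝ≥0 → ℝ → ℝ := fun p s => max 0 (1 - |s - p| / δ) with htent
  have tent_nonneg : ∀ p s, 0 ≤ tent p s := fun p s => le_max_left _ _
  have tent_le : ∀ p s, tent p s ≤ 1 := fun p s => max_le zero_le_one (by
    have : 0 ≤ |s - p| / δ := by positivity
    linarith)
  have tent_lip : ∀ p s s', |tent p s - tent p s'| ≤ |s - s'| / δ := by
    intro p s s'
    have h1 : 1 - |s - p| / δ - (1 - |s' - p| / δ) = (|s' - p| - |s - p|) / δ := by ring
    simp only [htent, max_comm (0 : ℝ)]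
    refine (abs_max_sub_max_le_abs _ _ _).trans ?_
    rw [h1, abs_div, abs_of_pos hδ]
    refine div_le_div_of_nonneg_right ?_ hδ.le
    refine (abs_abs_sub_abs_le (s' - (p : ℝ)) (s - p)).trans_eq ?_
    rw [show s' - p - (s - p) = -(s - s') by ring, abs_neg]
  set ψ : ℝ → ℝ := fun s => s + ∑ p ∈ F, d p * tent p s with hψ
  have ψ_cont : Continuous ψ := by
    simp only [hψ, htent]
    fun_prop
  have ψ_close : ∀ s, |ψ s - s| < min δ ε := by
    intro s
    simp only [hψ, add_sub_cancel_left]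
    refine (Finset.abs_sum_le_sum_abs _ _).trans_lt (lt_of_le_of_lt ?_ hsum)
    refine Finset.sum_le_sum fun p _ => ?_
    rw [abs_mul, abs_of_nonneg (tent_nonneg p s)]
    exact mul_le_of_le_one_right (abs_nonneg _) (tent_le p s)
  have ψ_mono : StrictMono ψ := by
    intro s s' hss
    have h1 : |∑ p ∈ F, d p * tent p s - ∑ p ∈ F, d p * tent p s'|
        ≤ (∑ p ∈ F, |d p|) * (|s - s'| / δ) := by
      rw [← Finset.sum_sub_distrib, Finset.sum_mul]
      refine (Finset.abs_sum_le_sum_abs _ _).trans (Finset.sum_le_sum fun p _ => ?_)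
      rw [← mul_sub, abs_mul]
      exact mul_le_mul_of_nonneg_left (tent_lip p s s') (abs_nonneg _)
    have hss' : 0 < |s - s'| := abs_pos.2 (sub_ne_zero.2 hss.ne)
    have h2 : (∑ p ∈ F, |d p|) * (|s - s'| / δ) < |s - s'| := by
      rw [← mul_div_assoc, div_lt_iff₀ hδ, mul_comm]
      exact mul_lt_mul_of_pos_left (hsum.trans_le (min_le_left _ _)) hss'
    have h3 := (abs_le.1 (h1.trans h2.le)).2
    have h4 := lt_of_le_of_lt h1 h2
    rw [abs_lt] at h4
    rw [abs_of_neg (sub_neg.2 hss)] at h4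
    simp only [hψ]
    linarith [h4.2]
  have ψ_apply : ∀ q ∈ insert 0 F, ψ q = c q := by
    intro q hq
    have h1 : ∑ p ∈ F, d p * tent p q = if q ∈ F then d q else 0 := by
      rw [← Finset.sum_ite_eq' F q d]
      refine Finset.sum_congr rfl fun p hp => ?_
      split_ifs with hpq
      · subst hpq
        simp [htent]
      · have := hsep q hq p (Finset.mem_insert_of_mem hp) (Ne.symm hpq)
        rw [NNReal.dist_eq] at this
        have : 1 - |(q : ℝ) - p| / δ ≤ 0 := by
          rw [sub_nonpos, one_le_div hδ]; exact this
        simp [htent, this]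
    simp only [hψ, h1]
    split_ifs with hqF
    · simp [hd]
    · rcases Finset.mem_insert.1 hq with rfl | h
      · simp [hc0]
      · exact absurd h hqF
  have ψ0 : ψ 0 = 0 := by simpa [hc0] using ψ_apply 0 (Finset.mem_insert_self _ _)
  have ψ_nonneg : ∀ s : ℝ≥0, 0 ≤ ψ s := fun s => by
    rw [← ψ0]; exact ψ_mono.monotone s.2
  have φ_mono : StrictMono fun s : ℝ≥0 => (⟨ψ s, ψ_nonneg s⟩ : ℝ≥0) :=
    fun s s' h => ψ_mono (show (s : ℝ) < s' from h)
  have φ_surj : Function.Surjective fun s : ℝ≥0 => (⟨ψ s, ψ_nonneg s⟩ : ℝ≥0) := by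
    intro y
    have hY : (0 : ℝ) ≤ y + min δ ε := add_nonneg y.2 (lt_min hδ hε).le
    have h1 := intermediate_value_Icc hY ψ_cont.continuousOn
    have h2 : (y : ℝ) ∈ Set.Icc (ψ 0) (ψ (y + min δ ε)) := by
      refine ⟨by rw [ψ0]; exact y.2, ?_⟩
      have := (abs_lt.1 (ψ_close (y + min δ ε))).1
      linarith
    obtain ⟨x, hx, hxy⟩ := h1 h2
    exact ⟨⟨x, hx.1⟩, NNReal.eq hxy⟩
  refine ⟨φ_mono.orderIsoOfSurjective _ φ_surj, fun s => ?_, fun p hp => ?_⟩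
  · rw [NNReal.dist_eq]
    exact (ψ_close s).trans_le (min_le_right _ _)
  · exact NNReal.eq (ψ_apply p (Finset.mem_insert_of_mem hp))

/-- On a bounded time interval, a càdlàg path oscillates little on the cells cut out by a suitable
finite set of times. -/
theorem IsCadlag.exists_finset {f : ℝ≥0 → E} (hf : IsCadlag f) (T : ℝ≥0) {V : Set (E × E)}
    (hV : V ∈ uniformity E) :
    ∃ F : Finset ℝ≥0, ∀ s ≤ T, ∀ s', (∀ p ∈ F, p ≤ s ↔ p ≤ s') → (f s, f s') ∈ V := by
  obtain ⟨W, hW, hWsymm, hWV⟩ := comp_symm_mem_uniformity_sets hV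
  have hloc : ∀ u : ℝ≥0, ∃ δ : ℝ, 0 < δ ∧ ∀ s ∈ Metric.ball u δ, ∀ s' ∈ Metric.ball u δ,
      (u ≤ s ↔ u ≤ s') → (f s, f s') ∈ V := by
    intro u
    obtain ⟨hr, l, hl⟩ := hf u
    have h1 : ∀ᶠ s in 𝓝 u, s ∈ Set.Ici u → (f u, f s) ∈ W :=
      eventually_nhdsWithin_iff.1 (hr (UniformSpace.ball_mem_nhds (f u) hW))
    have h2 : ∀ᶠ s in 𝓝 u, s ∈ Set.Iio u → (l, f s) ∈ W :=
      eventually_nhdsWithin_iff.1 (hl (UniformSpace.ball_mem_nhds l hW))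
    obtain ⟨δ, hδ, h⟩ := Metric.eventually_nhds_iff_ball.1 (h1.and h2)
    refine ⟨δ, hδ, fun s hs s' hs' hss => ?_⟩
    by_cases hu : u ≤ s
    · exact hWV ⟨f u, hWsymm.symm _ _ ((h s hs).1 hu), (h s' hs').1 (hss.1 hu)⟩
    · exact hWV ⟨l, hWsymm.symm _ _ ((h s hs).2 (not_le.1 hu)),
        (h s' hs').2 (not_le.1 fun h => hu (hss.2 h))⟩
  choose δ hδ hδf using hloc
  obtain ⟨F₁, -, hF₁⟩ := (isCompact_Icc (a := (0 : ℝ≥0)) (b := T)).elim_nhds_subcover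
    (fun u => Metric.ball u (δ u)) (fun u _ => Metric.ball_mem_nhds u (hδ u))
  obtain ⟨r, hr, hrF⟩ := lebesgue_number_lemma_of_metric (isCompact_Icc (a := (0 : ℝ≥0)) (b := T))
    (c := fun u : F₁ => Metric.ball (u : ℝ≥0) (δ u)) (fun _ => Metric.isOpen_ball) (by
      intro x hx
      obtain ⟨u, hu, hxu⟩ := Set.mem_iUnion₂.1 (hF₁ hx)
      exact Set.mem_iUnion.2 ⟨⟨u, hu⟩, hxu⟩)
  -- A grid of mesh below the Lebesgue number `r` puts `s` and `s'` into one ball of the cover; the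
  -- centre of that ball, also in the finite set, puts them on the same side of it. The grid runs
  -- one point past `T`, so that `s'` is bounded above even when `s` lies in the last cell.
  set q : ℝ≥0 := ⟨r / 2, by positivity⟩ with hq
  have hq0 : 0 < q := by
    rw [← NNReal.coe_pos]
    exact half_pos hr
  classical
  refine ⟨F₁ ∪ (Finset.range (⌊T / q⌋₊ + 2)).image (fun k : ℕ => (k : ℝ≥0) * q),
    fun s hs s' hss => ?_⟩
  obtain ⟨u, hu⟩ := hrF s ⟨zero_le, hs⟩
  have hgrid : ∀ k : ℕ, k < ⌊T / q⌋₊ + 2 → (k * q ≤ s ↔ k * q ≤ s') := fun k hk =>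
    hss _ (Finset.mem_union_right _ (Finset.mem_image_of_mem _ (Finset.mem_range.2 hk)))
  have hfl : ⌊s / q⌋₊ ≤ ⌊T / q⌋₊ := Nat.floor_le_floor (by gcongr)
  have h1 : ⌊s / q⌋₊ * q ≤ s := by
    rw [← le_div_iff₀ hq0]; exact Nat.floor_le (by positivity)
  have h2 : s < (⌊s / q⌋₊ + 1 : ℕ) * q := by
    rw [← div_lt_iff₀ hq0]; push_cast; exact Nat.lt_floor_add_one _
  have h1' := (hgrid _ (by omega)).1 h1
  have h2' : s' < (⌊s / q⌋₊ + 1 : ℕ) * q := by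
    by_contra! h
    exact absurd ((hgrid _ (by omega)).2 h) (not_le.2 h2)
  have hdist : s' ∈ Metric.ball s r := by
    rw [Metric.mem_ball, NNReal.dist_eq, abs_lt]
    have e1 : (⌊s / q⌋₊ : ℝ) * (r / 2) ≤ s := by exact_mod_cast h1
    have e2 : (s : ℝ) < ((⌊s / q⌋₊ : ℝ) + 1) * (r / 2) := by
      have : (s : ℝ) < ((⌊s / q⌋₊ + 1 : ℕ) * q : ℝ≥0) := h2
      push_cast at this; exact this
    have e3 : (⌊s / q⌋₊ : ℝ) * (r / 2) ≤ s' := by exact_mod_cast h1'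
    have e4 : (s' : ℝ) < ((⌊s / q⌋₊ : ℝ) + 1) * (r / 2) := by
      have : (s' : ℝ) < ((⌊s / q⌋₊ + 1 : ℕ) * q : ℝ≥0) := h2'
      push_cast at this; exact this
    constructor <;> linarith
  exact hδf u s (hu (Metric.mem_ball_self hr)) s' (hu hdist)
    (hss _ (Finset.mem_union_left _ u.2))

/-- The time change `φ` moves each `p` in the finite set of `IsCadlag.exists_finset` to the next
grid point. Then `p ≤ s` iff `φ p ≤ φ s` iff `p` is at most the grid point at or before `φ s`. So
`s` and the time at which `f` is sampled lie in the same cell, where `f` oscillates little. -/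
theorem tendsto_stepPath (f : SkorokhodSpace E) :
    Tendsto (fun n : ℕ => stepPath n fun k => f (k / ((n : ℝ≥0) + 1))) atTop (𝓝 f) := by
  rw [tendsto_nhds]
  intro U hU hfU
  obtain ⟨T, ε, hε, V, hV, h⟩ := hU _ hfU
  obtain ⟨F, hF⟩ := f.2.exists_finset T hV
  obtain ⟨κ, hκ, hφ⟩ := exists_timeChange F hε
  obtain ⟨N, hN⟩ := exists_nat_one_div_lt hκ
  filter_upwards [eventually_ge_atTop N] with n hn
  have hn0 : (0 : ℝ≥0) < (n : ℝ≥0) + 1 := by positivity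
  obtain ⟨φ, hφ1, hφ2⟩ := hφ (fun p => ⌈((n : ℝ≥0) + 1) * p⌉₊ / ((n : ℝ≥0) + 1)) (by simp) (by
    intro p _
    have hn0' : (0 : ℝ) < (n : ℝ) + 1 := by positivity
    have h1 : (((n : ℝ≥0) + 1) * p : ℝ≥0) ≤ ⌈((n : ℝ≥0) + 1) * p⌉₊ := Nat.le_ceil _
    have h2 : (⌈((n : ℝ≥0) + 1) * p⌉₊ : ℝ≥0) < ((n : ℝ≥0) + 1) * p + 1 :=
      Nat.ceil_lt_add_one (by positivity)
    have h1' : ((n : ℝ) + 1) * p ≤ ⌈((n : ℝ≥0) + 1) * p⌉₊ := by exact_mod_cast h1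
    have h2' : (⌈((n : ℝ≥0) + 1) * p⌉₊ : ℝ) < ((n : ℝ) + 1) * p + 1 := by exact_mod_cast h2
    rw [NNReal.dist_eq]
    push_cast
    have h3 : (⌈((n : ℝ≥0) + 1) * p⌉₊ : ℝ) / ((n : ℝ) + 1) - p
        = ((⌈((n : ℝ≥0) + 1) * p⌉₊ : ℝ) - ((n : ℝ) + 1) * p) / ((n : ℝ) + 1) := by
      field_simp
    rw [h3, abs_of_nonneg (div_nonneg (sub_nonneg.2 h1') hn0'.le)]
    refine le_trans ?_ hN.le
    have hNn : (N : ℝ) ≤ n := by exact_mod_cast hn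
    exact div_le_div₀ zero_le_one (by linarith) (by positivity) (by linarith))
  refine h _ ⟨φ, fun s hs => ⟨hφ1 s, hF s hs _ fun p hp => ?_⟩⟩
  rw [← φ.le_iff_le, hφ2 p hp, le_div_iff₀ hn0, div_le_iff₀ hn0, mul_comm p, mul_comm (φ s)]
  rw [← Nat.le_floor_iff (by positivity), ← Nat.ceil_le]

/-- A map into the Skorokhod space is Borel measurable as soon as its evaluations are. -/
theorem measurable_skorokhodSpace [(uniformity E).IsCountablyGenerated]
    [SecondCountableTopology E] [MeasurableSpace E] [BorelSpace E] {Ω : Type*} [MeasurableSpace Ω]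
    {f : Ω → SkorokhodSpace E} (hf : ∀ t : ℝ≥0, Measurable fun ω => f ω t) : Measurable f := by
  have := pseudoMetrizableSpace_skorokhodSpace (E := E)
  refine measurable_of_tendsto_metrizable
    (f := fun (n : ℕ) ω => stepPath n fun k => f ω (k / ((n : ℝ≥0) + 1))) (fun n => ?_)
    (tendsto_pi_nhds.2 fun ω => tendsto_stepPath (f ω))
  exact (continuous_stepPath n).measurable.comp (measurable_pi_lambda _ fun k => hf _)

end Skorokhod

/-! ### The generator on local functions -/

section Generator

theorem continuous_redistribute (x : ℤ) :
    Continuous fun q : ℝ × Config => redistribute x q.1 q.2 := by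
  unfold redistribute
  have h : Continuous fun q : ℝ × Config => q.2 x + q.2 (x + 1) := by fun_prop
  exact (continuous_snd.update x ((continuous_real_toNNReal.comp continuous_fst).mul h)).update
    (x + 1) ((continuous_real_toNNReal.comp (continuous_const.sub continuous_fst)).mul h)

theorem redistribute_apply_left (x : ℤ) (p : ℝ) (η : Config) :
    redistribute x p η x = p.toNNReal * (η x + η (x + 1)) := by
  simp [redistribute]

theorem redistribute_apply_right (x : ℤ) (p : ℝ) (η : Config) :
    redistribute x p η (x + 1) = (1 - p).toNNReal * (η x + η (x + 1)) := by
  simp [redistribute]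

theorem redistribute_apply_of_ne {x z : ℤ} (p : ℝ) (η : Config) (h : z ≠ x) (h' : z ≠ x + 1) :
    redistribute x p η z = η z := by
  simp [redistribute, h, h']

/-- `f` depends only on the sites of `(-M, M)`. -/
def IsLocalOn (M : ℕ) (f : Config → ℝ) : Prop :=
  DependsOn f (Set.Ioo (-(M : ℤ)) M)

theorem IsLocalOn.isLocal {M : ℕ} {f : Config → ℝ} (h : IsLocalOn M f) : IsLocal f :=
  ⟨Finset.Ioo (-(M : ℤ)) M, by simpa [IsLocalOn] using h⟩

theorem IsLocalOn.mono {M N : ℕ} {f : Config → ℝ} (h : IsLocalOn M f) (hMN : M ≤ N) :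
    IsLocalOn N f := fun η ξ hηξ => h fun z hz => hηξ z ⟨by have := hz.1; lia, by have := hz.2; lia⟩

theorem bondGenerator_eq_zero {α : ℝ} {M : ℕ} {f : Config → ℝ} (hf : IsLocalOn M f) {x : ℤ}
    (hx : x ∉ Finset.Ico (-(M : ℤ)) M) (η : Config) : bondGenerator α x f η = 0 := by
  have h : ∀ p, f (redistribute x p η) = f η := fun p => hf fun z hz => by
    rw [Finset.mem_Ico] at hx
    have h1 := hz.1
    have h2 := hz.2
    exact redistribute_apply_of_ne p η (by lia) (by lia)
  simp [bondGenerator, h]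

theorem generator_eq_sum {α : ℝ} {M : ℕ} {f : Config → ℝ} (hf : IsLocalOn M f) (η : Config) :
    generator α f η = ∑ x ∈ Finset.Ico (-(M : ℤ)) M, bondGenerator α x f η :=
  tsum_eq_sum fun _ hx => bondGenerator_eq_zero hf hx η

variable {α : ℝ}

theorem norm_sub_redistribute_le (f : Config →ᵇ ℝ) (x : ℤ) (p : ℝ) (η : Config) :
    ‖f (redistribute x p η) - f η‖ ≤ 2 * ‖f‖ :=
  (dist_eq_norm _ _).symm.trans_le (f.dist_le_two_norm _ _)

theorem continuous_bondGenerator (hα : 0 < α) (x : ℤ) (f : Config →ᵇ ℝ) :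
    Continuous (bondGenerator α x f) := by
  have := isProbabilityMeasureBeta hα hα
  have hc : Continuous fun q : ℝ × Config => f (redistribute x q.1 q.2) - f q.2 :=
    (f.continuous.comp (continuous_redistribute x)).sub (f.continuous.comp continuous_snd)
  refine continuous_of_dominated (bound := fun _ => 2 * ‖f‖) (fun η => ?_) (fun η => ?_)
    (integrable_const _) ?_
  · exact (hc.comp (Continuous.prodMk_left η)).aestronglyMeasurable
  · exact ae_of_all _ fun p => norm_sub_redistribute_le f x p η
  · exact ae_of_all _ fun p => hc.comp (Continuous.prodMk_right p)

theorem abs_bondGenerator_le (hα : 0 < α) (x : ℤ) (f : Config →ᵇ ℝ) (η : Config) :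
    |bondGenerator α x f η| ≤ 2 * ‖f‖ := by
  have := isProbabilityMeasureBeta hα hα
  have h := norm_integral_le_of_norm_le_const (μ := betaMeasure α α)
    (ae_of_all _ fun p => norm_sub_redistribute_le f x p η)
  simpa [bondGenerator] using h

/-- The generator maps bounded continuous local functions to bounded continuous local functions. -/
theorem exists_generator (hα : 0 < α) {M : ℕ} {f : Config →ᵇ ℝ} (hf : IsLocalOn M f) :
    ∃ g : Config →ᵇ ℝ, (∀ η, g η = generator α f η) ∧ IsLocalOn (M + 1) g ∧
      ‖g‖ ≤ 4 * M * ‖f‖ := by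
  -- `2M` bonds meet the window and each contributes at most `2‖f‖`. The linear growth in `M` is
  -- what the uniqueness argument relies on.
  have hbd : ∀ η, ‖generator α f η‖ ≤ 4 * M * ‖f‖ := by
    intro η
    rw [generator_eq_sum hf]
    refine (norm_sum_le_of_le _ fun x _ => abs_bondGenerator_le hα x f η).trans_eq ?_
    rw [Finset.sum_const, Int.card_Ico, nsmul_eq_mul]
    have : ((M : ℤ) - -M).toNat = 2 * M := by lia
    rw [this]
    push_cast
    ring
  have hc : Continuous (generator α f) := by
    rw [show generator α f = fun η => ∑ x ∈ Finset.Ico (-(M : ℤ)) M, bondGenerator α x f η from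
      funext (generator_eq_sum hf)]
    exact continuous_finsetSum _ fun x _ => continuous_bondGenerator hα x f
  refine ⟨BoundedContinuousFunction.ofNormedAddCommGroup _ hc _ hbd, fun _ => rfl, ?_, ?_⟩
  · intro η ξ hηξ
    change generator α f η = generator α f ξ
    rw [generator_eq_sum hf, generator_eq_sum hf]
    refine Finset.sum_congr rfl fun x hx => ?_
    rw [Finset.mem_Ico] at hx
    have h0 : ∀ z : ℤ, -(M : ℤ) ≤ z → z ≤ M → η z = ξ z := fun z h1 h2 =>
      hηξ z ⟨by push_cast; lia, by push_cast; lia⟩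
    have h1 : f η = f ξ := hf fun z hz => h0 z hz.1.le hz.2.le
    have h2 : ∀ p, f (redistribute x p η) = f (redistribute x p ξ) := fun p => hf fun z hz => by
      have hx1 := h0 x (by lia) (by lia)
      have hx2 := h0 (x + 1) (by lia) (by lia)
      by_cases hz1 : z = x
      · subst hz1; rw [redistribute_apply_left, redistribute_apply_left, hx1, hx2]
      by_cases hz2 : z = x + 1
      · subst hz2; rw [redistribute_apply_right, redistribute_apply_right, hx1, hx2]
      rw [redistribute_apply_of_ne _ _ hz1 hz2, redistribute_apply_of_ne _ _ hz1 hz2]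
      exact h0 z hz.1.le hz.2.le
    simp [bondGenerator, h1, h2]
  · exact (BoundedContinuousFunction.norm_le (by positivity)).2 hbd

end Generator

/-! ### Processes that solve the forward equation -/

section Forward

variable {Ω Ω' : Type*} {mΩ : MeasurableSpace Ω} {mΩ' : MeasurableSpace Ω'}

/-- An adapted process whose conditional expectations of local functions have the generator as their
right derivative in time. -/
structure SolvesForward (α : ℝ) (P : Measure Ω) (𝓕 : ℝ≥0 → MeasurableSpace Ω)
    (X : ℝ≥0 → Ω → Config) : Prop where
  mono : Monotone 𝓕
  adapted : ∀ t, Measurable[𝓕 t] (X t)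
  lipschitz : ∀ (M : ℕ) (f : Config →ᵇ ℝ), IsLocalOn M f → ∀ c : ℝ, ∃ C : ℝ, ∀ (s h : ℝ≥0)
    (G : Ω → ℝ), Measurable[𝓕 s] G → (∀ ω, |G ω| ≤ c) →
    |∫ ω, G ω * f (X (s + h) ω) ∂P - ∫ ω, G ω * f (X s ω) ∂P| ≤ C * h
  deriv : ∀ (M : ℕ) (f : Config →ᵇ ℝ), IsLocalOn M f → ∀ (c : ℝ) (s : ℝ≥0)
    (G : Ω → ℝ), Measurable[𝓕 s] G → (∀ ω, |G ω| ≤ c) →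
    Tendsto (fun h : ℝ => h⁻¹ * (∫ ω, G ω * f (X (s + h.toNNReal) ω) ∂P - ∫ ω, G ω * f (X s ω) ∂P))
      (𝓝[>] 0) (𝓝 (∫ ω, G ω * generator α f (X s ω) ∂P))

variable {α : ℝ} {P : Measure Ω} {P' : Measure Ω'}
  {𝓕 : ℝ≥0 → MeasurableSpace Ω} {𝓕' : ℝ≥0 → MeasurableSpace Ω'}
  {X : ℝ≥0 → Ω → Config} {X' : ℝ≥0 → Ω' → Config}

theorem abs_integral_mul_le [IsProbabilityMeasure P] {G F : Ω → ℝ} {c d : ℝ} (hG : ∀ ω, |G ω| ≤ c)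
    (hF : ∀ ω, |F ω| ≤ d) : |∫ ω, G ω * F ω ∂P| ≤ c * d := by
  have h := norm_integral_le_of_norm_le_const (μ := P) (f := fun ω => G ω * F ω) (C := c * d)
    (ae_of_all _ fun ω => by
      rw [Real.norm_eq_abs, abs_mul]
      exact mul_le_mul (hG ω) (hF ω) (abs_nonneg _) ((abs_nonneg _).trans (hG ω)))
  simpa using h

/-- The mean value inequality for right derivatives needs continuity, which a right derivative alone
does not give; the Lipschitz field supplies it, with one constant for all starting times. -/
theorem SolvesForward.continuousOn (h : SolvesForward α P 𝓕 X) {M : ℕ} {f : Config →ᵇ ℝ}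
    (hf : IsLocalOn M f) {s : ℝ≥0} {G : Ω → ℝ} (hG : Measurable[𝓕 s] G) {c : ℝ}
    (hGc : ∀ ω, |G ω| ≤ c) :
    ContinuousOn (fun r : ℝ => ∫ ω, G ω * f (X (s + r.toNNReal) ω) ∂P) (Set.Ici 0) := by
  obtain ⟨C, hC⟩ := h.lipschitz M f hf c
  have key : ∀ r r' : ℝ, 0 ≤ r → r ≤ r' → |(∫ ω, G ω * f (X (s + r'.toNNReal) ω) ∂P) -
      ∫ ω, G ω * f (X (s + r.toNNReal) ω) ∂P| ≤ C * (r' - r) := by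
    intro r r' hr hrr
    have h1 := hC (s + r.toNNReal) (r' - r).toNNReal G
      (hG.mono (h.mono (by simp)) le_rfl) hGc
    rwa [add_assoc, ← Real.toNNReal_add hr (sub_nonneg.2 hrr), add_sub_cancel,
      Real.coe_toNNReal _ (sub_nonneg.2 hrr)] at h1
  have hC0 : 0 ≤ C := by
    have := (abs_nonneg _).trans (key 0 1 le_rfl zero_le_one)
    linarith
  refine LipschitzOnWith.continuousOn (K := ⟨C, hC0⟩) (LipschitzOnWith.of_dist_le_mul ?_)
  intro r hr r' hr'
  rw [Real.dist_eq, Real.dist_eq]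
  change _ ≤ C * _
  rcases le_total r r' with hle | hle
  · rw [abs_sub_comm, abs_sub_comm r, abs_of_nonneg (sub_nonneg.2 hle)]
    exact key r r' hr hle
  · rw [abs_of_nonneg (sub_nonneg.2 hle)]
    exact key r' r hr' hle

theorem SolvesForward.hasDerivWithinAt (h : SolvesForward α P 𝓕 X) {M : ℕ} {f : Config →ᵇ ℝ}
    (hf : IsLocalOn M f) {s : ℝ≥0} {G : Ω → ℝ} (hG : Measurable[𝓕 s] G) {c : ℝ}
    (hGc : ∀ ω, |G ω| ≤ c) {r : ℝ} (hr : 0 ≤ r) :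
    HasDerivWithinAt (fun r : ℝ => ∫ ω, G ω * f (X (s + r.toNNReal) ω) ∂P)
      (∫ ω, G ω * generator α f (X (s + r.toNNReal) ω) ∂P) (Set.Ici r) r := by
  rw [← hasDerivWithinAt_Ioi_iff_Ici, hasDerivWithinAt_iff_tendsto_slope' Set.self_notMem_Ioi]
  have h1 := h.deriv M f hf c (s + r.toNNReal) G (hG.mono (h.mono (by simp)) le_rfl) hGc
  have h2 : Tendsto (fun r' : ℝ => r' - r) (𝓝[>] r) (𝓝[>] 0) := by
    refine tendsto_nhdsWithin_iff.2 ⟨?_, ?_⟩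
    · refine tendsto_nhdsWithin_of_tendsto_nhds ?_
      simpa using (show Continuous fun r' : ℝ => r' - r by fun_prop).tendsto r
    · filter_upwards [self_mem_nhdsWithin] with r' hr'
      exact sub_pos.2 (Set.mem_Ioi.1 hr')
  refine (h1.comp h2).congr' ?_
  filter_upwards [self_mem_nhdsWithin] with r' hr'
  have hrr : r ≤ r' := (Set.mem_Ioi.1 hr').le
  simp only [Function.comp_apply, slope_def_module, smul_eq_mul]
  rw [add_assoc, ← Real.toNNReal_add hr (sub_nonneg.2 hrr), add_sub_cancel]

/-- `(G, X s)` and `(G', X' s)` cannot be told apart by local functions of the configuration. -/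
def Matched (P : Measure Ω) (P' : Measure Ω') (G : Ω → ℝ) (G' : Ω' → ℝ) (Y : Ω → Config)
    (Y' : Ω' → Config) : Prop :=
  ∀ (M : ℕ) (f : Config →ᵇ ℝ), IsLocalOn M f →
    ∫ ω, G ω * f (Y ω) ∂P = ∫ ω, G' ω * f (Y' ω) ∂P'

/-- Induction on `k`. The right derivative of the difference for `f` is the difference for `𝓛f`,
which lives on a window larger by one and has norm at most `4M‖f‖`; integrating the bound of order
`k` for `𝓛f` gives the bound of order `k + 1` for `f`. Order `0` is the trivial bound. -/
theorem SolvesForward.abs_sub_le [IsProbabilityMeasure P] [IsProbabilityMeasure P']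
    (hα : 0 < α) (h : SolvesForward α P 𝓕 X)
    (h' : SolvesForward α P' 𝓕' X') {s : ℝ≥0} {G : Ω → ℝ} {G' : Ω' → ℝ}
    (hG : Measurable[𝓕 s] G) (hG' : Measurable[𝓕' s] G') {c : ℝ} (hc : ∀ ω, |G ω| ≤ c)
    (hc' : ∀ ω, |G' ω| ≤ c) (hm : Matched P P' G G' (X s) (X' s)) (k : ℕ) :
    ∀ (M : ℕ) (f : Config →ᵇ ℝ), IsLocalOn M f → ∀ r : ℝ, 0 ≤ r →
      |(∫ ω, G ω * f (X (s + r.toNNReal) ω) ∂P) - ∫ ω, G' ω * f (X' (s + r.toNNReal) ω) ∂P'| ≤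
        2 * c * (4 ^ k * M.ascFactorial k * ‖f‖) * (r ^ k / k.factorial) := by
  have hc0 : 0 ≤ c := by
    obtain ⟨ω⟩ := P.nonempty_of_neZero
    exact (abs_nonneg _).trans (hc ω)
  induction k with
  | zero =>
    intro M f _ r _
    have h1 := abs_integral_mul_le (P := P) hc (F := fun ω => f (X (s + r.toNNReal) ω))
      (fun ω => f.norm_coe_le_norm _)
    have h2 := abs_integral_mul_le (P := P') hc' (F := fun ω => f (X' (s + r.toNNReal) ω))
      (fun ω => f.norm_coe_le_norm _)
    have h3 := abs_sub (∫ ω, G ω * f (X (s + r.toNNReal) ω) ∂P)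
      (∫ ω, G' ω * f (X' (s + r.toNNReal) ω) ∂P')
    simp only [pow_zero, Nat.ascFactorial_zero, Nat.factorial_zero, Nat.cast_one, one_mul, div_one,
      mul_one]
    linarith
  | succ k ih =>
    intro M f hf r hr
    obtain ⟨g, hg, hgM, hgn⟩ := exists_generator hα hf
    set A : ℝ := 2 * c * (4 ^ (k + 1) * M.ascFactorial (k + 1) * ‖f‖) with hA
    have hB : ∀ x : ℝ, HasDerivAt (fun x : ℝ => A * (x ^ (k + 1) / (k + 1).factorial))
        (A * (x ^ k / k.factorial)) x := by
      intro x
      have h1 := ((hasDerivAt_pow (k + 1) x).div_const ((k + 1).factorial : ℝ)).const_mul A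
      convert! h1 using 2
      rw [Nat.factorial_succ]
      have := k.factorial_ne_zero
      push_cast
      field_simp
    have hcont : ContinuousOn (fun r : ℝ => (∫ ω, G ω * f (X (s + r.toNNReal) ω) ∂P) -
        ∫ ω, G' ω * f (X' (s + r.toNNReal) ω) ∂P') (Set.Icc 0 r) :=
      ((h.continuousOn hf hG hc).sub (h'.continuousOn hf hG' hc')).mono Set.Icc_subset_Ici_self
    refine image_norm_le_of_norm_deriv_right_le_deriv_boundary hcont
      (fun x hx => (h.hasDerivWithinAt hf hG hc hx.1).sub (h'.hasDerivWithinAt hf hG' hc' hx.1))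
      ?_ hB (fun x hx => ?_) (Set.right_mem_Icc.2 hr)
    · simp [hm M f hf]
    · simp only [← hg]
      refine (ih (M + 1) g hgM x hx.1).trans ?_
      have hx0 : 0 ≤ x ^ k / (k.factorial : ℝ) := div_nonneg (pow_nonneg hx.1 _) (by positivity)
      refine mul_le_mul_of_nonneg_right ?_ hx0
      rw [hA]
      refine mul_le_mul_of_nonneg_left ?_ (by positivity)
      have e : ((M : ℝ) * ((M + 1).ascFactorial k : ℕ)) = (M.ascFactorial (k + 1) : ℕ) := by
        rw [Nat.ascFactorial_succ, ← Nat.succ_ascFactorial]; push_cast; rfl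
      calc (4 : ℝ) ^ k * ((M + 1).ascFactorial k : ℕ) * ‖g‖
          ≤ 4 ^ k * ((M + 1).ascFactorial k : ℕ) * (4 * M * ‖f‖) := by gcongr
        _ = 4 ^ (k + 1) * (M * ((M + 1).ascFactorial k : ℕ)) * ‖f‖ := by ring
        _ = _ := by rw [e]

/-- Let `k → ∞` in `abs_sub_le`: rising factorial over `k!` is a binomial coefficient, at most `2 ^
(M + k)`, so the bound is a constant times `(8r) ^ k ≤ (1/2) ^ k`. -/
theorem Matched.add_of_le [IsProbabilityMeasure P] [IsProbabilityMeasure P']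
    (hα : 0 < α) (h : SolvesForward α P 𝓕 X)
    (h' : SolvesForward α P' 𝓕' X') {s : ℝ≥0} {G : Ω → ℝ} {G' : Ω' → ℝ}
    (hG : Measurable[𝓕 s] G) (hG' : Measurable[𝓕' s] G') {c : ℝ} (hc : ∀ ω, |G ω| ≤ c)
    (hc' : ∀ ω, |G' ω| ≤ c) (hm : Matched P P' G G' (X s) (X' s)) {r : ℝ≥0} (hr : r ≤ 1 / 16) :
    Matched P P' G G' (X (s + r)) (X' (s + r)) := by
  intro M f hf
  have hc0 : 0 ≤ c := by
    obtain ⟨ω⟩ := P.nonempty_of_neZero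
    exact (abs_nonneg _).trans (hc ω)
  -- The window is enlarged so that the rising factorial of `M + 1` is exactly `k! * choose (M + k)
  -- k`.
  have hf' : IsLocalOn (M + 1) f := hf.mono (Nat.le_succ M)
  have key := fun k => h.abs_sub_le hα h' hG hG' hc hc' hm k (M + 1) f hf' r r.2
  simp only [Real.toNNReal_coe] at key
  have hr' : (8 * r : ℝ) ≤ 1 / 2 := by
    have : (r : ℝ) ≤ 1 / 16 := by exact_mod_cast hr
    linarith
  have hbound : ∀ k : ℕ, 2 * c * (4 ^ k * (M + 1).ascFactorial k * ‖f‖) * ((r : ℝ) ^ k / k.factorial)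
      ≤ 2 * c * ‖f‖ * 2 ^ M * (1 / 2) ^ k := by
    intro k
    have hfac : (k.factorial : ℝ) ≠ 0 := by exact_mod_cast k.factorial_ne_zero
    rw [Nat.ascFactorial_eq_factorial_mul_choose]
    have h1 : ((M + k).choose k : ℝ) ≤ 2 ^ (M + k) := by exact_mod_cast Nat.choose_le_two_pow _ _
    calc 2 * c * (4 ^ k * ((k.factorial * (M + k).choose k : ℕ) : ℝ) * ‖f‖) *
          ((r : ℝ) ^ k / k.factorial)
        = 2 * c * ‖f‖ * (4 * r) ^ k * ((M + k).choose k : ℝ) := by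
          push_cast; field_simp; rw [mul_pow]; ring
      _ ≤ 2 * c * ‖f‖ * (4 * r) ^ k * 2 ^ (M + k) := by gcongr
      _ = 2 * c * ‖f‖ * 2 ^ M * (8 * r) ^ k := by
          rw [pow_add, show (8 * (r : ℝ)) = (4 * r) * 2 by ring, mul_pow (4 * (r : ℝ)) 2]; ring
      _ ≤ _ := by gcongr
  have hlim : Tendsto (fun k : ℕ => 2 * c * ‖f‖ * 2 ^ M * (1 / 2 : ℝ) ^ k) atTop (𝓝 0) := by
    simpa using (tendsto_pow_atTop_nhds_zero_of_lt_one (r := (1 / 2 : ℝ)) (by norm_num)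
      (by norm_num)).const_mul (2 * c * ‖f‖ * 2 ^ M)
  have h0 := ge_of_tendsto' hlim fun k => (key k).trans (hbound k)
  exact sub_eq_zero.1 (abs_nonpos_iff.1 h0)

theorem Matched.of_le [IsProbabilityMeasure P] [IsProbabilityMeasure P']
    (hα : 0 < α) (h : SolvesForward α P 𝓕 X)
    (h' : SolvesForward α P' 𝓕' X') {s t : ℝ≥0} (hst : s ≤ t) {G : Ω → ℝ} {G' : Ω' → ℝ}
    (hG : Measurable[𝓕 s] G) (hG' : Measurable[𝓕' s] G') {c : ℝ} (hc : ∀ ω, |G ω| ≤ c)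
    (hc' : ∀ ω, |G' ω| ≤ c) (hm : Matched P P' G G' (X s) (X' s)) :
    Matched P P' G G' (X t) (X' t) := by
  have key : ∀ n : ℕ, ∀ r : ℝ≥0, r ≤ n * (1 / 16) →
      Matched P P' G G' (X (s + r)) (X' (s + r)) := by
    intro n
    induction n with
    | zero =>
      intro r hr
      have : r = 0 := by simpa using hr
      simpa [this] using hm
    | succ n ih =>
      intro r hr
      have h1 := ih (r - 1 / 16) (by rw [tsub_le_iff_right]; push_cast at hr; linarith)
      rcases le_total (1 / 16) r with hle | hle
      · have h2 := h1.add_of_le hα h h' (hG.mono (h.mono (by simp)) le_rfl)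
          (hG'.mono (h'.mono (by simp)) le_rfl) hc hc' (r := 1 / 16) le_rfl
        rwa [add_assoc, tsub_add_cancel_of_le hle] at h2
      · exact hm.add_of_le hα h h' hG hG' hc hc' hle
  obtain ⟨n, hn⟩ := exists_nat_ge ((t - s) * 16)
  have := key n (t - s) (by
    rw [mul_one_div, le_div_iff₀ (by norm_num)]; exact hn)
  rwa [add_tsub_cancel_of_le hst] at this

/-- Matching tests against all local functions, so a factor `g` evaluated at the present
configuration can be moved from the test function into the weight. This is how an observation at the
current time is recorded before moving on. -/
theorem Matched.mul {G : Ω → ℝ} {G' : Ω' → ℝ} {Y : Ω → Config} {Y' : Ω' → Config}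
    (hm : Matched P P' G G' Y Y') {M : ℕ} {g : Config →ᵇ ℝ} (hg : IsLocalOn M g) :
    Matched P P' (fun ω => g (Y ω) * G ω) (fun ω => g (Y' ω) * G' ω) Y Y' := by
  intro N f hf
  have h1 := hm (max M N) (g * f) (by
    intro η ξ hηξ
    simp only [BoundedContinuousFunction.coe_mul, Pi.mul_apply]
    rw [hg.mono (le_max_left M N) hηξ, hf.mono (le_max_right M N) hηξ])
  simp only [BoundedContinuousFunction.coe_mul, Pi.mul_apply] at h1
  convert h1 using 3 <;> ring

/-- Finite-dimensional laws are determined by the forward equation and the initial condition. -/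
theorem SolvesForward.integral_prod_eq [IsProbabilityMeasure P] [IsProbabilityMeasure P']
    (hα : 0 < α) (h : SolvesForward α P 𝓕 X)
    (h' : SolvesForward α P' 𝓕' X') {η₀ : Config} (h0 : ∀ᵐ ω ∂P, X 0 ω = η₀)
    (h0' : ∀ᵐ ω ∂P', X' 0 ω = η₀) (J : Finset (ℝ≥0 × ℤ)) (g : ℝ≥0 × ℤ → ℝ≥0 →ᵇ ℝ) :
    ∫ ω, ∏ j ∈ J, g j (X j.1 ω j.2) ∂P = ∫ ω, ∏ j ∈ J, g j (X' j.1 ω j.2) ∂P' := by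
  classical
  suffices H : ∀ t : ℝ≥0, (∀ j ∈ J, j.1 ≤ t) →
      Measurable[𝓕 t] (fun ω => ∏ j ∈ J, g j (X j.1 ω j.2)) ∧
      Measurable[𝓕' t] (fun ω => ∏ j ∈ J, g j (X' j.1 ω j.2)) ∧
      (∃ c : ℝ, (∀ ω, |∏ j ∈ J, g j (X j.1 ω j.2)| ≤ c) ∧
        ∀ ω, |∏ j ∈ J, g j (X' j.1 ω j.2)| ≤ c) ∧
      Matched P P' (fun ω => ∏ j ∈ J, g j (X j.1 ω j.2)) (fun ω => ∏ j ∈ J, g j (X' j.1 ω j.2))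
        (X t) (X' t) by
    obtain ⟨-, -, -, hm⟩ := H (J.sup Prod.fst) fun j hj => Finset.le_sup (f := Prod.fst) hj
    have := hm 0 (BoundedContinuousFunction.const _ 1) (fun _ _ _ => rfl)
    simpa using this
  have hmeas : ∀ (K : Finset (ℝ≥0 × ℤ)) (t : ℝ≥0), (∀ j ∈ K, j.1 ≤ t) →
      Measurable[𝓕 t] (fun ω => ∏ j ∈ K, g j (X j.1 ω j.2)) := by
    intro K t hK
    refine Finset.measurable_fun_prod _ fun j hj => ?_
    exact (g j).continuous.measurable.comp ((measurable_pi_apply j.2).comp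
      ((h.adapted j.1).mono (h.mono (hK j hj)) le_rfl))
  have hmeas' : ∀ (K : Finset (ℝ≥0 × ℤ)) (t : ℝ≥0), (∀ j ∈ K, j.1 ≤ t) →
      Measurable[𝓕' t] (fun ω => ∏ j ∈ K, g j (X' j.1 ω j.2)) := by
    intro K t hK
    refine Finset.measurable_fun_prod _ fun j hj => ?_
    exact (g j).continuous.measurable.comp ((measurable_pi_apply j.2).comp
      ((h'.adapted j.1).mono (h'.mono (hK j hj)) le_rfl))
  have hbdd : ∀ (K : Finset (ℝ≥0 × ℤ)) (y : ℝ≥0 × ℤ → ℝ≥0),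
      |∏ j ∈ K, g j (y j)| ≤ ∏ j ∈ K, ‖g j‖ := by
    intro K y
    rw [Finset.abs_prod]
    exact Finset.prod_le_prod (fun _ _ => abs_nonneg _) fun j _ => (g j).norm_coe_le_norm _
  refine fun t ht => ⟨hmeas J t ht, hmeas' J t ht, ⟨_, fun ω => hbdd J _, fun ω => hbdd J _⟩, ?_⟩
  revert t
  -- Times are added in increasing order. The weight for the earlier times is matched at the latest
  -- time `a.1`, the new factor is absorbed there by `Matched.mul`, and the product is carried on to
  -- `t`.
  induction J using Finset.induction_on_max_value (Prod.fst : ℝ≥0 × ℤ → ℝ≥0) with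
  | empty =>
    intro t _
    simp only [Finset.prod_empty]
    have hm0 : Matched P P' (fun _ => 1) (fun _ => 1) (X 0) (X' 0) := by
      intro M f hf
      have e1 : ∫ ω, (1 : ℝ) * f (X 0 ω) ∂P = ∫ _, f η₀ ∂P :=
        integral_congr_ae (h0.mono fun ω hω => by simp [hω])
      have e2 : ∫ ω, (1 : ℝ) * f (X' 0 ω) ∂P' = ∫ _, f η₀ ∂P' :=
        integral_congr_ae (h0'.mono fun ω hω => by simp [hω])
      rw [e1, e2]
      simp
    exact hm0.of_le hα h h' zero_le measurable_const measurable_const (c := 1) (by simp) (by simp)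
  | insert a K haK hmax ih =>
    intro t ht
    have hat : a.1 ≤ t := ht a (Finset.mem_insert_self _ _)
    set gf : Config →ᵇ ℝ := (g a).compContinuous ⟨fun η : Config => η a.2, by fun_prop⟩ with hgf
    have hloc : IsLocalOn (a.2.natAbs + 1) gf := by
      intro η ξ hηξ
      have : η a.2 = ξ a.2 := hηξ a.2 ⟨by rw [← Int.natAbs_neg]; omega, by omega⟩
      simp [hgf, this]
    have h1 := (ih a.1 hmax).mul hloc
    have h2 : ∀ ξ : Config, gf ξ = g a (ξ a.2) := fun ξ => rfl
    simp only [h2] at h1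
    simp only [Finset.prod_insert haK]
    have hKa : ∀ j ∈ insert a K, j.1 ≤ a.1 := fun j hj => by
      rcases Finset.mem_insert.1 hj with rfl | hj
      · exact le_rfl
      · exact hmax j hj
    have m1 := hmeas (insert a K) a.1 hKa
    have m2 := hmeas' (insert a K) a.1 hKa
    simp only [Finset.prod_insert haK] at m1 m2
    have b1 := fun ω => hbdd (insert a K) fun j => X j.1 ω j.2
    have b2 := fun ω => hbdd (insert a K) fun j => X' j.1 ω j.2
    simp only [Finset.prod_insert haK] at b1 b2
    exact h1.of_le hα h h' hat m1 m2 b1 b2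

end Forward

/-! ### The KMP process solves the forward equation -/

section KMPForward

/-- The function is the limit of its samples at the first grid point strictly to the right of `t`,
and each sample depends on a floor only. -/
theorem measurable_of_continuousWithinAt_Ici {f : ℝ≥0 → ℝ}
    (hf : ∀ t, ContinuousWithinAt f (Set.Ici t) t) : Measurable f := by
  refine measurable_of_tendsto_metrizable
    (f := fun (n : ℕ) t => f ((⌊((n : ℝ≥0) + 1) * t⌋₊ + 1) / ((n : ℝ≥0) + 1))) (fun n => ?_)
    (tendsto_pi_nhds.2 fun t => ?_)
  · exact (measurable_from_nat (f := fun k : ℕ => f ((k + 1) / ((n : ℝ≥0) + 1)))).comp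
      (Nat.measurable_floor.comp (measurable_const.mul measurable_id))
  · refine (hf t).tendsto.comp (tendsto_nhdsWithin_iff.2 ⟨?_, ?_⟩)
    · have h1 : ∀ n : ℕ, t ≤ (⌊((n : ℝ≥0) + 1) * t⌋₊ + 1) / ((n : ℝ≥0) + 1) := fun n => by
        rw [le_div_iff₀ (by positivity), mul_comm]
        exact (Nat.lt_floor_add_one _).le
      have h2 : ∀ n : ℕ, (⌊((n : ℝ≥0) + 1) * t⌋₊ + 1) / ((n : ℝ≥0) + 1) ≤
          t + 1 / ((n : ℝ≥0) + 1) := fun n => by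
        rw [add_div]
        gcongr
        rw [div_le_iff₀ (by positivity), mul_comm t]
        exact Nat.floor_le (by positivity)
      refine tendsto_of_tendsto_of_tendsto_of_le_of_le tendsto_const_nhds ?_ h1 h2
      have h3 : Tendsto (fun n : ℕ => 1 / ((n : ℝ≥0) + 1)) atTop (𝓝 0) :=
        tendsto_one_div_add_atTop_nhds_zero_nat
      simpa using h3.const_add t
    · refine Eventually.of_forall fun n => ?_
      rw [Set.mem_Ici, le_div_iff₀ (by positivity), mul_comm]
      exact (Nat.lt_floor_add_one _).le

variable {α : ℝ} {Ω : Type*} {mΩ : MeasurableSpace Ω} {P : Measure Ω} [IsProbabilityMeasure P]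
  {η : Ω → SkorokhodSpace Config}

theorem intervalIntegrable_comp_cadlag (g : Config →ᵇ ℝ) (f : SkorokhodSpace Config) (a b : ℝ) :
    IntervalIntegrable (fun s : ℝ => g (f s.toNNReal)) volume a b := by
  have hm : Measurable fun t : ℝ≥0 => g (f t) :=
    measurable_of_continuousWithinAt_Ici fun t =>
      g.continuous.continuousAt.comp_continuousWithinAt (f.2 t).1
  refine (intervalIntegrable_const (c := ‖g‖)).mono_fun
    (hm.comp measurable_real_toNNReal).aestronglyMeasurable (ae_of_all _ fun s => ?_)
  rw [norm_norm]
  exact g.norm_coe_le_norm _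

/-- The integrated generator along a path. -/
def drift (g : Config →ᵇ ℝ) (s h : ℝ≥0) (f : SkorokhodSpace Config) : ℝ :=
  ∫ v in (s : ℝ)..(s + h : ℝ≥0), g (f v.toNNReal)

theorem abs_drift_le (g : Config →ᵇ ℝ) (s h : ℝ≥0) (f : SkorokhodSpace Config) :
    |drift g s h f| ≤ ‖g‖ * h := by
  refine (intervalIntegral.norm_integral_le_of_norm_le_const (C := ‖g‖)
    fun v _ => g.norm_coe_le_norm _).trans_eq ?_
  push_cast
  rw [add_sub_cancel_left, NNReal.abs_eq]

theorem tendsto_drift (g : Config →ᵇ ℝ) (s : ℝ≥0) (f : SkorokhodSpace Config) :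
    Tendsto (fun h : ℝ => h⁻¹ * drift g s h.toNNReal f) (𝓝[>] 0) (𝓝 (g (f s))) := by
  have hc : ContinuousWithinAt (fun v : ℝ => g (f v.toNNReal)) (Set.Ici (s : ℝ)) s := by
    have h1 : ContinuousWithinAt (fun t : ℝ≥0 => g (f t)) (Set.Ici s) s :=
      g.continuous.continuousAt.comp_continuousWithinAt (f.2 s).1
    refine ContinuousWithinAt.comp (g := fun t : ℝ≥0 => g (f t)) (t := Set.Ici s)
      (by rwa [Real.toNNReal_coe])
      continuous_real_toNNReal.continuousWithinAt fun v hv => ?_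
    exact NNReal.le_toNNReal_of_coe_le hv
  have hm : StronglyMeasurable fun v : ℝ => g (f v.toNNReal) :=
    ((measurable_of_continuousWithinAt_Ici fun t =>
      g.continuous.continuousAt.comp_continuousWithinAt (f.2 t).1).comp
        measurable_real_toNNReal).stronglyMeasurable
  have hd := intervalIntegral.integral_hasDerivWithinAt_right
    (intervalIntegrable_comp_cadlag g f (s : ℝ) s)
    (s := Set.Ici (s : ℝ)) (t := Set.Ioi (s : ℝ)) (hm.stronglyMeasurableAtFilter)
    (hc.mono Set.Ioi_subset_Ici_self)
  rw [← hasDerivWithinAt_Ioi_iff_Ici,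
    hasDerivWithinAt_iff_tendsto_slope' Set.self_notMem_Ioi, Real.toNNReal_coe] at hd
  have h2 : Tendsto (fun h : ℝ => (s : ℝ) + h) (𝓝[>] 0) (𝓝[>] (s : ℝ)) := by
    refine tendsto_nhdsWithin_iff.2 ⟨?_, ?_⟩
    · refine tendsto_nhdsWithin_of_tendsto_nhds ?_
      simpa using (show Continuous fun h : ℝ => (s : ℝ) + h by fun_prop).tendsto 0
    · filter_upwards [self_mem_nhdsWithin] with h hh
      simpa using hh
  refine (hd.comp h2).congr' ?_
  filter_upwards [self_mem_nhdsWithin] with h hh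
  have hh0 : (0 : ℝ) ≤ h := (Set.mem_Ioi.1 hh).le
  simp [slope_def_module, drift, Real.coe_toNNReal _ hh0]

/-- Testing the martingale against a weight measurable at time `s` gives `E[G M_{s+h}] = E[G M_s]`.
Measurability of the drift is read off from its expression through `f` and the martingale, so no
joint measurability in time and `ω` is used. -/
theorem IsKMPProcess.integral_sub_eq (hη : IsKMPProcess α P η) {f g : Config →ᵇ ℝ}
    (hf : IsLocal f) (hg : ∀ ξ, g ξ = generator α f ξ) (s h : ℝ≥0) {G : Ω → ℝ}
    (hG : Measurable[Filtration.natural (fun (t : ℝ≥0) ω => η ω t)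
      (fun t => (hη.measurable_eval t).stronglyMeasurable) s] G) {c : ℝ} (hc : ∀ ω, |G ω| ≤ c) :
    Measurable (fun ω => drift g s h (η ω)) ∧
      ∫ ω, G ω * f (η ω (s + h)) ∂P - ∫ ω, G ω * f (η ω s) ∂P =
        ∫ ω, G ω * drift g s h (η ω) ∂P := by
  set 𝓕 := Filtration.natural (fun (t : ℝ≥0) ω => η ω t)
    (fun t => (hη.measurable_eval t).stronglyMeasurable) with h𝓕
  have hmart := hη.martingale f hf
  simp only [← hg] at hmart
  set M : ℝ≥0 → Ω → ℝ := fun t ω => f (η ω t) - ∫ s in (0 : ℝ)..t, g (η ω s.toNNReal) with hM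
  have hGm : Measurable G := hG.mono (𝓕.le s) le_rfl
  have hdrift : ∀ ω, drift g s h (η ω) = f (η ω (s + h)) - f (η ω s) - (M (s + h) ω - M s ω) := by
    intro ω
    have := intervalIntegral.integral_interval_sub_left
      (intervalIntegrable_comp_cadlag g (η ω) 0 (s + h : ℝ≥0))
      (intervalIntegrable_comp_cadlag g (η ω) 0 s)
    simp only [hM, drift]
    rw [← this]
    ring
  have hfm : ∀ t : ℝ≥0, Measurable fun ω => f (η ω t) := fun t =>
    f.continuous.measurable.comp (hη.measurable_eval t)
  have hMm : ∀ t, Measurable (M t) := fun t =>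
    ((hmart.1 t).mono (𝓕.le t)).measurable
  have hGf : ∀ t : ℝ≥0, Integrable (fun ω => G ω * f (η ω t)) P := fun t => by
    refine Integrable.of_bound (hGm.mul (hfm t)).aestronglyMeasurable (c * ‖f‖)
      (ae_of_all _ fun ω => ?_)
    rw [norm_mul]
    exact mul_le_mul (hc ω) (f.norm_coe_le_norm _) (norm_nonneg _) ((abs_nonneg _).trans (hc ω))
  have hGM : ∀ t, Integrable (fun ω => G ω * M t ω) P := fun t =>
    (hmart.integrable t).bdd_mul hGm.aestronglyMeasurable (ae_of_all _ hc)
  have hdm : Measurable fun ω => drift g s h (η ω) := by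
    simp only [hdrift]
    exact ((hfm _).sub (hfm _)).sub ((hMm _).sub (hMm _))
  refine ⟨hdm, ?_⟩
  have hMeq : ∫ ω, G ω * M (s + h) ω ∂P = ∫ ω, G ω * M s ω ∂P := by
    have h1 := condExp_mul_of_stronglyMeasurable_left (m := 𝓕 s) (μ := P) (f := G)
      (g := M (s + h)) hG.stronglyMeasurable (hGM (s + h)) (hmart.integrable (s + h))
    have h2 : P[M (s + h) | 𝓕 s] =ᵐ[P] M s := hmart.2 s (s + h) (by simp)
    have h3 : ∫ ω, (P[G * M (s + h) | 𝓕 s]) ω ∂P = ∫ ω, (G * M (s + h)) ω ∂P :=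
      integral_condExp (𝓕.le s)
    refine h3.symm.trans (integral_congr_ae ?_)
    filter_upwards [h1, h2] with ω h1 h2
    rw [h1, Pi.mul_apply, h2]
  simp only [hdrift, mul_sub]
  refine Eq.trans ?_ (integral_sub ((hGf (s + h)).sub (hGf s)) ((hGM (s + h)).sub (hGM s))).symm
  refine Eq.trans ?_ (congrArg₂ _ (integral_sub (hGf (s + h)) (hGf s)).symm
    (integral_sub (hGM (s + h)) (hGM s)).symm)
  rw [hMeq, sub_self, sub_zero]

theorem IsKMPProcess.solvesForward (hα : 0 < α) (hη : IsKMPProcess α P η) :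
    SolvesForward α P (Filtration.natural (fun (t : ℝ≥0) ω => η ω t)
      (fun t => (hη.measurable_eval t).stronglyMeasurable)) (fun t ω => η ω t) where
  mono := fun _ _ h => Filtration.mono _ h
  adapted t := (Filtration.stronglyAdapted_natural
    (fun t => (hη.measurable_eval t).stronglyMeasurable) t).measurable
  lipschitz M f hf c := by
    obtain ⟨g, hg, -, -⟩ := exists_generator hα hf
    refine ⟨c * ‖g‖, fun s h G hG hc => ?_⟩
    rw [(hη.integral_sub_eq hf.isLocal hg s h hG hc).2, mul_assoc]
    exact abs_integral_mul_le hc fun ω => abs_drift_le g s h _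
  deriv M f hf c s G hG hc := by
    obtain ⟨g, hg, -, -⟩ := exists_generator hα hf
    have hGm : Measurable G := hG.mono (Filtration.le _ s) le_rfl
    have key : ∀ h : ℝ, h⁻¹ * (∫ ω, G ω * f (η ω (s + h.toNNReal)) ∂P -
        ∫ ω, G ω * f (η ω s) ∂P) = ∫ ω, G ω * (h⁻¹ * drift g s h.toNNReal (η ω)) ∂P := by
      intro h
      rw [(hη.integral_sub_eq hf.isLocal hg s h.toNNReal hG hc).2, ← integral_const_mul]
      refine integral_congr_ae (ae_of_all _ fun ω => ?_)
      ring
    simp only [key, ← hg]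
    refine tendsto_integral_filter_of_dominated_convergence (fun _ => c * ‖g‖)
      (Eventually.of_forall fun h => ?_) ?_ (integrable_const _)
      (ae_of_all _ fun ω => (tendsto_drift g s (η ω)).const_mul (G ω))
    · exact (hGm.mul (measurable_const.mul
        (hη.integral_sub_eq hf.isLocal hg s h.toNNReal hG hc).1)).aestronglyMeasurable
    · filter_upwards [self_mem_nhdsWithin] with h hh
      refine ae_of_all _ fun ω => ?_
      rw [norm_mul]
      have hh0 : (0 : ℝ) < h := hh
      refine mul_le_mul (hc ω) ?_ (norm_nonneg _) ((abs_nonneg _).trans (hc ω))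
      rw [norm_mul, Real.norm_eq_abs, Real.norm_eq_abs, abs_of_pos (inv_pos.2 hh0),
        inv_mul_le_iff₀ hh0, mul_comm h]
      refine (abs_drift_le g s _ _).trans_eq ?_
      rw [Real.coe_toNNReal _ hh0.le]

end KMPForward

/-! ### Equality of laws from the forward equation -/

section Law

variable {Ω Ω' : Type*} {mΩ : MeasurableSpace Ω} {mΩ' : MeasurableSpace Ω'}
  {P : Measure Ω} {P' : Measure Ω'} [IsProbabilityMeasure P] [IsProbabilityMeasure P']

theorem map_pi_eq_of_integral_prod_eq {ι : Type*} [Fintype ι] {E : Type*} [TopologicalSpace E]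
    [MeasurableSpace E] [BorelSpace E] [HasOuterApproxClosed E] {μ ν : Measure (ι → E)}
    [IsFiniteMeasure μ] [IsFiniteMeasure ν]
    (h : ∀ f : ι → E →ᵇ ℝ, ∫ x, ∏ i, f i (x i) ∂μ = ∫ x, ∏ i, f i (x i) ∂ν) : μ = ν := by
  -- A trivial factor is adjoined to bring the measures to the form treated by
  -- `Measure.ext_of_integral_prod_mul_boundedContinuousFunction`.
  have hm : Measurable fun x : ι → E => (x, ()) := measurable_id.prodMk measurable_const
  have h1 : μ.map (fun x => (x, ())) = ν.map (fun x => (x, ())) := by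
    refine Measure.ext_of_integral_prod_mul_boundedContinuousFunction fun f g => ?_
    have hs : StronglyMeasurable fun p : (ι → E) × Unit => (∏ i, f i (p.1 i)) * g p.2 :=
      ((Finset.measurable_fun_prod _ fun i _ => (f i).continuous.measurable.comp
        ((measurable_pi_apply i).comp measurable_fst)).mul
          (measurable_from_top.comp measurable_snd)).stronglyMeasurable
    rw [integral_map hm.aemeasurable hs.aestronglyMeasurable,
      integral_map hm.aemeasurable hs.aestronglyMeasurable]
    simp only [integral_mul_const, h f]
  have h2 := congrArg (Measure.map Prod.fst) h1
  rwa [Measure.map_map measurable_fst hm, Measure.map_map measurable_fst hm,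
    show (Prod.fst ∘ fun x : ι → E => (x, ())) = id from rfl, Measure.map_id, Measure.map_id] at h2

/-- Products of bounded continuous functions separate laws on finite products, and uniqueness of
projective limits gives equality on the space of all evaluations. Every Borel set of paths is the
preimage of a measurable set there. -/
theorem identDistrib_skorokhodSpace {η : Ω → SkorokhodSpace Config}
    {ρ : Ω' → SkorokhodSpace Config} (hη : ∀ t : ℝ≥0, Measurable fun ω => η ω t)
    (hρ : ∀ t : ℝ≥0, Measurable fun ω => ρ ω t)
    (h : ∀ (J : Finset (ℝ≥0 × ℤ)) (g : ℝ≥0 × ℤ → ℝ≥0 →ᵇ ℝ),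
      ∫ ω, ∏ j ∈ J, g j (η ω j.1 j.2) ∂P = ∫ ω, ∏ j ∈ J, g j (ρ ω j.1 j.2) ∂P') :
    IdentDistrib η ρ P P' := by
  have hηm := measurable_skorokhodSpace hη
  have hρm := measurable_skorokhodSpace hρ
  refine ⟨hηm.aemeasurable, hρm.aemeasurable, ?_⟩
  set ev : SkorokhodSpace Config → ℝ≥0 × ℤ → ℝ≥0 := fun f j => f j.1 j.2 with hev
  have hηe : Measurable (ev ∘ η) := measurable_pi_lambda _ fun j =>
    (measurable_pi_apply j.2).comp (hη j.1)
  have hρe : Measurable (ev ∘ ρ) := measurable_pi_lambda _ fun j =>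
    (measurable_pi_apply j.2).comp (hρ j.1)
  have hlaw : P.map (ev ∘ η) = P'.map (ev ∘ ρ) := by
    have : IsProbabilityMeasure (P.map (ev ∘ η)) := Measure.isProbabilityMeasure_map hηe.aemeasurable
    have : IsProbabilityMeasure (P'.map (ev ∘ ρ)) :=
      Measure.isProbabilityMeasure_map hρe.aemeasurable
    have hproj : ∀ I : Finset (ℝ≥0 × ℤ), (P.map (ev ∘ η)).map I.restrict =
        (P'.map (ev ∘ ρ)).map I.restrict := by
      intro I
      have hI : Measurable (I.restrict (π := fun _ : ℝ≥0 × ℤ => ℝ≥0)) := I.measurable_restrict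
      rw [Measure.map_map hI hηe, Measure.map_map hI hρe]
      have : IsProbabilityMeasure (P.map (I.restrict ∘ ev ∘ η)) :=
        Measure.isProbabilityMeasure_map (hI.comp hηe).aemeasurable
      have : IsProbabilityMeasure (P'.map (I.restrict ∘ ev ∘ ρ)) :=
        Measure.isProbabilityMeasure_map (hI.comp hρe).aemeasurable
      refine map_pi_eq_of_integral_prod_eq fun f => ?_
      have hs : StronglyMeasurable fun x : I → ℝ≥0 => ∏ i, f i (x i) :=
        (Finset.measurable_fun_prod _ fun i _ => (f i).continuous.measurable.comp
          (measurable_pi_apply i)).stronglyMeasurable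
      rw [integral_map (hI.comp hηe).aemeasurable hs.aestronglyMeasurable,
        integral_map (hI.comp hρe).aemeasurable hs.aestronglyMeasurable]
      classical
      have key := h I fun j => if hj : j ∈ I then f ⟨j, hj⟩ else 0
      convert key using 2
      · ext ω
        rw [← Finset.prod_coe_sort I]
        simp [hev]
      · ext ω
        rw [← Finset.prod_coe_sort I]
        simp [hev]
    exact IsProjectiveLimit.unique (P := fun I => (P'.map (ev ∘ ρ)).map I.restrict)
      (fun I => hproj I) (fun I => rfl)
  -- The evaluations generate a σ-algebra that contains the Borel σ-algebra.
  have hle : borel (SkorokhodSpace Config) ≤ MeasurableSpace.comap ev inferInstance := by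
    let m : MeasurableSpace (SkorokhodSpace Config) := MeasurableSpace.comap ev inferInstance
    -- The measurability criterion is applied to the identity, its domain carrying the σ-algebra of
    -- the evaluations.
    have hid : @Measurable _ _ m (borel _) (id : SkorokhodSpace Config → SkorokhodSpace Config) :=
      @measurable_skorokhodSpace _ _ _ _ _ _ _ m id fun t => by
        refine measurable_pi_lambda _ fun x => ?_
        exact (measurable_pi_apply (t, x)).comp (comap_measurable ev)
    intro s hs
    exact hid hs
  refine Measure.ext fun S hS => ?_
  obtain ⟨B, hB, rfl⟩ := hle S hS
  rw [Measure.map_apply hηm hS, Measure.map_apply hρm hS]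
  have := congrArg (fun μ => μ B) hlaw
  simpa only [Measure.map_apply hηe hB, Measure.map_apply hρe hB, Set.preimage_comp] using this

end Law

/-! ### The walk in a fixed environment -/

section Walk

/-- The Poisson times of every bond go to infinity. -/
def Environment.Unbounded (e : Environment) : Prop :=
  ∀ x, Tendsto (e.ring x) atTop atTop

/-- The bond `(x, x+1)` does not ring during `(s, t]`. -/
def Environment.Silent (e : Environment) (x : ℤ) (s t : ℝ) : Prop :=
  ∀ j, e.ring x j ∉ Set.Ioc s t

/-- Almost sure properties of the environment under which the walk is well defined. -/
structure Environment.IsGood (e : Environment) : Prop where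
  strictMono : ∀ x, StrictMono (e.ring x)
  pos : ∀ x, 0 < e.ring x 0
  unbounded : e.Unbounded
  mark_mem : ∀ x j, e.mark x j ∈ Set.Icc (0 : ℝ) 1
  silent_left : ∀ (T : ℝ) (M : ℤ), ∃ x ≤ M, e.Silent x 0 T
  silent_right : ∀ (T : ℝ) (M : ℤ), ∃ x ≥ M, e.Silent x 0 T

variable {e e' : Environment} {x y a b : ℤ} {s t : ℝ}

theorem Environment.Silent.mono (h : e.Silent x s t) {s' t' : ℝ} (hs : s ≤ s') (ht : t' ≤ t) :
    e.Silent x s' t' := fun j hj => h j ⟨hs.trans_lt hj.1, hj.2.trans ht⟩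

theorem Environment.Unbounded.lt_nextRing (he : e.Unbounded) (x : ℤ) (s : ℝ) :
    s < e.nextRing x s :=
  Nat.sInf_mem (s := {j | s < e.ring x j}) ((he x).eventually_gt_atTop s).exists

theorem Environment.nextIndex_le {j : ℕ} (h : s < e.ring x j) : e.nextIndex x s ≤ j :=
  Nat.sInf_le h

theorem Environment.Silent.lt_nextRing (h : e.Silent x s t) {r : ℝ}
    (hr : s < e.nextRing x r) : t < e.nextRing x r := by
  by_contra! hle
  exact h _ ⟨hr, hle⟩

/-- The time of the step that follows the time and position `p`. -/
def stepTime (e : Environment) (p : ℝ × ℤ) : ℝ :=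
  min (e.nextRing (p.2 - 1) p.1) (e.nextRing p.2 p.1)

theorem walkStep_fst (e : Environment) (u : ℝ) (p : ℝ × ℤ) : (walkStep e u p).1 = stepTime e p := by
  unfold walkStep stepTime
  by_cases h : e.nextRing (p.2 - 1) p.1 < e.nextRing p.2 p.1
  · rw [if_pos h, min_eq_left h.le]
  · rw [if_neg h, min_eq_right (not_lt.1 h)]

/-- A step can change the side of the bond `(a, a+1)` only if that bond rings at the time of the
step. -/
theorem walkStep_snd_le_iff {u : ℝ} {p : ℝ × ℤ} (h : ∀ j, e.ring a j ≠ (walkStep e u p).1) :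
    (walkStep e u p).2 ≤ a ↔ p.2 ≤ a := by
  unfold walkStep at h ⊢
  have key : ∀ b r, (∀ j, e.ring a j ≠ e.nextRing b r) → b ≠ a := by
    rintro b r hb rfl
    exact hb _ rfl
  split_ifs at h ⊢ with h1 h2 h2
  · have := key _ _ h; simp only; omega
  · rfl
  · rfl
  · have := key _ _ h; simp only; omega

theorem walkStep_fst_mem (e : Environment) (u : ℝ) (p : ℝ × ℤ) :
    ∃ b, (b = p.2 - 1 ∨ b = p.2) ∧ ∃ j, (walkStep e u p).1 = e.ring b j := by
  rw [walkStep_fst, stepTime]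
  rcases min_choice (e.nextRing (p.2 - 1) p.1) (e.nextRing p.2 p.1) with h | h <;> rw [h]
  · exact ⟨_, Or.inl rfl, _, rfl⟩
  · exact ⟨_, Or.inr rfl, _, rfl⟩

variable {u : ℕ → unitInterval}

theorem walkChain_lt_succ (he : e.Unbounded) (n : ℕ) :
    (walkChain e s y u n).1 < (walkChain e s y u (n + 1)).1 := by
  rw [walkChain, walkStep_fst]
  exact lt_min (he.lt_nextRing _ _) (he.lt_nextRing _ _)

theorem strictMono_walkChain (he : e.Unbounded) :
    StrictMono fun n => (walkChain e s y u n).1 :=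
  strictMono_nat_of_lt_succ (walkChain_lt_succ he)

/-- The number of steps taken up to time `t` by the walk started from `y` at time `0`. -/
def walkIndex (e : Environment) (y : ℤ) (u : ℕ → unitInterval) (t : ℝ) : ℕ :=
  sInf {n | t < (walkChain e 0 y u (n + 1)).1}

theorem walk_eq : walk e 0 y u t = (walkChain e 0 y u (walkIndex e y u t)).2 := rfl

theorem walkChain_mem_block (he : e.Unbounded) (ha : e.Silent a 0 t) (hb : e.Silent b 0 t)
    (hy : y ∈ Set.Ioc a b) (n : ℕ) (hn : (walkChain e 0 y u n).1 ≤ t) :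
    (walkChain e 0 y u n).2 ∈ Set.Ioc a b := by
  induction n with
  | zero => exact hy
  | succ n ih =>
    have h1 := walkChain_lt_succ (y := y) (u := u) (s := 0) he n
    have h0 : 0 < (walkChain e 0 y u (n + 1)).1 :=
      (strictMono_walkChain (y := y) (u := u) (s := 0) he) n.succ_pos
    have h2 := ih (h1.le.trans hn)
    have key : ∀ c, e.Silent c 0 t →
        ((walkChain e 0 y u (n + 1)).2 ≤ c ↔ (walkChain e 0 y u n).2 ≤ c) := fun c hc =>
      walkStep_snd_le_iff fun j hj => hc j (hj ▸ ⟨h0, hn⟩)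
    exact ⟨not_le.1 fun h => absurd ((key a ha).1 h) (not_le.2 h2.1), (key b hb).2 h2.2⟩

/-- The walk does not explode. Otherwise all its step times would lie in `(0, t]`; silent bonds keep
it in a finite block, whose bonds ring finitely often before `t`, while the step times are strictly
increasing. -/
theorem Environment.IsGood.exists_lt_walkChain (he : e.IsGood) (y : ℤ) (u : ℕ → unitInterval) (t : ℝ) :
    ∃ n, t < (walkChain e 0 y u (n + 1)).1 := by
  by_contra! h
  obtain ⟨a, hay, ha⟩ := he.silent_left t (y - 1)
  obtain ⟨b, hby, hb⟩ := he.silent_right t y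
  have hfin : (⋃ x ∈ Set.Icc a b, e.ring x '' {j | e.ring x j ≤ t}).Finite := by
    refine (Set.finite_Icc a b).biUnion fun x _ => Set.Finite.image _ ?_
    have h1 := ((he.unbounded x).eventually_gt_atTop t)
    rw [← Nat.cofinite_eq_atTop, eventually_cofinite] at h1
    simpa using h1
  refine Set.infinite_range_of_injective
    (f := fun n : ℕ => (walkChain e 0 y u (n + 1)).1) ?_ (hfin.subset ?_)
  · exact ((strictMono_walkChain he.unbounded).comp (fun _ _ h => Nat.succ_lt_succ h)).injective
  · rintro _ ⟨n, rfl⟩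
    have h1 := walkChain_mem_block (u := u) he.unbounded ha hb ⟨by omega, hby⟩ n
      ((walkChain_lt_succ he.unbounded n).le.trans (h n))
    obtain ⟨c, hc, j, hj⟩ := walkStep_fst_mem e (u n) (walkChain e 0 y u n)
    refine Set.mem_iUnion₂.2 ⟨c, ⟨?_, ?_⟩, j, ?_, hj.symm⟩
    · have := h1.1; omega
    · have := h1.2; omega
    · exact hj.symm.trans_le (h n)

theorem Environment.IsGood.lt_walkChain_walkIndex (he : e.IsGood) :
    t < (walkChain e 0 y u (walkIndex e y u t + 1)).1 :=
  Nat.sInf_mem (he.exists_lt_walkChain y u t)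

theorem walkChain_walkIndex_le (ht : 0 ≤ t) : (walkChain e 0 y u (walkIndex e y u t)).1 ≤ t := by
  rcases h : walkIndex e y u t with _ | n
  · exact ht
  · by_contra! hlt
    have := Nat.sInf_le (s := {n | t < (walkChain e 0 y u (n + 1)).1}) hlt
    rw [walkIndex] at h
    omega

theorem Environment.IsGood.walkIndex_eq (he : e.IsGood) (ht : 0 ≤ t) {n : ℕ}
    (h : (walkChain e 0 y u n).1 ≤ t) (h' : t < (walkChain e 0 y u (n + 1)).1) :
    walkIndex e y u t = n := by
  have hm := strictMono_walkChain (s := 0) (y := y) (u := u) he.unbounded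
  have h1 := hm.lt_iff_lt.1 ((walkChain_walkIndex_le ht).trans_lt h')
  have h2 := hm.lt_iff_lt.1 (h.trans_lt he.lt_walkChain_walkIndex)
  omega

theorem Environment.IsGood.walk_zero (he : e.IsGood) : walk e 0 y u 0 = y := by
  have : walkIndex e y u 0 = 0 := he.walkIndex_eq le_rfl le_rfl
    ((strictMono_walkChain (s := 0) (y := y) (u := u) he.unbounded) one_pos)
  rw [walk_eq, this, walkChain]

/-- The walk does not cross a silent bond. -/
theorem Environment.IsGood.walk_le_iff (he : e.IsGood) (hs : 0 ≤ s) (hst : s ≤ t) (ha : e.Silent a s t) :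
    walk e 0 y u t ≤ a ↔ walk e 0 y u s ≤ a := by
  have hm := strictMono_walkChain (s := 0) (y := y) (u := u) he.unbounded
  have h0 : walkIndex e y u s ≤ walkIndex e y u t := by
    have := hm.lt_iff_lt.1 ((walkChain_walkIndex_le hs).trans_lt
      (hst.trans_lt (he.lt_walkChain_walkIndex (y := y) (u := u))))
    omega
  have key : ∀ n, walkIndex e y u s ≤ n → n ≤ walkIndex e y u t →
      ((walkChain e 0 y u n).2 ≤ a ↔ walk e 0 y u s ≤ a) := by
    intro n hn
    induction n, hn using Nat.le_induction with
    | base => exact fun _ => Iff.rfl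
    | succ n hn ih =>
      intro hnt
      rw [← ih (by omega)]
      have h1 : s < (walkChain e 0 y u (n + 1)).1 :=
        he.lt_walkChain_walkIndex.trans_le (hm.monotone (Nat.succ_le_succ hn))
      have h2 : (walkChain e 0 y u (n + 1)).1 ≤ t :=
        (hm.monotone hnt).trans (walkChain_walkIndex_le (hs.trans hst))
      exact walkStep_snd_le_iff fun j hj => ha j (by rw [hj]; exact ⟨h1, h2⟩)
  exact key _ h0 le_rfl

theorem Environment.IsGood.walk_eq_iff (he : e.IsGood) (hs : 0 ≤ s) (hst : s ≤ t) (hx : e.Silent (x - 1) s t)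
    (hx' : e.Silent x s t) : walk e 0 y u t = x ↔ walk e 0 y u s = x := by
  have h1 := he.walk_le_iff (y := y) (u := u) hs hst hx
  have h2 := he.walk_le_iff (y := y) (u := u) hs hst hx'
  omega

/-- The bond `(x, x+1)` rings exactly once during `(s, t]`, and it is its `j`-th time. -/
def Environment.RingsOnce (e : Environment) (x : ℤ) (s t : ℝ) (j : ℕ) : Prop :=
  e.ring x j ∈ Set.Ioc s t ∧ ∀ k, e.ring x k ∈ Set.Ioc s t → k = j

/-- Both neighbouring bonds being silent, the first step after `s` from `x` or `x + 1` is the single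
ring of the bond, and the next one comes after `t`. So one uniform variable decides the position,
with the same rule for both starting sites. -/
theorem Environment.IsGood.walkChain_of_ringsOnce (he : e.IsGood) (hx : e.Silent (x - 1) s t)
    (hx' : e.Silent (x + 1) s t) {j : ℕ} (hj : e.RingsOnce x s t j) {n : ℕ}
    (hn : (walkChain e 0 y u n).1 ≤ s) (hn' : s < (walkChain e 0 y u (n + 1)).1)
    (hpos : (walkChain e 0 y u n).2 = x ∨ (walkChain e 0 y u n).2 = x + 1) :
    (walkChain e 0 y u (n + 1)).1 ≤ t ∧
      (walkChain e 0 y u (n + 1)).2 = (if (u n : ℝ) < e.mark x j then x else x + 1) ∧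
      t < (walkChain e 0 y u (n + 2)).1 := by
  have hnext : ∀ r, r ≤ s → s < e.nextRing x r → e.nextIndex x r = j := fun r hr hsr => by
    refine hj.2 _ ⟨hsr, le_trans ?_ hj.1.2⟩
    exact (he.strictMono x).monotone (Environment.nextIndex_le (hr.trans_lt hj.1.1))
  have hstep : (walkChain e 0 y u (n + 1)).1 = e.ring x j ∧
      (walkChain e 0 y u (n + 1)).2 = (if (u n : ℝ) < e.mark x j then x else x + 1) := by
    rw [walkChain, walkStep_fst, stepTime, lt_min_iff] at hn'
    rw [walkChain]
    generalize walkChain e 0 y u n = p at hn hn' hpos ⊢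
    rcases hpos with hp | hp
    · rw [hp] at hn'
      have h1 := hx.lt_nextRing hn'.1
      have h2 := hnext _ hn hn'.2
      have h3 : e.nextRing x p.1 = e.ring x j := by rw [Environment.nextRing, h2]
      have h4 : ¬ e.nextRing (x - 1) p.1 < e.nextRing x p.1 := by
        rw [h3, not_lt]; exact hj.1.2.trans h1.le
      rw [h3] at h4
      simp [walkStep, hp, if_neg h4, h3, Environment.nextMark, h2]
    · rw [hp, add_sub_cancel_right] at hn'
      have h1 := hx'.lt_nextRing hn'.2
      have h2 := hnext _ hn hn'.1
      have h3 : e.nextRing x p.1 = e.ring x j := by rw [Environment.nextRing, h2]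
      have h4 : e.nextRing x p.1 < e.nextRing (x + 1) p.1 := by
        rw [h3]; exact hj.1.2.trans_lt h1
      rw [h3] at h4
      simp [walkStep, hp, if_pos h4, h3, Environment.nextMark, h2]
  refine ⟨hstep.1.trans_le hj.1.2, hstep.2, ?_⟩
  have hlate : ∀ b, b = x - 1 ∨ b = x ∨ b = x + 1 → t < e.nextRing b (e.ring x j) := by
    intro b hb
    have h1 := he.unbounded.lt_nextRing b (e.ring x j)
    have h2 := hj.1.1.trans h1
    rcases hb with rfl | rfl | rfl
    · exact hx.lt_nextRing h2
    · by_contra! hle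
      have h3 := hj.2 _ ⟨h2, hle⟩
      rw [Environment.nextRing, h3] at h1
      exact lt_irrefl _ h1
    · exact hx'.lt_nextRing h2
  rw [walkChain, walkStep_fst, stepTime, hstep.1, hstep.2]
  refine lt_min (hlate _ ?_) (hlate _ ?_) <;> split_ifs <;> omega

theorem Environment.IsGood.walk_of_ringsOnce (he : e.IsGood) (hs : 0 ≤ s) (hst : s ≤ t)
    (hx : e.Silent (x - 1) s t) (hx' : e.Silent (x + 1) s t) {j : ℕ} (hj : e.RingsOnce x s t j)
    (hpos : walk e 0 y u s = x ∨ walk e 0 y u s = x + 1) :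
    walk e 0 y u t = if (u (walkIndex e y u s) : ℝ) < e.mark x j then x else x + 1 := by
  obtain ⟨h1, h2, h3⟩ := he.walkChain_of_ringsOnce hx hx' hj (walkChain_walkIndex_le hs)
    he.lt_walkChain_walkIndex hpos
  rw [← h2, walk_eq, he.walkIndex_eq (hs.trans hst) h1 h3]

/-! ### The quenched kernel -/

instance : IsProbabilityMeasure quenchedMeasure := by
  unfold quenchedMeasure
  infer_instance

/-- The first `n` uniform variables. -/
def firstUniforms (n : ℕ) (u : ℕ → unitInterval) (i : Finset.range n) : unitInterval := u i

theorem measurable_firstUniforms (n : ℕ) : Measurable (firstUniforms n) :=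
  measurable_pi_lambda _ fun i => measurable_pi_apply (i : ℕ)

theorem measurableSet_walkChain (e : Environment) (s : ℝ) (y : ℤ) (n : ℕ) (S : Set (ℝ × ℤ)) :
    MeasurableSet[MeasurableSpace.comap (firstUniforms n) inferInstance]
      {u | walkChain e s y u n ∈ S} := by
  induction n generalizing S with
  | zero => simp [walkChain]
  | succ n ih =>
    have hle : MeasurableSpace.comap (firstUniforms n) inferInstance ≤
        MeasurableSpace.comap (firstUniforms (n + 1)) inferInstance := by
      rintro _ ⟨B, hB, rfl⟩
      have hr : Measurable fun (v : Finset.range (n + 1) → unitInterval) (i : Finset.range n) =>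
          v ⟨i, Finset.mem_range.2 (Nat.lt_succ_of_lt (Finset.mem_range.1 i.2))⟩ :=
        measurable_pi_lambda _ fun i => measurable_pi_apply _
      exact ⟨_, hr hB, rfl⟩
    have hc : Measurable[MeasurableSpace.comap (firstUniforms (n + 1)) inferInstance, ⊤]
        fun u => walkChain e s y u n := fun S' _ => hle _ (ih S')
    have hu : Measurable[MeasurableSpace.comap (firstUniforms (n + 1)) inferInstance]
        fun u : ℕ → unitInterval => (u n : ℝ) :=
      (show Measurable fun v : Finset.range (n + 1) → unitInterval =>
        (v ⟨n, Finset.self_mem_range_succ n⟩ : ℝ) from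
          measurable_subtype_coe.comp (measurable_pi_apply _)).comp
            (comap_measurable (firstUniforms (n + 1)))
    -- `θ p` is the mark against which the step from `p` compares its uniform variable. The step
    -- depends on that variable only through this comparison, so `θ p - 1` and `θ p` represent the
    -- two cases; this allows arbitrary sets `S` in the induction.
    set θ : ℝ × ℤ → ℝ := fun p => if e.nextRing (p.2 - 1) p.1 < e.nextRing p.2 p.1 then
      e.nextMark (p.2 - 1) p.1 else e.nextMark p.2 p.1 with hθ
    have hstep : ∀ v p, walkStep e v p = if v < θ p then walkStep e (θ p - 1) p else
        walkStep e (θ p) p := by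
      intro v p
      simp only [walkStep, hθ]
      split_ifs <;> first | rfl | (exfalso; linarith)
    have hset : {u | walkChain e s y u (n + 1) ∈ S} =
        ({u | (u n : ℝ) < θ (walkChain e s y u n)} ∩
          {u | walkChain e s y u n ∈ {p | walkStep e (θ p - 1) p ∈ S}}) ∪
        ({u | (u n : ℝ) < θ (walkChain e s y u n)}ᶜ ∩
          {u | walkChain e s y u n ∈ {p | walkStep e (θ p) p ∈ S}}) := by
      ext u
      simp only [walkChain, Set.mem_ofPred_eq, Set.mem_union, Set.mem_inter_iff, Set.mem_compl_iff]
      rw [hstep]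
      split_ifs with h <;> simp [h]
    have hθm : Measurable[⊤] θ := fun _ _ => trivial
    have hlt : MeasurableSet[MeasurableSpace.comap (firstUniforms (n + 1)) inferInstance]
        {u | (u n : ℝ) < θ (walkChain e s y u n)} :=
      measurableSet_lt hu (hθm.comp hc)
    rw [hset]
    exact (hlt.inter (hle _ (ih _))).union (hlt.compl.inter (hle _ (ih _)))

theorem indepFun_firstUniforms (n : ℕ) :
    IndepFun (firstUniforms n) (fun u => u n) quenchedMeasure := by
  have h1 : iIndepFun (fun (i : ℕ) (u : ℕ → unitInterval) => u i) quenchedMeasure :=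
    iIndepFun_infinitePi (P := fun _ : ℕ => (volume : Measure unitInterval))
      (X := fun _ => id) fun _ => measurable_id
  have h2 := h1.indepFun_finset (Finset.range n) {n} (by simp) fun i => measurable_pi_apply i
  exact h2.comp measurable_id (measurable_pi_apply (⟨n, Finset.mem_singleton_self n⟩ : ({n} : Finset ℕ)))

theorem quenchedMeasure_inter (n : ℕ) {A : Set (ℕ → unitInterval)}
    (hA : MeasurableSet[MeasurableSpace.comap (firstUniforms n) inferInstance] A) {p : ℝ}
    (hp : p ∈ Set.Icc (0 : ℝ) 1) :
    quenchedMeasure (A ∩ {u | (u n : ℝ) < p}) = ENNReal.ofReal p * quenchedMeasure A := by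
  obtain ⟨B, hB, rfl⟩ := hA
  have h1 := (indepFun_firstUniforms n).measure_inter_preimage_eq_mul B (Set.Iio ⟨p, hp⟩) hB
    measurableSet_Iio
  have h2 : quenchedMeasure ((fun u : ℕ → unitInterval => u n) ⁻¹' Set.Iio ⟨p, hp⟩) =
      ENNReal.ofReal p := by
    rw [← Measure.map_apply (measurable_pi_apply n) measurableSet_Iio, quenchedMeasure,
      Measure.infinitePi_map_eval, unitInterval.volume_Iio]
  rw [h2, mul_comm] at h1
  exact h1

/-- The time of a step does not depend on the uniform variable used in it (`walkStep_fst`). Hence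
having taken exactly `n` steps by time `t`, and the position then, are decided by the first `n`
variables. -/
theorem Environment.IsGood.measurableSet_walk_inter (he : e.IsGood) (ht : 0 ≤ t) (S : Set ℤ) (n : ℕ) :
    MeasurableSet[MeasurableSpace.comap (firstUniforms n) inferInstance]
      {u | walk e 0 y u t ∈ S ∧ walkIndex e y u t = n} := by
  convert measurableSet_walkChain e 0 y n {p | p.1 ≤ t ∧ t < stepTime e p ∧ p.2 ∈ S} using 1
  ext u
  simp only [Set.mem_ofPred_eq]
  constructor
  · rintro ⟨h1, rfl⟩
    refine ⟨walkChain_walkIndex_le ht, ?_, h1⟩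
    rw [← walkStep_fst e (u (walkIndex e y u t))]
    exact he.lt_walkChain_walkIndex
  · rintro ⟨h1, h2, h3⟩
    rw [← walkStep_fst e (u n)] at h2
    have h4 := he.walkIndex_eq ht h1 h2
    exact ⟨by rw [walk_eq, h4]; exact h3, h4⟩

theorem Environment.IsGood.measurableSet_walk (he : e.IsGood) (ht : 0 ≤ t) (S : Set ℤ) :
    MeasurableSet {u | walk e 0 y u t ∈ S} := by
  have : {u | walk e 0 y u t ∈ S} = ⋃ n, {u | walk e 0 y u t ∈ S ∧ walkIndex e y u t = n} := by
    ext u; simp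
  rw [this]
  exact MeasurableSet.iUnion fun n =>
    (measurable_firstUniforms n).comap_le _ (he.measurableSet_walk_inter ht S n)

/-- On each event that `n` steps have been taken, the variable of index `n` is still unused, hence
independent of the position; sum over `n`. -/
theorem Environment.IsGood.quenchedMeasure_walk_inter (he : e.IsGood) (ht : 0 ≤ t) (S : Set ℤ) {p : ℝ}
    (hp : p ∈ Set.Icc (0 : ℝ) 1) :
    quenchedMeasure {u | walk e 0 y u t ∈ S ∧ (u (walkIndex e y u t) : ℝ) < p} =
      ENNReal.ofReal p * quenchedMeasure {u | walk e 0 y u t ∈ S} := by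
  have hm := fun n => he.measurableSet_walk_inter (y := y) ht S n
  have hm' := fun n => (measurable_firstUniforms n).comap_le _ (hm n)
  have h1 : {u | walk e 0 y u t ∈ S ∧ (u (walkIndex e y u t) : ℝ) < p} =
      ⋃ n, ({u | walk e 0 y u t ∈ S ∧ walkIndex e y u t = n} ∩ {u | (u n : ℝ) < p}) := by
    ext u
    simp only [Set.mem_ofPred_eq, Set.mem_iUnion, Set.mem_inter_iff]
    constructor
    · rintro ⟨h1, h2⟩; exact ⟨_, ⟨h1, rfl⟩, h2⟩
    · rintro ⟨n, ⟨h1, rfl⟩, h2⟩; exact ⟨h1, h2⟩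
  have h2 : {u | walk e 0 y u t ∈ S} = ⋃ n, {u | walk e 0 y u t ∈ S ∧ walkIndex e y u t = n} := by
    ext u; simp
  have hd : Pairwise (Function.onFun Disjoint
      fun n => {u | walk e 0 y u t ∈ S ∧ walkIndex e y u t = n}) := by
    intro m n hmn
    refine Set.disjoint_left.2 fun u hu hu' => hmn (hu.2.symm.trans hu'.2)
  have hlt : ∀ n : ℕ, MeasurableSet {u : ℕ → unitInterval | (u n : ℝ) < p} := fun n =>
    measurableSet_lt (measurable_subtype_coe.comp (measurable_pi_apply n)) measurable_const
  rw [h1, h2, measure_iUnion hd hm', measure_iUnion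
    (fun m n hmn => (hd hmn).mono Set.inter_subset_left Set.inter_subset_left)
    (fun n => (hm' n).inter (hlt n)), ← ENNReal.tsum_mul_left]
  exact tsum_congr fun n => quenchedMeasure_inter n (hm n) hp

theorem Environment.IsGood.quenchedKernel_zero (he : e.IsGood) :
    quenchedKernel e 0 0 y x = if y = x then 1 else 0 := by
  simp only [quenchedKernel, he.walk_zero]
  split_ifs with h <;> simp [h]

theorem Environment.IsGood.quenchedKernel_of_silent (he : e.IsGood) (hs : 0 ≤ s) (hst : s ≤ t)
    (hx : e.Silent (x - 1) s t) (hx' : e.Silent x s t) :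
    quenchedKernel e 0 t y x = quenchedKernel e 0 s y x := by
  simp only [quenchedKernel, he.walk_eq_iff hs hst hx hx']

/-- The outer bonds are silent, so the mass on `{x, x+1}` is conserved. The fraction going left is
the probability that an unused uniform variable is below the mark; the value at `x + 1` follows by
subtraction. -/
theorem Environment.IsGood.quenchedKernel_of_ringsOnce (he : e.IsGood) (hs : 0 ≤ s) (hst : s ≤ t)
    (hx : e.Silent (x - 1) s t) (hx' : e.Silent (x + 1) s t) {j : ℕ}
    (hj : e.RingsOnce x s t j) :
    quenchedKernel e 0 t y x =
        e.mark x j * (quenchedKernel e 0 s y x + quenchedKernel e 0 s y (x + 1)) ∧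
      quenchedKernel e 0 t y (x + 1) =
        (1 - e.mark x j) * (quenchedKernel e 0 s y x + quenchedKernel e 0 s y (x + 1)) := by
  have hmem : ∀ u, (walk e 0 y u t = x ∨ walk e 0 y u t = x + 1) ↔
      (walk e 0 y u s = x ∨ walk e 0 y u s = x + 1) := by
    intro u
    have h1 := he.walk_le_iff (y := y) (u := u) hs hst hx
    have h2 := he.walk_le_iff (y := y) (u := u) hs hst hx'
    omega
  have hmeas : ∀ {r : ℝ}, 0 ≤ r → ∀ z, MeasurableSet {u | walk e 0 y u r = z} := fun hr z =>
    he.measurableSet_walk hr {z}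
  have hpair : ∀ r : ℝ, 0 ≤ r → quenchedMeasure.real {u | walk e 0 y u r ∈ ({x, x + 1} : Set ℤ)} =
      quenchedKernel e 0 r y x + quenchedKernel e 0 r y (x + 1) := by
    intro r hr
    rw [quenchedKernel, quenchedKernel, ← measureReal_union ?_ (hmeas hr _)]
    · rfl
    · refine Set.disjoint_left.2 fun u hu hu' => ?_
      simp only [Set.mem_ofPred_eq] at hu hu'
      omega
  have hleft : quenchedKernel e 0 t y x =
      e.mark x j * (quenchedKernel e 0 s y x + quenchedKernel e 0 s y (x + 1)) := by
    rw [← hpair s hs, quenchedKernel]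
    have h1 : {u | walk e 0 y u t = x} = {u | walk e 0 y u s ∈ ({x, x + 1} : Set ℤ) ∧
        (u (walkIndex e y u s) : ℝ) < e.mark x j} := by
      ext u
      simp only [Set.mem_ofPred_eq, Set.mem_insert_iff, Set.mem_singleton_iff]
      constructor
      · intro h
        have h2 := (hmem u).1 (Or.inl h)
        refine ⟨h2, ?_⟩
        have h3 := he.walk_of_ringsOnce hs hst hx hx' hj h2
        by_contra h4
        rw [if_neg h4] at h3
        omega
      · rintro ⟨h2, h3⟩
        rw [he.walk_of_ringsOnce hs hst hx hx' hj h2, if_pos h3]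
    rw [h1, measureReal_def, he.quenchedMeasure_walk_inter hs _ (he.mark_mem x j),
      ENNReal.toReal_mul, ENNReal.toReal_ofReal (he.mark_mem x j).1, measureReal_def]
  refine ⟨hleft, ?_⟩
  have htot : quenchedKernel e 0 t y x + quenchedKernel e 0 t y (x + 1) =
      quenchedKernel e 0 s y x + quenchedKernel e 0 s y (x + 1) := by
    rw [← hpair s hs, ← hpair t (hs.trans hst)]
    congr 1
    ext u
    exact hmem u
  linear_combination htot - hleft

theorem Environment.IsGood.quenchedKernel_eq_zero (he : e.IsGood) (ht : 0 ≤ t) (ha : e.Silent a 0 t)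
    (hxy : (y ≤ a ∧ a < x) ∨ (x ≤ a ∧ a < y)) : quenchedKernel e 0 t y x = 0 := by
  have : {u | walk e 0 y u t = x} = ∅ := by
    ext u
    have h1 := he.walk_le_iff (y := y) (u := u) le_rfl ht ha
    rw [he.walk_zero] at h1
    simp only [Set.mem_ofPred_eq, Set.mem_empty_iff_false, iff_false]
    omega
  rw [quenchedKernel, this, measureReal_empty]

theorem Environment.IsGood.finite_support_quenchedKernel (he : e.IsGood) (ht : 0 ≤ t) (x : ℤ) :
    (Function.support fun y => quenchedKernel e 0 t y x).Finite := by
  obtain ⟨a, hax, ha⟩ := he.silent_left t (x - 1)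
  obtain ⟨b, hbx, hb⟩ := he.silent_right t x
  refine (Set.finite_Ioc a b).subset fun y hy => ?_
  by_contra h
  rw [Set.mem_Ioc, not_and_or, not_lt, not_le] at h
  rcases h with h | h
  · exact hy (he.quenchedKernel_eq_zero ht ha (Or.inl ⟨h, by omega⟩))
  · exact hy (he.quenchedKernel_eq_zero ht hb (Or.inr ⟨hbx, h⟩))

/-! ### The walk depends only on the past -/

/-- Up to time `t`, the environments `e` and `e'` have the same Poisson times and marks. -/
def AgreeUpTo (e e' : Environment) (t : ℝ) : Prop :=
  ∀ x j, e.ring x j ≤ t ∨ e'.ring x j ≤ t →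
    e.ring x j = e'.ring x j ∧ e.mark x j = e'.mark x j

theorem AgreeUpTo.nextIndex_eq (h : AgreeUpTo e e' t) (hs : s ≤ t) :
    e.nextIndex x s = e'.nextIndex x s := by
  unfold Environment.nextIndex
  congr 1
  ext j
  simp only [Set.mem_ofPred_eq]
  constructor
  · intro h1
    by_contra! h2
    rw [(h x j (Or.inr (h2.trans hs))).1] at h1
    exact absurd h1 (not_lt.2 h2)
  · intro h1
    by_contra! h2
    rw [← (h x j (Or.inl (h2.trans hs))).1] at h1
    exact absurd h1 (not_lt.2 h2)

theorem AgreeUpTo.nextRing_eq (h : AgreeUpTo e e' t) (hs : s ≤ t) (x : ℤ) :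
    (t < e.nextRing x s ∧ t < e'.nextRing x s) ∨
      (e.nextRing x s ≤ t ∧ e.nextRing x s = e'.nextRing x s ∧
        e.nextMark x s = e'.nextMark x s) := by
  simp only [Environment.nextRing, Environment.nextMark, ← h.nextIndex_eq hs]
  by_cases h1 : e.ring x (e.nextIndex x s) ≤ t
  · exact Or.inr ⟨h1, h x _ (Or.inl h1)⟩
  · by_cases h2 : e'.ring x (e.nextIndex x s) ≤ t
    · have h3 := h x _ (Or.inr h2)
      exact absurd (h3.1.trans_le h2) h1
    · exact Or.inl ⟨not_le.1 h1, not_le.1 h2⟩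

theorem AgreeUpTo.walkStep_eq (h : AgreeUpTo e e' t) {p : ℝ × ℤ} (hp : p.1 ≤ t) (v : ℝ) :
    (walkStep e v p = walkStep e' v p ∧ (walkStep e v p).1 ≤ t) ∨
      (t < (walkStep e v p).1 ∧ t < (walkStep e' v p).1) := by
  have h1 := h.nextRing_eq hp (p.2 - 1)
  have h2 := h.nextRing_eq hp p.2
  rcases h1 with ⟨h1, h1'⟩ | ⟨h1, h1', h1''⟩ <;> rcases h2 with ⟨h2, h2'⟩ | ⟨h2, h2', h2''⟩
  · right
    rw [walkStep_fst, walkStep_fst]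
    exact ⟨lt_min h1 h2, lt_min h1' h2'⟩
  · left
    have h3 : ¬ e.nextRing (p.2 - 1) p.1 < e.nextRing p.2 p.1 := by linarith
    have h4 : ¬ e'.nextRing (p.2 - 1) p.1 < e'.nextRing p.2 p.1 := by linarith
    simp only [walkStep, if_neg h3, if_neg h4]
    exact ⟨by rw [h2', h2''], h2⟩
  · left
    have h3 : e.nextRing (p.2 - 1) p.1 < e.nextRing p.2 p.1 := by linarith
    have h4 : e'.nextRing (p.2 - 1) p.1 < e'.nextRing p.2 p.1 := by linarith
    simp only [walkStep, if_pos h3, if_pos h4]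
    exact ⟨by rw [h1', h1''], h1⟩
  · left
    refine ⟨?_, ?_⟩
    · simp only [walkStep, h1', h2', h1'', h2'']
    · rw [walkStep_fst]
      exact (min_le_left _ _).trans h1

/-- At each step the two chains either coincide at a time at most `s` or have both passed `s`. This
makes the profile at time `s` a function of the environment up to `s`. -/
theorem AgreeUpTo.walk_eq (h : AgreeUpTo e e' t) (he : e.Unbounded) (he' : e'.Unbounded)
    (hs : 0 ≤ s) (hst : s ≤ t) : walk e 0 y u s = walk e' 0 y u s := by
  have h' : AgreeUpTo e e' s := fun x j hj => h x j (hj.imp (le_trans · hst) (le_trans · hst))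
  have key : ∀ n, (walkChain e 0 y u n = walkChain e' 0 y u n ∧ (walkChain e 0 y u n).1 ≤ s) ∨
      (s < (walkChain e 0 y u n).1 ∧ s < (walkChain e' 0 y u n).1) := by
    intro n
    induction n with
    | zero => exact Or.inl ⟨rfl, hs⟩
    | succ n ih =>
      rcases ih with ⟨h1, h2⟩ | ⟨h1, h2⟩
      · have := h'.walkStep_eq h2 (u n)
        simp only [walkChain, ← h1]
        exact this
      · exact Or.inr ⟨h1.trans (walkChain_lt_succ he n), h2.trans (walkChain_lt_succ he' n)⟩
  have hindex : walkIndex e y u s = walkIndex e' y u s := by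
    unfold walkIndex
    congr 1
    ext n
    simp only [Set.mem_ofPred_eq]
    rcases key (n + 1) with ⟨h1, h2⟩ | ⟨h1, h2⟩
    · rw [← h1]
    · exact iff_of_true h1 h2
  rw [KMP.walk_eq, KMP.walk_eq, ← hindex]
  rcases key (walkIndex e y u s) with ⟨h1, -⟩ | ⟨h1, -⟩
  · rw [h1]
  · exact absurd (walkChain_walkIndex_le hs) (not_le.2 h1)

theorem AgreeUpTo.quenchedKernel_eq (h : AgreeUpTo e e' t) (he : e.Unbounded)
    (he' : e'.Unbounded) (hs : 0 ≤ s) (hst : s ≤ t) :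
    quenchedKernel e 0 s y x = quenchedKernel e' 0 s y x := by
  simp only [quenchedKernel, h.walk_eq he he' hs hst]

end Walk

/-! ### Measurability in the environment -/

section EnvMeasurable

variable {Θ : Type*} [MeasurableSpace Θ]

theorem measurable_sInf_nat {p : ℕ → Θ → Prop} (hp : ∀ n, MeasurableSet {θ | p n θ}) :
    Measurable fun θ => sInf {n | p n θ} := by
  refine measurable_to_countable' fun n => ?_
  -- The second set of the union accounts for `sInf ∅ = 0`.
  have h : (fun θ => sInf {n | p n θ}) ⁻¹' {n} =
      ({θ | p n θ} ∩ ⋂ k ∈ Set.Iio n, {θ | p k θ}ᶜ) ∪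
        ({θ | n = 0} ∩ ⋂ k, {θ | p k θ}ᶜ) := by
    ext θ
    simp only [Set.mem_preimage, Set.mem_singleton_iff, Set.mem_union, Set.mem_inter_iff,
      Set.mem_ofPred_eq, Set.mem_iInter, Set.mem_compl_iff, Set.mem_Iio]
    constructor
    · rintro rfl
      by_cases hne : {n | p n θ}.Nonempty
      · exact Or.inl ⟨Nat.sInf_mem hne, fun k hk => Nat.notMem_of_lt_sInf hk⟩
      · rw [Set.not_nonempty_iff_eq_empty] at hne
        refine Or.inr ⟨by simp [hne], fun k hk => ?_⟩
        have : k ∈ {n | p n θ} := hk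
        simp [hne] at this
    · rintro (⟨h1, h2⟩ | ⟨rfl, h2⟩)
      · exact le_antisymm (Nat.sInf_le h1) (le_csInf ⟨n, h1⟩ fun k hk => not_lt.1 fun h => h2 k h hk)
      · simp [h2]
  rw [h]
  exact ((hp n).inter (MeasurableSet.biInter (Set.to_countable _) fun k _ => (hp k).compl)).union
    ((MeasurableSet.const _).inter (MeasurableSet.iInter fun k => (hp k).compl))

theorem measurable_apply_countable {ι β : Type*} [MeasurableSpace ι] [Countable ι]
    [MeasurableSingletonClass ι] [MeasurableSpace β] {F : ι → Θ → β} (hF : ∀ i, Measurable (F i))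
    {k : Θ → ι} (hk : Measurable k) : Measurable fun θ => F (k θ) θ :=
  (measurable_from_prod_countable_right (f := fun q : ι × Θ => F q.1 q.2) hF).comp
    (hk.prodMk measurable_id)

/-- All the times and marks of the environment are measurable. -/
structure MeasurableEnv (env : Θ → Environment) : Prop where
  ring : ∀ x j, Measurable fun θ => (env θ).ring x j
  mark : ∀ x j, Measurable fun θ => (env θ).mark x j

theorem measurableEnv_mk :
    MeasurableEnv fun q : (ℤ → ℕ → ℝ) × (ℤ → ℕ → ℝ) => Environment.mk q.1 q.2 where
  ring x j := (measurable_pi_apply j).comp ((measurable_pi_apply x).comp measurable_fst)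
  mark x j := (measurable_pi_apply j).comp ((measurable_pi_apply x).comp measurable_snd)

variable {env : Θ → Environment}

theorem MeasurableEnv.comp (h : MeasurableEnv env) {Θ' : Type*} [MeasurableSpace Θ'] {g : Θ' → Θ}
    (hg : Measurable g) : MeasurableEnv fun θ => env (g θ) where
  ring x j := (h.ring x j).comp hg
  mark x j := (h.mark x j).comp hg

theorem MeasurableEnv.nextIndex (h : MeasurableEnv env) {s : Θ → ℝ} (hs : Measurable s) {x : Θ → ℤ}
    (hx : Measurable x) : Measurable fun θ => (env θ).nextIndex (x θ) (s θ) :=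
  measurable_apply_countable (F := fun x θ => (env θ).nextIndex x (s θ))
    (fun x => measurable_sInf_nat fun j => measurableSet_lt hs (h.ring x j)) hx

theorem MeasurableEnv.nextRing (h : MeasurableEnv env) {s : Θ → ℝ} (hs : Measurable s) {x : Θ → ℤ}
    (hx : Measurable x) : Measurable fun θ => (env θ).nextRing (x θ) (s θ) :=
  measurable_apply_countable (F := fun (i : ℤ × ℕ) θ => (env θ).ring i.1 i.2)
    (fun i => h.ring i.1 i.2) (hx.prodMk (h.nextIndex hs hx))

theorem MeasurableEnv.nextMark (h : MeasurableEnv env) {s : Θ → ℝ} (hs : Measurable s) {x : Θ → ℤ}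
    (hx : Measurable x) : Measurable fun θ => (env θ).nextMark (x θ) (s θ) :=
  measurable_apply_countable (F := fun (i : ℤ × ℕ) θ => (env θ).mark i.1 i.2)
    (fun i => h.mark i.1 i.2) (hx.prodMk (h.nextIndex hs hx))

theorem MeasurableEnv.walkStep (h : MeasurableEnv env) {v : Θ → ℝ} (hv : Measurable v)
    {p : Θ → ℝ × ℤ} (hp : Measurable p) : Measurable fun θ => KMP.walkStep (env θ) (v θ) (p θ) := by
  have hs : Measurable fun θ => (p θ).1 := hp.fst
  have hx : Measurable fun θ => (p θ).2 := hp.snd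
  have hx' : Measurable fun θ => (p θ).2 - 1 := hx.sub_const 1
  unfold KMP.walkStep
  refine Measurable.ite (measurableSet_lt (h.nextRing hs hx') (h.nextRing hs hx)) ?_ ?_
  · exact (h.nextRing hs hx').prodMk
      (Measurable.ite (measurableSet_lt hv (h.nextMark hs hx')) hx' hx)
  · exact (h.nextRing hs hx).prodMk
      (Measurable.ite (measurableSet_lt hv (h.nextMark hs hx)) hx (hx.add_const 1))

theorem MeasurableEnv.walk (h : MeasurableEnv env) {u : Θ → ℕ → unitInterval} (hu : Measurable u)
    (s : ℝ) (y : ℤ) (t : ℝ) : Measurable fun θ => KMP.walk (env θ) s y (u θ) t := by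
  have hc : ∀ n, Measurable fun θ => walkChain (env θ) s y (u θ) n := by
    intro n
    induction n with
    | zero => exact measurable_const
    | succ n ih =>
      exact h.walkStep (measurable_subtype_coe.comp ((measurable_pi_apply n).comp hu)) ih
  refine measurable_apply_countable (F := fun n θ => (walkChain (env θ) s y (u θ) n).2)
    (fun n => (hc n).snd) (measurable_sInf_nat fun n => ?_)
  exact measurableSet_lt measurable_const (hc (n + 1)).fst

theorem MeasurableEnv.quenchedKernel (h : MeasurableEnv env) (s t : ℝ) (y x : ℤ) :
    Measurable fun θ => KMP.quenchedKernel (env θ) s t y x := by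
  have hS : MeasurableSet {q : Θ × (ℕ → unitInterval) | KMP.walk (env q.1) s y q.2 t = x} :=
    (h.comp measurable_fst).walk measurable_snd s y t (measurableSet_singleton x)
  exact (measurable_measure_prodMk_left (ν := quenchedMeasure) hS).ennreal_toReal

end EnvMeasurable

/-! ### The averaged profile -/

section Profile

/-- The profile `ρ_t(x) = ∑_y ρ₀(y) K_t(y, x)` in a fixed environment. -/
def profile (ρ₀ : ℤ → ℝ≥0) (e : Environment) (t : ℝ) : Config :=
  fun x => ∑' y, ρ₀ y * (quenchedKernel e 0 t y x).toNNReal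

variable {ρ₀ : ℤ → ℝ≥0} {e e' : Environment} {x y z : ℤ} {s t : ℝ}

theorem quenchedKernel_nonneg : 0 ≤ quenchedKernel e s t y x := measureReal_nonneg

theorem MeasurableEnv.profile {Θ : Type*} [MeasurableSpace Θ] {env : Θ → Environment}
    (h : MeasurableEnv env) (ρ₀ : ℤ → ℝ≥0) (t : ℝ) : Measurable fun θ => KMP.profile ρ₀ (env θ) t :=
  measurable_pi_lambda _ fun x => Measurable.tsum fun y =>
    measurable_const.mul (h.quenchedKernel 0 t y x).real_toNNReal

theorem Environment.IsGood.summable_profile (he : e.IsGood) (ρ₀ : ℤ → ℝ≥0) (ht : 0 ≤ t) (x : ℤ) :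
    Summable fun y => ρ₀ y * (quenchedKernel e 0 t y x).toNNReal :=
  summable_of_hasFiniteSupport ((he.finite_support_quenchedKernel ht x).subset fun y hy => by
    rw [Function.mem_support] at hy ⊢
    intro h
    simp [h] at hy)

theorem Environment.IsGood.hasSum_profile (he : e.IsGood) (ρ₀ : ℤ → ℝ≥0) (ht : 0 ≤ t) (x : ℤ) :
    HasSum (fun y : ℤ => (ρ₀ y : ℝ) * quenchedKernel e 0 t y x) (profile ρ₀ e t x : ℝ) := by
  have h : HasSum (fun y => ((ρ₀ y * (quenchedKernel e 0 t y x).toNNReal : ℝ≥0) : ℝ))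
      (profile ρ₀ e t x : ℝ) := NNReal.hasSum_coe.2 (he.summable_profile ρ₀ ht x).hasSum
  simpa only [NNReal.coe_mul, Real.coe_toNNReal _ quenchedKernel_nonneg] using h

theorem Environment.IsGood.profile_zero (he : e.IsGood) : profile ρ₀ e 0 = ρ₀ := by
  ext x
  congr 1
  rw [profile, tsum_eq_single x fun y hy => by simp [he.quenchedKernel_zero, hy]]
  simp [he.quenchedKernel_zero]

theorem AgreeUpTo.profile_eq (h : AgreeUpTo e e' t) (he : e.Unbounded) (he' : e'.Unbounded)
    (hs : 0 ≤ s) (hst : s ≤ t) : profile ρ₀ e s = profile ρ₀ e' s := by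
  ext x
  simp only [profile, h.quenchedKernel_eq he he' hs hst]

theorem Environment.IsGood.profile_of_silent (he : e.IsGood) (hs : 0 ≤ s) (hst : s ≤ t)
    (hx : e.Silent (x - 1) s t) (hx' : e.Silent x s t) :
    profile ρ₀ e t x = profile ρ₀ e s x := by
  simp only [profile, he.quenchedKernel_of_silent hs hst hx hx']

theorem Environment.IsGood.profile_of_ringsOnce (he : e.IsGood) (hs : 0 ≤ s) (hst : s ≤ t)
    (hx : e.Silent (x - 1) s t) (hx' : e.Silent (x + 1) s t) {j : ℕ}
    (hj : e.RingsOnce x s t j) :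
    profile ρ₀ e t x = redistribute x (e.mark x j) (profile ρ₀ e s) x ∧
      profile ρ₀ e t (x + 1) = redistribute x (e.mark x j) (profile ρ₀ e s) (x + 1) := by
  have hB := he.mark_mem x j
  rw [redistribute_apply_left, redistribute_apply_right]
  have hsum : profile ρ₀ e s x + profile ρ₀ e s (x + 1) =
      ∑' y, ρ₀ y * (quenchedKernel e 0 s y x + quenchedKernel e 0 s y (x + 1)).toNNReal := by
    rw [profile, profile, ← (he.summable_profile ρ₀ hs x).tsum_add
      (he.summable_profile ρ₀ hs (x + 1))]
    refine tsum_congr fun y => ?_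
    rw [Real.toNNReal_add quenchedKernel_nonneg quenchedKernel_nonneg, mul_add]
  rw [hsum, ← NNReal.tsum_mul_left, ← NNReal.tsum_mul_left]
  have hK : ∀ y, 0 ≤ quenchedKernel e 0 s y x + quenchedKernel e 0 s y (x + 1) := fun y =>
    add_nonneg quenchedKernel_nonneg quenchedKernel_nonneg
  constructor
  · refine tsum_congr fun y => ?_
    rw [(he.quenchedKernel_of_ringsOnce hs hst hx hx' hj).1, Real.toNNReal_mul hB.1,
      mul_left_comm]
  · refine tsum_congr fun y => ?_
    rw [(he.quenchedKernel_of_ringsOnce hs hst hx hx' hj).2,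
      Real.toNNReal_mul (sub_nonneg.2 hB.2), mul_left_comm]

/-- The bonds that influence the window `(-M, M)`, with a margin. -/
def windowBonds (M : ℕ) : Finset ℤ := Finset.Icc (-(M : ℤ) - 1) M

theorem Environment.IsGood.local_profile_of_silent (he : e.IsGood) {M : ℕ} {f : Config → ℝ}
    (hf : IsLocalOn M f) (hs : 0 ≤ s) (hst : s ≤ t)
    (h : ∀ b ∈ windowBonds M, e.Silent b s t) : f (profile ρ₀ e t) = f (profile ρ₀ e s) := by
  refine hf fun z hz => he.profile_of_silent hs hst (h _ ?_) (h _ ?_)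
  · rw [windowBonds, Finset.mem_Icc]; have := hz.1; have := hz.2; omega
  · rw [windowBonds, Finset.mem_Icc]; have := hz.1; have := hz.2; omega

/-- The redistribution rule on the bond `b` requires `b - 1` and `b + 1` to be silent. With `b` next
to a site `z` of the window these range from `z - 2` to `z + 1`, whence the margin in `windowBonds`.
-/
theorem Environment.IsGood.local_profile_of_ringsOnce (he : e.IsGood) {M : ℕ} {f : Config → ℝ}
    (hf : IsLocalOn M f) (hs : 0 ≤ s) (hst : s ≤ t) {b : ℤ} {j : ℕ}
    (h : ∀ c ∈ windowBonds M, c ≠ b → e.Silent c s t) (hj : e.RingsOnce b s t j) :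
    f (profile ρ₀ e t) = f (redistribute b (e.mark b j) (profile ρ₀ e s)) := by
  refine hf fun z hz => ?_
  have hz1 := hz.1
  have hz2 := hz.2
  have hmem : ∀ c, c ≠ b → z - 2 ≤ c → c ≤ z + 1 → e.Silent c s t := fun c hcb h1 h2 =>
    h c (by rw [windowBonds, Finset.mem_Icc]; omega) hcb
  by_cases h1 : z = b
  · subst h1
    exact (he.profile_of_ringsOnce hs hst (hmem _ (by omega) (by omega) (by omega))
      (hmem _ (by omega) (by omega) (by omega)) hj).1
  by_cases h2 : z = b + 1
  · subst h2
    exact (he.profile_of_ringsOnce hs hst (hmem _ (by omega) (by omega) (by omega))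
      (hmem _ (by omega) (by omega) (by omega)) hj).2
  rw [redistribute_apply_of_ne _ _ h1 h2]
  exact he.profile_of_silent hs hst (hmem _ (by omega) (by omega) (by omega))
    (hmem _ (by omega) (by omega) (by omega))

theorem Environment.IsGood.silent_of_lt_nextRing (he : e.IsGood) (h : t < e.nextRing x s) :
    e.Silent x s t := fun j hj => by
  have := (he.strictMono x).monotone (Environment.nextIndex_le hj.1)
  exact absurd (h.trans_le this) (not_lt.2 hj.2)

theorem Environment.IsGood.exists_silent_left (he : e.IsGood) (x : ℤ) {t : ℝ≥0} (ht : 0 < t) :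
    ∃ r < t, ∀ r' < t, e.Silent x r r' := by
  have hfin : {j | e.ring x j < t}.Finite := by
    have h1 := (he.unbounded x).eventually_ge_atTop t
    rw [← Nat.cofinite_eq_atTop, eventually_cofinite] at h1
    simpa using h1
  have h1 : ∀ᶠ r : ℝ≥0 in 𝓝[<] t, ∀ j ∈ {j | e.ring x j < t}, e.ring x j < r := by
    rw [Filter.eventually_all_finite hfin]
    intro j hj
    exact mem_nhdsWithin_of_mem_nhds
      ((NNReal.continuous_coe.tendsto t).eventually (lt_mem_nhds hj))
  have : (𝓝[<] t).NeBot := nhdsLT_neBot_of_exists_lt ⟨0, ht⟩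
  obtain ⟨r, hr, hrt⟩ := (h1.and self_mem_nhdsWithin).exists
  refine ⟨r, hrt, fun r' hr' j hj => ?_⟩
  exact absurd (hr j (hj.2.trans_lt (NNReal.coe_lt_coe.2 hr'))) (not_lt.2 hj.1.le)

/-- In the product topology one coordinate at a time matters, and the profile at `x` is constant as
long as neither of the two bonds at `x` rings. -/
theorem Environment.IsGood.isCadlag_profile (he : e.IsGood) (ρ₀ : ℤ → ℝ≥0) :
    IsCadlag fun t : ℝ≥0 => profile ρ₀ e t := by
  intro t
  constructor
  · rw [continuousWithinAt_pi]
    intro x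
    refine ContinuousWithinAt.congr_of_eventuallyEq
      (continuousWithinAt_const (b := profile ρ₀ e t x)) ?_ rfl
    have h1 : ∀ b, ∀ᶠ r : ℝ≥0 in 𝓝 t, (r : ℝ) < e.nextRing b t := fun b =>
      (NNReal.continuous_coe.tendsto t).eventually (gt_mem_nhds (he.unbounded.lt_nextRing b t))
    filter_upwards [self_mem_nhdsWithin, mem_nhdsWithin_of_mem_nhds (h1 (x - 1)),
      mem_nhdsWithin_of_mem_nhds (h1 x)] with r hr h1 h2
    exact he.profile_of_silent t.2 hr (he.silent_of_lt_nextRing h1) (he.silent_of_lt_nextRing h2)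
  · rcases eq_or_ne t 0 with rfl | ht
    · exact ⟨ρ₀, by simp⟩
    have ht' : 0 < t := pos_iff_ne_zero.2 ht
    have key : ∀ x, ∃ l, Tendsto (fun r : ℝ≥0 => profile ρ₀ e r x) (𝓝[<] t) (𝓝 l) := by
      intro x
      obtain ⟨r₁, hr₁, h₁⟩ := he.exists_silent_left (x - 1) ht'
      obtain ⟨r₂, hr₂, h₂⟩ := he.exists_silent_left x ht'
      refine ⟨profile ρ₀ e (max r₁ r₂ : ℝ≥0) x, tendsto_const_nhds.congr' ?_⟩
      filter_upwards [self_mem_nhdsWithin,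
        mem_nhdsWithin_of_mem_nhds (lt_mem_nhds (max_lt hr₁ hr₂))] with r hr hr'
      refine (he.profile_of_silent (max r₁ r₂).2 (NNReal.coe_le_coe.2 hr'.le) ?_ ?_).symm
      · exact (h₁ r hr).mono (NNReal.coe_le_coe.2 (le_max_left _ _)) le_rfl
      · exact (h₂ r hr).mono (NNReal.coe_le_coe.2 (le_max_right _ _)) le_rfl
    choose l hl using key
    exact ⟨l, tendsto_pi_nhds.2 hl⟩

end Profile

/-! ### Counting the Poisson times of a bond -/

section Counting

variable {e : Environment} {x : ℤ} {s t : ℝ}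

theorem Environment.lt_nextIndex_iff (hm : StrictMono (e.ring x))
    (ht : Tendsto (e.ring x) atTop atTop) {j : ℕ} : j < e.nextIndex x t ↔ e.ring x j ≤ t := by
  have hne : {j | t < e.ring x j}.Nonempty := (ht.eventually_gt_atTop t).exists
  constructor
  · intro h
    exact not_lt.1 fun h' => absurd (Environment.nextIndex_le h') (not_le.2 h)
  · intro h
    by_contra! h'
    have h1 : t < e.ring x (e.nextIndex x t) := Nat.sInf_mem hne
    exact absurd (h1.trans_le (hm.monotone h')) (not_lt.2 h)

theorem Environment.ncard_eq_nextIndex (hm : StrictMono (e.ring x))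
    (ht : Tendsto (e.ring x) atTop atTop) (t : ℝ) :
    Set.ncard {j | e.ring x j ≤ t} = e.nextIndex x t := by
  have : {j | e.ring x j ≤ t} = (Finset.range (e.nextIndex x t) : Set ℕ) := by
    ext j
    simp [Environment.lt_nextIndex_iff hm ht]
  rw [this, Set.ncard_coe_finset, Finset.card_range]

theorem Environment.nextIndex_mono (hm : StrictMono (e.ring x))
    (ht : Tendsto (e.ring x) atTop atTop) : Monotone (e.nextIndex x) := fun s t hst => by
  by_contra! h
  have h1 := (Environment.lt_nextIndex_iff hm ht).1 h
  exact lt_irrefl _ ((Environment.lt_nextIndex_iff hm ht).2 (h1.trans hst))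

theorem Environment.nextIndex_zero (h0 : 0 < e.ring x 0) : e.nextIndex x 0 = 0 :=
  Nat.le_zero.1 (Environment.nextIndex_le h0)

theorem Environment.silent_of_nextIndex_eq (hm : StrictMono (e.ring x))
    (ht : Tendsto (e.ring x) atTop atTop) (h : e.nextIndex x t = e.nextIndex x s) :
    e.Silent x s t := fun j hj => by
  have h1 := (Environment.lt_nextIndex_iff hm ht).2 hj.2
  rw [h, Environment.lt_nextIndex_iff hm ht] at h1
  exact absurd hj.1 (not_lt.2 h1)

theorem Environment.ringsOnce_of_nextIndex_eq (hm : StrictMono (e.ring x))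
    (ht : Tendsto (e.ring x) atTop atTop) (h : e.nextIndex x t = e.nextIndex x s + 1) :
    e.RingsOnce x s t (e.nextIndex x s) := by
  have hiff : ∀ k, e.ring x k ∈ Set.Ioc s t ↔ k = e.nextIndex x s := fun k => by
    rw [Set.mem_Ioc, ← not_le, ← Environment.lt_nextIndex_iff hm ht,
      ← Environment.lt_nextIndex_iff hm ht, h]
    omega
  exact ⟨(hiff _).2 rfl, fun k hk => (hiff k).1 hk⟩

end Counting

/-! ### Probability estimates for Poisson times -/

section Poisson

variable {Ω : Type*} [MeasurableSpace Ω] {P : Measure Ω}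

theorem poissonMeasure_real_zero (r : ℝ≥0) :
    (poissonMeasure r).real {0} = Real.exp (-r) := by
  simp [poissonMeasure_real_singleton]

theorem poissonMeasure_real_ge_two_le (r : ℝ≥0) :
    (poissonMeasure r).real {n | 2 ≤ n} ≤ (r : ℝ) ^ 2 := by
  have h : {n : ℕ | 2 ≤ n} = ({0, 1} : Set ℕ)ᶜ := by
    ext n
    simp only [Set.mem_ofPred_eq, Set.mem_compl_iff, Set.mem_insert_iff, Set.mem_singleton_iff]
    omega
  rw [h, probReal_compl_eq_one_sub (MeasurableSet.of_discrete), Set.insert_eq,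
    measureReal_union (by simp) (MeasurableSet.of_discrete), poissonMeasure_real_singleton,
    poissonMeasure_real_singleton]
  -- The probability is `1 - (1 + r) exp (-r)`, and `(1 + r)(1 - r) = 1 - r²`.
  have h1 : 1 - (r : ℝ) ≤ Real.exp (-r) := by
    have := Real.add_one_le_exp (-(r : ℝ)); linarith
  have h2 : (0 : ℝ) ≤ 1 + r := by positivity
  simp only [pow_zero, Nat.factorial_zero, pow_one, Nat.factorial_one, Nat.cast_one, div_one]
  nlinarith [mul_le_mul_of_nonneg_right h1 h2]

theorem one_sub_exp_neg_le (r : ℝ≥0) : 1 - Real.exp (-r) ≤ r := by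
  have := Real.add_one_le_exp (-(r : ℝ)); linarith

end Poisson
/-! ### Almost sure properties of the environment -/

section AlmostSure

variable {Ω : Type*} [MeasurableSpace Ω] {P : Measure Ω} {α : ℝ} {env env' : Ω → Environment}

theorem IsPoissonTimes.congr {T T' : ℕ → Ω → ℝ} (h : IsPoissonTimes P T)
    (hT' : ∀ j, Measurable (T' j)) (hTT' : ∀ᵐ ω ∂P, ∀ j, T j ω = T' j ω) :
    IsPoissonTimes P T' where
  measurable := hT'
  pos := by filter_upwards [h.pos, hTT'] with ω h1 h2; rwa [← h2]
  strictMono := by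
    filter_upwards [h.strictMono, hTT'] with ω h1 h2
    simpa only [h2] using h1
  tendsto := by
    filter_upwards [h.tendsto, hTT'] with ω h1 h2
    simpa only [h2] using h1
  indep_increments n t ht := by
    refine (h.indep_increments n t ht).congr fun i => ?_
    filter_upwards [hTT'] with ω h2
    simp only [h2]
  law_increments s t hst := by
    refine (h.law_increments s t hst).congr ?_
    filter_upwards [hTT'] with ω h2
    simp only [h2]

theorem IsBetaEnvironment.measurableEnv (h : IsBetaEnvironment α P env) : MeasurableEnv env :=
  ⟨fun x j => (h.poisson x).measurable j, h.measurable_mark⟩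

theorem IsBetaEnvironment.congr (h : IsBetaEnvironment α P env) (h' : MeasurableEnv env')
    (hae : env =ᵐ[P] env') : IsBetaEnvironment α P env' where
  poisson x := (h.poisson x).congr (h'.ring x) (by
    filter_upwards [hae] with ω hω j
    rw [hω])
  indep_ring := h.indep_ring.congr fun x => by
    filter_upwards [hae] with ω hω
    rw [hω]
  measurable_mark := h'.mark
  law_mark x j := (h.law_mark x j).congr (by
    filter_upwards [hae] with ω hω
    rw [hω])
  indep_mark := h.indep_mark.congr fun i => by
    filter_upwards [hae] with ω hω
    rw [hω]
  indep_ring_mark := h.indep_ring_mark.congr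
    (by filter_upwards [hae] with ω hω; rw [hω]) (by filter_upwards [hae] with ω hω; rw [hω])

theorem IsBetaEnvironment.hasLaw_nextIndex (h : IsBetaEnvironment α P env) (x : ℤ) (s t : ℝ≥0)
    (hst : s ≤ t) :
    HasLaw (fun ω => (env ω).nextIndex x t - (env ω).nextIndex x s) (poissonMeasure (t - s)) P := by
  refine ((h.poisson x).law_increments s t hst).congr ?_
  filter_upwards [(h.poisson x).strictMono, (h.poisson x).tendsto] with ω h1 h2
  rw [Environment.ncard_eq_nextIndex h1 h2, Environment.ncard_eq_nextIndex h1 h2]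

theorem betaMeasure_compl_Icc : betaMeasure α α (Set.Icc 0 1)ᶜ = 0 := by
  rw [betaMeasure, withDensity_apply _ measurableSet_Icc.compl]
  refine setLIntegral_eq_zero measurableSet_Icc.compl fun x hx => ?_
  rw [Set.mem_compl_iff, Set.mem_Icc, not_and_or, not_le, not_le] at hx
  rcases hx with hx | hx
  · exact betaPDF_eq_zero_of_nonpos hx.le
  · exact betaPDF_eq_zero_of_one_le hx.le

theorem IsBetaEnvironment.ae_mark_mem (h : IsBetaEnvironment α P env) (x : ℤ) (j : ℕ) :
    ∀ᵐ ω ∂P, (env ω).mark x j ∈ Set.Icc (0 : ℝ) 1 := by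
  have h1 : ∀ᵐ p ∂(P.map fun ω => (env ω).mark x j), p ∈ Set.Icc (0 : ℝ) 1 := by
    rw [(h.law_mark x j).map_eq]
    exact betaMeasure_compl_Icc
  exact ae_of_ae_map (h.law_mark x j).aemeasurable h1

theorem IsBetaEnvironment.measure_not_silent_le (h : IsBetaEnvironment α P env) (x : ℤ)
    (t : ℝ≥0) : P {ω | ¬ (env ω).Silent x 0 t} ≤ ENNReal.ofReal (1 - Real.exp (-t)) := by
  have hl := h.hasLaw_nextIndex x 0 t zero_le
  have h1 : P {ω | ¬ (env ω).Silent x 0 t} ≤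
      P ((fun ω => (env ω).nextIndex x t - (env ω).nextIndex x (0 : ℝ≥0)) ⁻¹' {0}ᶜ) := by
    refine measure_mono_ae ?_
    filter_upwards [(h.poisson x).strictMono, (h.poisson x).tendsto] with ω h1 h2 h3 h4
    refine h3 (Environment.silent_of_nextIndex_eq h1 h2 ?_)
    have h5 := Environment.nextIndex_mono h1 h2 t.2
    have h6 := Nat.sub_eq_zero_iff_le.1 h4
    exact le_antisymm (by simpa using h6) h5
  refine h1.trans ?_
  rw [← Measure.map_apply_of_aemeasurable hl.aemeasurable MeasurableSet.of_discrete, hl.map_eq,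
    tsub_zero, ← ofReal_measureReal, probReal_compl_eq_one_sub MeasurableSet.of_discrete,
    poissonMeasure_real_zero]

/-- By independence over bonds, `K` given bonds all ring before `t` with probability at most `(1 -
exp (-t)) ^ K`, which tends to `0`. -/
theorem IsBetaEnvironment.ae_exists_silent [IsProbabilityMeasure P]
    (h : IsBetaEnvironment α P env) {f : ℕ → ℤ} (hf : Function.Injective f) (t : ℝ≥0) :
    ∀ᵐ ω ∂P, ∃ k, (env ω).Silent (f k) 0 t := by
  have hr : MeasurableSet (⋂ j, {r : ℕ → ℝ | r j ∉ Set.Ioc 0 (t : ℝ)})ᶜ :=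
    (MeasurableSet.iInter fun j => (measurable_pi_apply j measurableSet_Ioc).compl).compl
  have hK : ∀ K : ℕ, P {ω | ∀ k, ¬ (env ω).Silent (f k) 0 t} ≤
      ENNReal.ofReal (1 - Real.exp (-t)) ^ K := by
    intro K
    have h1 := (h.indep_ring.precomp hf).meas_biInter (S := Finset.range K)
      (s := fun k => {ω | ¬ (env ω).Silent (f k) 0 t}) fun k _ =>
        ⟨_, hr, by ext ω; simp [Environment.Silent]⟩
    calc P {ω | ∀ k, ¬ (env ω).Silent (f k) 0 t}
        ≤ P (⋂ k ∈ Finset.range K, {ω | ¬ (env ω).Silent (f k) 0 t}) :=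
          measure_mono fun ω hω => Set.mem_iInter₂.2 fun k _ => hω k
      _ = ∏ k ∈ Finset.range K, P {ω | ¬ (env ω).Silent (f k) 0 t} := h1
      _ ≤ ∏ k ∈ Finset.range K, ENNReal.ofReal (1 - Real.exp (-t)) :=
          Finset.prod_le_prod' fun k _ => h.measure_not_silent_le (f k) t
      _ = _ := by rw [Finset.prod_const, Finset.card_range]
  have hlim : Tendsto (fun K : ℕ => ENNReal.ofReal (1 - Real.exp (-t)) ^ K) atTop (𝓝 0) := by
    refine ENNReal.tendsto_pow_atTop_nhds_zero_of_lt_one ?_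
    rw [← ENNReal.ofReal_one]
    exact (ENNReal.ofReal_lt_ofReal_iff one_pos).2 (by linarith [Real.exp_pos (-(t : ℝ))])
  have h0 := le_antisymm (ge_of_tendsto' hlim hK) zero_le
  rw [ae_iff]
  simpa only [not_exists] using h0

theorem IsBetaEnvironment.ae_isGood [IsProbabilityMeasure P] (h : IsBetaEnvironment α P env) :
    ∀ᵐ ω ∂P, (env ω).IsGood := by
  have hl : ∀ᵐ ω ∂P, ∀ (T : ℕ) (M : ℤ), ∃ k : ℕ, (env ω).Silent (M - k) 0 (T : ℝ≥0) :=
    ae_all_iff.2 fun T => ae_all_iff.2 fun M =>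
      h.ae_exists_silent (f := fun k : ℕ => M - k) (fun a b hab => by simpa using hab) T
  have hr : ∀ᵐ ω ∂P, ∀ (T : ℕ) (M : ℤ), ∃ k : ℕ, (env ω).Silent (M + k) 0 (T : ℝ≥0) :=
    ae_all_iff.2 fun T => ae_all_iff.2 fun M =>
      h.ae_exists_silent (f := fun k : ℕ => M + k) (fun a b hab => by simpa using hab) T
  filter_upwards [hl, hr, ae_all_iff.2 fun x => (h.poisson x).strictMono,
    ae_all_iff.2 fun x => (h.poisson x).tendsto, ae_all_iff.2 fun x => (h.poisson x).pos,
    ae_all_iff.2 fun x => ae_all_iff.2 fun j => h.ae_mark_mem x j] with ω hl hr h1 h2 h3 h4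
  refine ⟨h1, h3, h2, h4, fun T M => ?_, fun T M => ?_⟩
  · obtain ⟨n, hn⟩ := exists_nat_ge T
    obtain ⟨k, hk⟩ := hl n M
    exact ⟨M - k, by omega, hk.mono le_rfl (by simpa using hn)⟩
  · obtain ⟨n, hn⟩ := exists_nat_ge T
    obtain ⟨k, hk⟩ := hr n M
    exact ⟨M + k, by omega, hk.mono le_rfl (by simpa using hn)⟩

/-- A random environment agrees almost surely with one that is good everywhere. -/
theorem IsBetaEnvironment.exists_isGood [IsProbabilityMeasure P]
    (h : IsBetaEnvironment α P env) :
    ∃ env' : Ω → Environment, IsBetaEnvironment α P env' ∧ env =ᵐ[P] env' ∧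
      ∀ ω, (env' ω).IsGood := by
  classical
  -- Off a measurable null set containing all bad environments nothing changes; on it one fixed good
  -- environment is substituted, so measurability survives.
  obtain ⟨N, hN, hNm, hN0⟩ := exists_measurable_superset_of_null (ae_iff.1 h.ae_isGood)
  have hgood : ∀ ω ∉ N, (env ω).IsGood := fun ω hω => by
    by_contra h'
    exact hω (hN h')
  obtain ⟨ω₀, hω₀⟩ : ∃ ω₀, ω₀ ∉ N := by
    by_contra! h'
    rw [Set.eq_univ_of_forall h', measure_univ] at hN0
    exact one_ne_zero hN0
  have hae : env =ᵐ[P] fun ω => if ω ∈ N then env ω₀ else env ω := by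
    filter_upwards [measure_eq_zero_iff_ae_notMem.1 hN0] with ω hω
    rw [if_neg hω]
  refine ⟨_, h.congr ⟨fun x j => ?_, fun x j => ?_⟩ hae, hae, fun ω => ?_⟩
  · simp only [apply_ite Environment.ring, ite_apply]
    exact Measurable.ite hNm measurable_const (h.measurableEnv.ring x j)
  · simp only [apply_ite Environment.mark, ite_apply]
    exact Measurable.ite hNm measurable_const (h.measurableEnv.mark x j)
  · split_ifs with hω
    · exact hgood _ hω₀
    · exact hgood _ hω

end AlmostSure

/-! ### Independence lemmas -/

section Independence

variable {Ω : Type*} [MeasurableSpace Ω] {P : Measure Ω}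

/-- If `X` and `Y` are independent and `(X, Y)` is independent of `Z`, then `X` is independent of
`(Y, Z)`. -/
theorem indepFun_prodMk_of_indepFun {A B C : Type*} [MeasurableSpace A] [MeasurableSpace B]
    [MeasurableSpace C] [IsProbabilityMeasure P] {X : Ω → A} {Y : Ω → B} {Z : Ω → C}
    (hX : Measurable X) (hY : Measurable Y) (hZ : Measurable Z) (h : IndepFun X Y P)
    (h' : IndepFun (fun ω => (X ω, Y ω)) Z P) : IndepFun X (fun ω => (Y ω, Z ω)) P := by
  have hYZ : IndepFun Y Z P := h'.comp measurable_snd measurable_id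
  rw [indepFun_iff_map_prod_eq_prod_map_map hX.aemeasurable (hY.prodMk hZ).aemeasurable,
    (indepFun_iff_map_prod_eq_prod_map_map hY.aemeasurable hZ.aemeasurable).1 hYZ,
    ← Measure.prodAssoc_prod,
    ← (indepFun_iff_map_prod_eq_prod_map_map hX.aemeasurable hY.aemeasurable).1 h,
    ← (indepFun_iff_map_prod_eq_prod_map_map (hX.prodMk hY).aemeasurable hZ.aemeasurable).1 h',
    Measure.map_map MeasurableEquiv.prodAssoc.measurable ((hX.prodMk hY).prodMk hZ)]
  rfl

theorem iIndepFun.indepFun_compl_singleton {ι : Type*} {β : ι → Type*}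
    [∀ i, MeasurableSpace (β i)] {X : ∀ i, Ω → β i} (h : iIndepFun X P)
    (hX : ∀ i, Measurable (X i)) (b : ι) :
    IndepFun (X b) (fun ω (i : {i // i ≠ b}) => X i ω) P := by
  have h1 := indep_iSup_of_disjoint (fun i => (hX i).comap_le) h.iIndep
    (S := {b}) (T := {i | i ≠ b}) (by simp)
  rw [IndepFun_iff_Indep]
  refine indep_of_indep_of_le h1 ?_ ?_
  · simp
  · rw [MeasurableSpace.pi, MeasurableSpace.comap_iSup]
    refine iSup_le fun i => ?_
    rw [MeasurableSpace.comap_comp]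
    exact le_iSup₂_of_le (i : ι) i.2 le_rfl

theorem measure_eq_tsum_fiber {N : Ω → ℕ} (hN : Measurable N) {S : Set Ω} (hS : MeasurableSet S) :
    P S = ∑' n, P (S ∩ {ω | N ω = n}) := by
  have h : S = ⋃ n, S ∩ {ω | N ω = n} := by ext; simp
  conv_lhs => rw [h]
  refine measure_iUnion (fun m n hmn => Set.disjoint_left.2 fun ω h1 h2 =>
    hmn (h1.2.symm.trans h2.2)) fun n => hS.inter (hN (measurableSet_singleton n))

/-- The increments of a process with independent increments are independent of its past. -/
theorem indepFun_past_increment [IsProbabilityMeasure P] {X : ℝ≥0 → Ω → ℕ}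
    (hX : HasIndepIncrements X P) (hm : ∀ t, Measurable (X t)) (h0 : ∀ ω, X 0 ω = 0)
    (hmono : ∀ ω, Monotone fun t => X t ω) (s h : ℝ≥0) :
    IndepFun (fun ω (r : Set.Iic s) => X r ω) (fun ω => X (s + h) ω - X s ω) P := by
  refine IndepFun.process_indepFun (fun r => hm r) ((hm _).sub (hm _)) fun I => ?_
  set k := I.card
  -- The sampling times are `0`, the sorted elements of `I`, then `s`, then `s + h`. As `X 0 = 0`,
  -- each past value is a sum of the first `k + 1` increments, and increment `k + 1` is the one over
  -- `(s, s + h]`.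
  let t : ℕ → ℝ≥0 := fun i => match i with
    | 0 => 0
    | i + 1 => if hi : i < k then (I.orderEmbOfFin rfl ⟨i, hi⟩ : ℝ≥0) else
        if i = k then s else s + h
  have ht : Monotone t := by
    refine monotone_nat_of_le_succ fun i => ?_
    cases i with
    | zero => exact zero_le
    | succ i =>
      simp only [t]
      split_ifs with h1 h2 h3 h4 h5 h6 <;> try omega
      · exact (I.orderEmbOfFin rfl).monotone (Fin.mk_le_mk.2 (Nat.le_succ i))
      · exact (I.orderEmbOfFin rfl ⟨i, h1⟩).2
      · exact le_self_add
      · exact le_rfl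
  have hind := (hX.nat ht).indepFun_finset (Finset.range (k + 1)) {k + 1} (by simp)
    fun i => (hm _).sub (hm _)
  have hsum : ∀ n ω, X (t n) ω = ∑ i ∈ Finset.range n, (X (t (i + 1)) ω - X (t i) ω) := fun n ω => by
    rw [Finset.sum_range_tsub (f := fun i => X (t i) ω) ((hmono ω).comp ht)]
    simp [t, h0]
  let idx : I → Fin k := fun r => (I.orderIsoOfFin rfl).symm r
  have hidx : ∀ r : I, t (idx r + 1) = r := fun r => by
    simp only [t, (idx r).2, dif_pos]
    rw [← Finset.coe_orderIsoOfFin_apply]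
    simp [idx]
  let φ : (Finset.range (k + 1) → ℕ) → I → ℕ := fun v r =>
    ∑ i ∈ Finset.range (idx r + 1), if hi : i ∈ Finset.range (k + 1) then v ⟨i, hi⟩ else 0
  let ψ : (({k + 1} : Finset ℕ) → ℕ) → ℕ := fun v => v ⟨k + 1, by simp⟩
  convert hind.comp (φ := φ) (ψ := ψ) Measurable.of_discrete Measurable.of_discrete using 1
  · ext ω r
    simp only [Function.comp, φ]
    rw [← hidx r]
    refine (hsum (idx r + 1) ω).trans (Finset.sum_congr rfl fun i hi => ?_)
    rw [dif_pos]
    rw [Finset.mem_range] at hi ⊢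
    have := (idx r).2
    omega
  · ext ω
    simp [ψ, t]

end Independence

/-! ### The past of the environment -/

section Past

/-- The Poisson times up to time `s`; later times are replaced by deterministic ones. -/
def stopRing (s : ℝ) (r : ℤ → ℕ → ℝ) : ℤ → ℕ → ℝ := fun x j =>
  if r x j ≤ s then r x j else s + 1 + j

/-- The marks of the Poisson times up to time `s`; later marks are erased. -/
def stopMark (s : ℝ) (r m : ℤ → ℕ → ℝ) : ℤ → ℕ → ℝ := fun x j =>
  if r x j ≤ s then m x j else 0

/-- The environment seen up to time `s`. -/
def Environment.stopped (e : Environment) (s : ℝ) : Environment :=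
  ⟨stopRing s e.ring, stopMark s e.ring e.mark⟩

variable {e : Environment} {s t : ℝ} {x : ℤ} {j : ℕ} {r m : ℤ → ℕ → ℝ}

theorem stopRing_le_iff (hst : s ≤ t) : stopRing t r x j ≤ s ↔ r x j ≤ s := by
  unfold stopRing
  split_ifs with h
  · rfl
  · have : (0 : ℝ) ≤ j := j.cast_nonneg
    constructor <;> intro h' <;> linarith

theorem stopRing_stopRing (hst : s ≤ t) : stopRing s (stopRing t r) = stopRing s r := by
  ext x j
  by_cases h : r x j ≤ t
  · simp only [stopRing, if_pos h]
  · have h1 : stopRing t r x j = t + 1 + j := if_neg h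
    have h2 : (0 : ℝ) ≤ j := j.cast_nonneg
    have h3 : ¬ r x j ≤ s := fun h' => h (h'.trans hst)
    have h4 : ¬ stopRing t r x j ≤ s := by rw [h1]; linarith
    exact (if_neg h4).trans (if_neg h3).symm

theorem stopMark_stopMark (hst : s ≤ t) :
    stopMark s (stopRing t r) (stopMark t r m) = stopMark s r m := by
  ext x j
  simp only [stopMark, stopRing_le_iff hst]
  split_ifs with h1 h2
  · rfl
  · exact absurd (h1.trans hst) h2
  · rfl

theorem stopMark_stopRing : stopMark s (stopRing s r) m = stopMark s r m := by
  ext x j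
  simp only [stopMark, stopRing_le_iff le_rfl]

theorem measurable_stopRing (s : ℝ) : Measurable (stopRing s) := by
  refine measurable_pi_lambda _ fun x => measurable_pi_lambda _ fun j => ?_
  have h : Measurable fun r : ℤ → ℕ → ℝ => r x j :=
    (measurable_pi_apply j).comp (measurable_pi_apply x)
  exact Measurable.ite (measurableSet_le h measurable_const) h measurable_const

theorem measurable_stopMark (s : ℝ) :
    Measurable fun q : (ℤ → ℕ → ℝ) × (ℤ → ℕ → ℝ) => stopMark s q.1 q.2 := by
  refine measurable_pi_lambda _ fun x => measurable_pi_lambda _ fun j => ?_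
  have h : Measurable fun r : ℤ → ℕ → ℝ => r x j :=
    (measurable_pi_apply j).comp (measurable_pi_apply x)
  exact Measurable.ite (measurableSet_le (h.comp measurable_fst) measurable_const)
    (h.comp measurable_snd) measurable_const

/-- Erased times are sent to `s + 1 + j`, not to a constant, for this reason: the walk in the
stopped environment must still pass every ring time, as `AgreeUpTo.profile_eq` requires. -/
theorem Environment.Unbounded.stopped (he : e.Unbounded) (s : ℝ) : (e.stopped s).Unbounded := by
  intro x
  refine (tendsto_atTop_add_const_left atTop (s + 1) tendsto_natCast_atTop_atTop).congr' ?_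
  filter_upwards [(he x).eventually_gt_atTop s] with j hj
  exact (if_neg (not_le.2 hj)).symm

theorem agreeUpTo_stopped (e : Environment) (s : ℝ) : AgreeUpTo e (e.stopped s) s := by
  intro x j h
  have h' : e.ring x j ≤ s := h.elim id (stopRing_le_iff le_rfl).1
  exact ⟨(if_pos h').symm, (if_pos h').symm⟩

theorem Environment.nextIndex_stopRing (e : Environment) (m : ℤ → ℕ → ℝ) (x : ℤ) (s : ℝ) :
    (Environment.mk (stopRing s e.ring) m).nextIndex x s = e.nextIndex x s := by
  simp only [Environment.nextIndex, ← not_le, stopRing_le_iff le_rfl]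

variable {Ω : Type*} {env : Ω → Environment}

/-- The σ-algebra of the environment up to time `s`. -/
@[reducible] def past (env : Ω → Environment) (s : ℝ) : MeasurableSpace Ω :=
  MeasurableSpace.comap (fun ω => (((env ω).stopped s).ring, ((env ω).stopped s).mark)) inferInstance

theorem MeasurableEnv.pair [MeasurableSpace Ω] (h : MeasurableEnv env) :
    Measurable fun ω => ((env ω).ring, (env ω).mark) :=
  (measurable_pi_lambda _ fun x => measurable_pi_lambda _ fun j => h.ring x j).prodMk
    (measurable_pi_lambda _ fun x => measurable_pi_lambda _ fun j => h.mark x j)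

theorem measurable_stopPair (s : ℝ) : Measurable fun q : (ℤ → ℕ → ℝ) × (ℤ → ℕ → ℝ) =>
    (stopRing s q.1, stopMark s q.1 q.2) :=
  ((measurable_stopRing s).comp measurable_fst).prodMk (measurable_stopMark s)

theorem past_mono (env : Ω → Environment) (hst : s ≤ t) : past env s ≤ past env t := by
  refine Measurable.comap_le (m₁ := past env t) ?_
  have h := @Measurable.comp _ _ _ (past env t) _ _ _ _ (measurable_stopPair s)
    (comap_measurable fun ω => (((env ω).stopped t).ring, ((env ω).stopped t).mark))
  convert h using 2 with ω
  simp only [Function.comp, Environment.stopped, stopRing_stopRing hst, stopMark_stopMark hst]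

theorem MeasurableEnv.past_le [mΩ : MeasurableSpace Ω] (h : MeasurableEnv env) (s : ℝ) : past env s ≤ mΩ :=
  Measurable.comap_le ((measurable_stopPair s).comp h.pair)

theorem measurable_profile_past (hgood : ∀ ω, (env ω).Unbounded) (ρ₀ : ℤ → ℝ≥0) (hs : 0 ≤ s) :
    Measurable[past env s] fun ω => profile ρ₀ (env ω) s := by
  have h := @Measurable.comp _ _ _ (past env s) _ _ _ _ (measurableEnv_mk.profile ρ₀ s)
    (comap_measurable fun ω => (((env ω).stopped s).ring, ((env ω).stopped s).mark))
  convert h using 2 with ω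
  exact (agreeUpTo_stopped (env ω) s).profile_eq (hgood ω) ((hgood ω).stopped s) hs le_rfl

end Past

/-! ### Independence of the future from the past -/

section Future

/-- The number of Poisson times of the bond `(x, x+1)` during `(s, t]`. -/
def Environment.ringCount (e : Environment) (x : ℤ) (s t : ℝ) : ℕ :=
  e.nextIndex x t - e.nextIndex x s

theorem Environment.IsGood.silent_of_ringCount {e : Environment} (he : e.IsGood) {x : ℤ} {s t : ℝ}
    (hst : s ≤ t) (h : e.ringCount x s t = 0) : e.Silent x s t := by
  have h1 := Environment.nextIndex_mono (he.strictMono x) (he.unbounded x) hst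
  refine Environment.silent_of_nextIndex_eq (he.strictMono x) (he.unbounded x) ?_
  unfold Environment.ringCount at h
  omega

theorem Environment.IsGood.ringsOnce_of_ringCount {e : Environment} (he : e.IsGood) {x : ℤ}
    {s t : ℝ} (hst : s ≤ t) (h : e.ringCount x s t = 1) :
    e.RingsOnce x s t (e.nextIndex x s) := by
  have h1 := Environment.nextIndex_mono (he.strictMono x) (he.unbounded x) hst
  refine Environment.ringsOnce_of_nextIndex_eq (he.strictMono x) (he.unbounded x) ?_
  unfold Environment.ringCount at h
  omega

variable {Ω : Type*} [MeasurableSpace Ω] {P : Measure Ω} {α : ℝ} {env : Ω → Environment}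

theorem MeasurableEnv.ringCount (h : MeasurableEnv env) (x : ℤ) (s t : ℝ) :
    Measurable fun ω => (env ω).ringCount x s t :=
  (h.nextIndex measurable_const measurable_const).sub
    (h.nextIndex measurable_const measurable_const)

theorem IsBetaEnvironment.hasIndepIncrements_nextIndex (h : IsBetaEnvironment α P env)
    (hg : ∀ ω, (env ω).IsGood) (b : ℤ) :
    HasIndepIncrements (fun (t : ℝ≥0) ω => (env ω).nextIndex b t) P := by
  convert (h.poisson b).indep_increments using 3 with t ω
  exact (Environment.ncard_eq_nextIndex ((hg ω).strictMono b) ((hg ω).unbounded b) t).symm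

/-- The Poisson times of a bond up to time `s` are a function of its counting process. -/
theorem comap_stopRing_le {Ω : Type*} {env : Ω → Environment} (hg : ∀ ω, (env ω).IsGood) (b : ℤ) (s : ℝ≥0) :
    MeasurableSpace.comap (fun ω => stopRing s (env ω).ring b) inferInstance ≤
      MeasurableSpace.comap (fun ω (r : Set.Iic s) => (env ω).nextIndex b (r : ℝ≥0))
        inferInstance := by
  set m := MeasurableSpace.comap (fun ω (r : Set.Iic s) => (env ω).nextIndex b (r : ℝ≥0))
    inferInstance
  have hN : ∀ r : Set.Iic s, Measurable[m] fun ω => (env ω).nextIndex b (r : ℝ≥0) := fun r =>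
    (measurable_pi_apply (X := fun _ : Set.Iic s => ℕ) r).comp
      (comap_measurable fun ω (r : Set.Iic s) => (env ω).nextIndex b (r : ℝ≥0))
  refine Measurable.comap_le (m₁ := m) ?_
  refine measurable_pi_lambda _ fun j => measurable_of_Iic fun a => ?_
  -- Either the `j`-th time comes by `min a s`, which the counting process up to `s` sees, or the
  -- deterministic substitute is at most `a`. In the latter case `a > s`, so the event is the whole
  -- space.
  have key : (fun ω => stopRing s (env ω).ring b j) ⁻¹' Set.Iic a =
      ({ω | 0 ≤ a} ∩ {ω | j < (env ω).nextIndex b (min a.toNNReal s : ℝ≥0)}) ∪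
        {ω | (s : ℝ) + 1 + j ≤ a} := by
    ext ω
    have h0 : 0 < (env ω).ring b j :=
      ((hg ω).pos b).trans_le (((hg ω).strictMono b).monotone j.zero_le)
    have hj : (0 : ℝ) ≤ j := j.cast_nonneg
    simp only [Set.mem_preimage, Set.mem_Iic, Set.mem_union, Set.mem_inter_iff, Set.mem_ofPred_eq,
      Environment.lt_nextIndex_iff ((hg ω).strictMono b) ((hg ω).unbounded b)]
    rw [NNReal.coe_min, le_min_iff, stopRing]
    have ha : 0 ≤ a → (a.toNNReal : ℝ) = a := Real.coe_toNNReal a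
    split_ifs with h1
    · constructor
      · intro h2
        have h3 := h0.le.trans h2
        exact Or.inl ⟨h3, by rw [ha h3]; exact h2, h1⟩
      · rintro (⟨h2, h3, -⟩ | h2)
        · rwa [ha h2] at h3
        · linarith
    · constructor
      · exact Or.inr
      · rintro (⟨-, -, h2⟩ | h2)
        · exact absurd h2 h1
        · exact h2
  rw [key]
  exact ((MeasurableSet.const _).inter (measurableSet_lt measurable_const
    (hN ⟨_, Set.mem_Iic.2 (min_le_right _ _)⟩))).union (MeasurableSet.const _)

variable [IsProbabilityMeasure P]

theorem IsBetaEnvironment.indepFun_ringCount_stopRing_row (h : IsBetaEnvironment α P env)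
    (hg : ∀ ω, (env ω).IsGood) (b : ℤ) (s t : ℝ≥0) :
    IndepFun (fun ω => (env ω).ringCount b s (s + t : ℝ≥0))
      (fun ω => stopRing s (env ω).ring b) P := by
  have h1 := indepFun_past_increment (h.hasIndepIncrements_nextIndex hg b)
    (fun r => h.measurableEnv.nextIndex measurable_const measurable_const)
    (fun ω => Environment.nextIndex_zero ((hg ω).pos b))
    (fun ω r r' hr => Environment.nextIndex_mono ((hg ω).strictMono b) ((hg ω).unbounded b)
      (NNReal.coe_le_coe.2 hr)) s t
  rw [IndepFun_iff_Indep] at h1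
  rw [IndepFun_iff_Indep]
  exact indep_of_indep_of_le_right h1.symm (comap_stopRing_le hg b s)

/-- The past of the bond `b` is handled by independent increments, all other bonds by independence
over bonds; `indepFun_prodMk_of_indepFun` joins the two. -/
theorem IsBetaEnvironment.indepFun_ringCount_stopRing (h : IsBetaEnvironment α P env)
    (hg : ∀ ω, (env ω).IsGood) (b : ℤ) (s t : ℝ≥0) :
    IndepFun (fun ω => (env ω).ringCount b s (s + t : ℝ≥0))
      (fun ω => stopRing s (env ω).ring) P := by
  have hr : ∀ x, Measurable fun ω => (env ω).ring x := fun x =>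
    measurable_pi_lambda _ fun j => h.measurableEnv.ring x j
  let φ : (ℕ → ℝ) → ℕ × (ℕ → ℝ) := fun r =>
    (sInf {j | ((s + t : ℝ≥0) : ℝ) < r j} - sInf {j | (s : ℝ) < r j},
      fun j => if r j ≤ s then r j else s + 1 + j)
  have hφ : Measurable φ := by
    refine Measurable.prodMk (Measurable.sub ?_ ?_) (measurable_pi_lambda _ fun j => ?_)
    · exact measurable_sInf_nat fun j => measurableSet_lt measurable_const (measurable_pi_apply j)
    · exact measurable_sInf_nat fun j => measurableSet_lt measurable_const (measurable_pi_apply j)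
    · exact Measurable.ite (measurableSet_le (measurable_pi_apply j) measurable_const)
        (measurable_pi_apply j) measurable_const
  have h1 : IndepFun (fun ω => ((env ω).ringCount b s (s + t : ℝ≥0), stopRing s (env ω).ring b))
      (fun ω (x : {x // x ≠ b}) => (env ω).ring x) P :=
    (iIndepFun.indepFun_compl_singleton h.indep_ring hr b).comp hφ measurable_id
  have hb : Measurable fun ω => stopRing s (env ω).ring b :=
    ((measurable_pi_apply b).comp (measurable_stopRing s)).comp (measurable_pi_lambda _ hr)
  have h2 := indepFun_prodMk_of_indepFun (h.measurableEnv.ringCount b s (s + t : ℝ≥0)) hb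
    (Z := fun ω (x : {x // x ≠ b}) => (env ω).ring x) (measurable_pi_lambda _ fun x => hr x)
    (h.indepFun_ringCount_stopRing_row hg b s t) h1
  let ψ : (ℕ → ℝ) × ({x // x ≠ b} → ℕ → ℝ) → ℤ → ℕ → ℝ := fun q x j =>
    if hx : x = b then q.1 j else if q.2 ⟨x, hx⟩ j ≤ s then q.2 ⟨x, hx⟩ j else s + 1 + j
  have hψ : Measurable ψ := by
    refine measurable_pi_lambda _ fun x => measurable_pi_lambda _ fun j => ?_
    by_cases hx : x = b
    · simp only [ψ, dif_pos hx]
      exact (measurable_pi_apply j).comp measurable_fst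
    · simp only [ψ, dif_neg hx]
      have h3 : Measurable fun q : (ℕ → ℝ) × ({x // x ≠ b} → ℕ → ℝ) => q.2 ⟨x, hx⟩ j :=
        (measurable_pi_apply j).comp ((measurable_pi_apply (⟨x, hx⟩ : {x // x ≠ b})).comp
          measurable_snd)
      exact Measurable.ite (measurableSet_le h3 measurable_const) h3 measurable_const
  have h3 : (fun ω => stopRing s (env ω).ring) =
      ψ ∘ fun ω => (stopRing s (env ω).ring b, fun x : {x // x ≠ b} => (env ω).ring x) := by
    ext ω x j
    simp only [Function.comp, ψ]
    split_ifs with hx h4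
    · rw [hx]
    · exact if_pos h4
    · exact if_neg h4
  rw [h3]
  exact h2.comp measurable_id hψ

/-- The Poisson times after time `s` are independent of those before and of all the marks. -/
theorem IsBetaEnvironment.indepFun_ringCount (h : IsBetaEnvironment α P env)
    (hg : ∀ ω, (env ω).IsGood) (b : ℤ) (s t : ℝ≥0) :
    IndepFun (fun ω => (env ω).ringCount b s (s + t : ℝ≥0))
      (fun ω => (stopRing s (env ω).ring, (env ω).mark)) P := by
  have hp := h.measurableEnv.pair
  refine indepFun_prodMk_of_indepFun (h.measurableEnv.ringCount b s (s + t : ℝ≥0))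
    ((measurable_stopRing s).comp hp.fst) hp.snd (h.indepFun_ringCount_stopRing hg b s t) ?_
  have hφ : Measurable fun r : ℤ → ℕ → ℝ =>
      ((Environment.mk r fun _ _ => 0).ringCount b s (s + t : ℝ≥0), stopRing s r) := by
    refine Measurable.prodMk (MeasurableEnv.ringCount ?_ b s (s + t : ℝ≥0)) (measurable_stopRing s)
    exact measurableEnv_mk.comp (measurable_id.prodMk measurable_const)
  exact h.indep_ring_mark.comp hφ measurable_id

/-- Each mark is independent of the other marks and of all the Poisson times. -/
theorem IsBetaEnvironment.indepFun_mark (h : IsBetaEnvironment α P env) (b : ℤ) (n : ℕ) :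
    IndepFun (fun ω => (env ω).mark b n)
      (fun ω => ((fun i : {i : ℤ × ℕ // i ≠ (b, n)} => (env ω).mark i.1.1 i.1.2), (env ω).ring))
      P := by
  have hp := h.measurableEnv.pair
  refine indepFun_prodMk_of_indepFun (h.measurable_mark b n)
    (measurable_pi_lambda _ fun i => h.measurable_mark _ _) hp.fst
    (iIndepFun.indepFun_compl_singleton h.indep_mark (fun i => h.measurable_mark _ _) (b, n)) ?_
  have hφ : Measurable fun m : ℤ → ℕ → ℝ =>
      (m b n, fun i : {i : ℤ × ℕ // i ≠ (b, n)} => m i.1.1 i.1.2) :=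
    ((measurable_pi_apply n).comp (measurable_pi_apply b)).prodMk
      (measurable_pi_lambda _ fun i => (measurable_pi_apply _).comp (measurable_pi_apply _))
  exact h.indep_ring_mark.symm.comp hφ measurable_id

/-- The next mark has a random index, so one sums over its value `n`. On `nextIndex = n` the ring
`(b, n)` comes after `s`, so its mark is erased from the past; the past event then involves only the
ring times and the other marks, of which the mark `(b, n)` is independent. -/
theorem IsBetaEnvironment.measure_stopped_inter_nextMark (h : IsBetaEnvironment α P env)
    (hg : ∀ ω, (env ω).IsGood) (b : ℤ) (s : ℝ) {A : Set ((ℤ → ℕ → ℝ) × (ℤ → ℕ → ℝ))}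
    (hA : MeasurableSet A) {B : Set ℝ} (hB : MeasurableSet B) :
    P ((fun ω => (((env ω).stopped s).ring, ((env ω).stopped s).mark)) ⁻¹' A ∩
        (fun ω => (env ω).nextMark b s) ⁻¹' B) =
      P ((fun ω => (((env ω).stopped s).ring, ((env ω).stopped s).mark)) ⁻¹' A) *
        betaMeasure α α B := by
  have hZ : Measurable fun ω => (((env ω).stopped s).ring, ((env ω).stopped s).mark) :=
    (measurable_stopPair s).comp h.measurableEnv.pair
  have hN : Measurable fun ω => (env ω).nextIndex b s :=
    h.measurableEnv.nextIndex measurable_const measurable_const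
  rw [measure_eq_tsum_fiber hN (hZ hA), measure_eq_tsum_fiber hN ((hZ hA).inter
    (h.measurableEnv.nextMark measurable_const measurable_const hB)), ← ENNReal.tsum_mul_right]
  refine tsum_congr fun n => ?_
  -- `ψ` rebuilds an environment from the ring times and all marks but `(b, n)`, with `0` in the
  -- missing place.
  let ψ : ({i : ℤ × ℕ // i ≠ (b, n)} → ℝ) × (ℤ → ℕ → ℝ) → Environment := fun q =>
    Environment.mk q.2 fun x j => if hi : (x, j) ≠ (b, n) then q.1 ⟨(x, j), hi⟩ else 0
  have hψ : MeasurableEnv ψ := by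
    refine ⟨fun x j => (measurable_pi_apply j).comp ((measurable_pi_apply x).comp measurable_snd),
      fun x j => ?_⟩
    by_cases hi : (x, j) ≠ (b, n)
    · simp only [ψ, dif_pos hi]
      exact (measurable_pi_apply (⟨(x, j), hi⟩ : {i : ℤ × ℕ // i ≠ (b, n)})).comp measurable_fst
    · simp only [ψ, dif_neg hi]
      exact measurable_const
  let C : Set (({i : ℤ × ℕ // i ≠ (b, n)} → ℝ) × (ℤ → ℕ → ℝ)) :=
    (fun q => (((ψ q).stopped s).ring, ((ψ q).stopped s).mark)) ⁻¹' A ∩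
      {q | (ψ q).nextIndex b s = n}
  have hC : MeasurableSet C :=
    (((measurable_stopPair s).comp hψ.pair) hA).inter
      (hψ.nextIndex measurable_const measurable_const (measurableSet_singleton n))
  set W := fun ω => ((fun i : {i : ℤ × ℕ // i ≠ (b, n)} => (env ω).mark i.1.1 i.1.2),
    (env ω).ring) with hW
  have hind : ∀ ω, (ψ (W ω)).nextIndex b s = (env ω).nextIndex b s := fun ω => rfl
  have hpast : ∀ ω, (env ω).nextIndex b s = n →
      (((ψ (W ω)).stopped s).ring, ((ψ (W ω)).stopped s).mark) =
        (((env ω).stopped s).ring, ((env ω).stopped s).mark) := by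
    intro ω hω
    refine Prod.ext rfl ?_
    ext x j
    simp only [Environment.stopped, stopMark, ψ, hW]
    by_cases hi : (x, j) = (b, n)
    · obtain ⟨rfl, rfl⟩ := Prod.mk.inj hi
      have h1 := (hg ω).unbounded.lt_nextRing x s
      rw [Environment.nextRing, hω] at h1
      rw [if_neg (not_le.2 h1), if_neg (not_le.2 h1)]
    · rw [dif_pos hi]
  have h1 : (fun ω => (((env ω).stopped s).ring, ((env ω).stopped s).mark)) ⁻¹' A ∩
      {ω | (env ω).nextIndex b s = n} = W ⁻¹' C := by
    ext ω
    simp only [C, Set.mem_inter_iff, Set.mem_preimage, Set.mem_ofPred_eq, hind]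
    refine and_congr_left fun hω => ?_
    rw [hpast ω hω]
  have h2 : (fun ω => (((env ω).stopped s).ring, ((env ω).stopped s).mark)) ⁻¹' A ∩
      (fun ω => (env ω).nextMark b s) ⁻¹' B ∩ {ω | (env ω).nextIndex b s = n} =
      (fun ω => (env ω).mark b n) ⁻¹' B ∩ W ⁻¹' C := by
    rw [← h1]
    ext ω
    simp only [Set.mem_inter_iff, Set.mem_preimage, Set.mem_ofPred_eq, Environment.nextMark]
    constructor
    · rintro ⟨⟨h3, h4⟩, h5⟩; rw [h5] at h4; exact ⟨h4, h3, h5⟩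
    · rintro ⟨h4, h3, h5⟩; rw [h5]; exact ⟨⟨h3, h4⟩, rfl⟩
  rw [h1, h2, (h.indepFun_mark b n).measure_inter_preimage_eq_mul B C hB hC, mul_comm]
  congr 1
  rw [← (h.law_mark b n).map_eq, Measure.map_apply (h.measurable_mark b n) hB]

/-- The next mark of a bond has the Beta law. -/
theorem IsBetaEnvironment.map_nextMark (h : IsBetaEnvironment α P env)
    (hg : ∀ ω, (env ω).IsGood) (b : ℤ) (s : ℝ) :
    P.map (fun ω => (env ω).nextMark b s) = betaMeasure α α := by
  ext B hB
  rw [Measure.map_apply (h.measurableEnv.nextMark measurable_const measurable_const) hB]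
  simpa using h.measure_stopped_inter_nextMark hg b s MeasurableSet.univ hB

/-- The next mark of a bond is independent of the past. -/
theorem IsBetaEnvironment.indep_past_nextMark (h : IsBetaEnvironment α P env)
    (hg : ∀ ω, (env ω).IsGood) (b : ℤ) (s : ℝ) :
    Indep (past env s)
      (MeasurableSpace.comap (fun ω => (env ω).nextMark b s) inferInstance) P := by
  refine (IndepFun_iff_Indep _ _ _).1 (indepFun_iff_measure_inter_preimage_eq_mul.2 ?_)
  intro A B hA hB
  rw [h.measure_stopped_inter_nextMark hg b s hA hB, ← h.map_nextMark hg b s,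
    Measure.map_apply (h.measurableEnv.nextMark measurable_const measurable_const) hB]

end Future

/-! ### The forward equation of the averaged profile -/

section Forward

variable {Ω : Type*} [mΩ : MeasurableSpace Ω] {P : Measure Ω} {α : ℝ} {env : Ω → Environment}

theorem IsBetaEnvironment.hasLaw_ringCount (h : IsBetaEnvironment α P env) (b : ℤ) (s t : ℝ≥0) :
    HasLaw (fun ω => (env ω).ringCount b s (s + t : ℝ≥0)) (poissonMeasure t) P := by
  have := h.hasLaw_nextIndex b s (s + t) le_self_add
  rwa [add_tsub_cancel_left] at this

theorem IsBetaEnvironment.measureReal_one_le_ringCount (h : IsBetaEnvironment α P env) (b : ℤ)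
    (s t : ℝ≥0) :
    P.real {ω | 1 ≤ (env ω).ringCount b s (s + t : ℝ≥0)} = 1 - Real.exp (-t) := by
  rw [(h.hasLaw_ringCount b s t).measureReal_eq (p := fun n => 1 ≤ n) MeasurableSet.of_discrete,
    ← poissonMeasure_real_zero, ← probReal_compl_eq_one_sub MeasurableSet.of_discrete]
  congr 1
  ext n
  simp only [Set.mem_ofPred_eq, Set.mem_compl_iff, Set.mem_singleton_iff]
  omega

theorem IsBetaEnvironment.measureReal_two_le_ringCount (h : IsBetaEnvironment α P env) (b : ℤ)
    (s t : ℝ≥0) :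
    P.real {ω | 2 ≤ (env ω).ringCount b s (s + t : ℝ≥0)} ≤ (t : ℝ) ^ 2 := by
  rw [(h.hasLaw_ringCount b s t).measureReal_eq (p := fun n => 2 ≤ n) MeasurableSet.of_discrete]
  exact poissonMeasure_real_ge_two_le t

theorem IsBetaEnvironment.measureReal_ringCount_inter (h : IsBetaEnvironment α P env) {b c : ℤ}
    (hbc : b ≠ c) (s t : ℝ≥0) :
    P.real {ω | 1 ≤ (env ω).ringCount b s (s + t : ℝ≥0) ∧
      1 ≤ (env ω).ringCount c s (s + t : ℝ≥0)} ≤ (t : ℝ) ^ 2 := by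
  have hφ : Measurable fun r : ℕ → ℝ =>
      sInf {j | ((s + t : ℝ≥0) : ℝ) < r j} - sInf {j | (s : ℝ) < r j} :=
    Measurable.sub
      (measurable_sInf_nat fun j => measurableSet_lt measurable_const (measurable_pi_apply j))
      (measurable_sInf_nat fun j => measurableSet_lt measurable_const (measurable_pi_apply j))
  have hind : IndepFun (fun ω => (env ω).ringCount b s (s + t : ℝ≥0))
      (fun ω => (env ω).ringCount c s (s + t : ℝ≥0)) P :=
    (h.indep_ring.indepFun hbc).comp hφ hφ
  have h1 := hind.measure_inter_preimage_eq_mul (Set.Ici 1) (Set.Ici 1) measurableSet_Ici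
    measurableSet_Ici
  have h2 : P.real {ω | 1 ≤ (env ω).ringCount b s (s + t : ℝ≥0) ∧
      1 ≤ (env ω).ringCount c s (s + t : ℝ≥0)} = (1 - Real.exp (-t)) * (1 - Real.exp (-t)) := by
    nth_rewrite 1 [← h.measureReal_one_le_ringCount b s t]
    rw [← h.measureReal_one_le_ringCount c s t]
    exact (congrArg ENNReal.toReal h1).trans ENNReal.toReal_mul
  rw [h2, pow_two]
  have h3 := one_sub_exp_neg_le t
  have h4 : 0 ≤ 1 - Real.exp (-(t : ℝ)) := by simp
  exact mul_le_mul h3 h3 h4 t.2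

variable [IsProbabilityMeasure P]

/-- By Fubini: the next mark has the Beta law and is independent of the weight and the present
profile, and integrating it out gives the bond generator. -/
theorem integral_past_mul_redistribute_nextMark (hα : 0 < α) (h : IsBetaEnvironment α P env)
    (hg : ∀ ω, (env ω).IsGood) (ρ₀ : ℤ → ℝ≥0) (f : Config →ᵇ ℝ) (b : ℤ) (s : ℝ≥0) {G : Ω → ℝ}
    (hG : Measurable[past env s] G) {c : ℝ} (hGc : ∀ ω, |G ω| ≤ c) :
    ∫ ω, G ω * (f (redistribute b ((env ω).nextMark b s) (profile ρ₀ (env ω) s)) -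
        f (profile ρ₀ (env ω) s)) ∂P =
      ∫ ω, G ω * bondGenerator α b f (profile ρ₀ (env ω) s) ∂P := by
  have := isProbabilityMeasureBeta hα hα
  have hle := h.measurableEnv.past_le s
  have hX : Measurable[past env s] fun ω => (G ω, profile ρ₀ (env ω) s) :=
    Measurable.prodMk hG
      (measurable_profile_past (fun ω => (hg ω).unbounded) ρ₀ s.2)
  have hX' : Measurable fun ω => (G ω, profile ρ₀ (env ω) s) := hX.mono hle le_rfl
  have hm : Measurable fun ω => (env ω).nextMark b s :=
    h.measurableEnv.nextMark measurable_const measurable_const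
  have hind : IndepFun (fun ω => (G ω, profile ρ₀ (env ω) s)) (fun ω => (env ω).nextMark b s) P :=
    (IndepFun_iff_Indep _ _ _).2 (indep_of_indep_of_le_left (h.indep_past_nextMark hg b s)
      hX.comap_le)
  have hlaw := (indepFun_iff_map_prod_eq_prod_map_map hX'.aemeasurable hm.aemeasurable).1 hind
  rw [h.map_nextMark hg b s] at hlaw
  set F : (ℝ × Config) × ℝ → ℝ := fun q => q.1.1 * (f (redistribute b q.2 q.1.2) - f q.1.2)
  have hF : Measurable F := by
    have h1 : Continuous fun q : (ℝ × Config) × ℝ => redistribute b q.2 q.1.2 :=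
      (continuous_redistribute b).comp (by fun_prop : Continuous fun q : (ℝ × Config) × ℝ =>
        (q.2, q.1.2))
    exact (continuous_fst.fst.mul ((f.continuous.comp h1).sub
      (f.continuous.comp continuous_fst.snd))).measurable
  have hint : Integrable F ((P.map fun ω => (G ω, profile ρ₀ (env ω) s)).prod
      (betaMeasure α α)) := by
    rw [← hlaw, integrable_map_measure hF.aestronglyMeasurable (hX'.prodMk hm).aemeasurable]
    refine Integrable.of_bound (C := c * (2 * ‖f‖))
      (hF.comp (hX'.prodMk hm)).aestronglyMeasurable (ae_of_all _ fun ω => ?_)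
    rw [Function.comp, norm_mul]
    exact mul_le_mul (hGc ω) (norm_sub_redistribute_le f _ _ _) (norm_nonneg _)
      ((abs_nonneg _).trans (hGc ω))
  calc ∫ ω, G ω * (f (redistribute b ((env ω).nextMark b s) (profile ρ₀ (env ω) s)) -
        f (profile ρ₀ (env ω) s)) ∂P
      = ∫ q, F q ∂(P.map fun ω => ((G ω, profile ρ₀ (env ω) s), (env ω).nextMark b s)) :=
        (integral_map (hX'.prodMk hm).aemeasurable hF.aestronglyMeasurable).symm
    _ = ∫ q, q.1 * bondGenerator α b f q.2 ∂(P.map fun ω => (G ω, profile ρ₀ (env ω) s)) := by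
        rw [hlaw, integral_prod _ hint]
        refine integral_congr_ae (ae_of_all _ fun q => ?_)
        exact integral_const_mul (μ := betaMeasure α α) q.1
          fun p => f (redistribute b p q.2) - f q.2
    _ = _ := by
        refine integral_map hX'.aemeasurable (Measurable.aestronglyMeasurable ?_)
        exact measurable_fst.mul ((continuous_bondGenerator hα b f).measurable.comp measurable_snd)

theorem past_le_comap {Ω : Type*} (s : ℝ) (env : Ω → Environment) :
    past env s ≤
      MeasurableSpace.comap (fun ω => (stopRing s (env ω).ring, (env ω).mark)) inferInstance := by
  set m := MeasurableSpace.comap (fun ω => (stopRing s (env ω).ring, (env ω).mark)) inferInstance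
  have h1 : Measurable fun q : (ℤ → ℕ → ℝ) × (ℤ → ℕ → ℝ) => (q.1, stopMark s q.1 q.2) :=
    measurable_fst.prodMk (measurable_stopMark s)
  have h2 := @Measurable.comp _ _ _ m _ _ _ _ h1
    (comap_measurable fun ω => (stopRing s (env ω).ring, (env ω).mark))
  refine Measurable.comap_le (m₁ := m) ?_
  convert h2 using 2 with ω
  simp only [Function.comp, Environment.stopped, stopMark_stopRing]

theorem measurable_mul_sub_redistribute {Ω : Type*} {m : MeasurableSpace Ω} {G p : Ω → ℝ}
    {ξ : Ω → Config} (hG : Measurable G) (hp : Measurable p) (hξ : Measurable ξ) (f : Config →ᵇ ℝ)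
    (b : ℤ) : Measurable fun ω => G ω * (f (redistribute b (p ω) (ξ ω)) - f (ξ ω)) := by
  refine hG.mul (Measurable.sub ?_ (f.continuous.measurable.comp hξ))
  exact (f.continuous.comp (continuous_redistribute b)).measurable.comp (hp.prodMk hξ)

theorem measurable_nextMark_comap {Ω : Type*} (env : Ω → Environment) (b : ℤ) (s : ℝ) :
    Measurable[MeasurableSpace.comap (fun ω => (stopRing s (env ω).ring, (env ω).mark))
      inferInstance] fun ω => (env ω).nextMark b s := by
  have h1 := measurableEnv_mk.nextMark (measurable_const (a := s)) (measurable_const (a := b))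
  have h2 := h1.comp (comap_measurable fun ω => (stopRing s (env ω).ring, (env ω).mark))
  convert h2 using 2 with ω
  simp only [Function.comp, Environment.nextMark, Environment.nextIndex_stopRing]

/-- The number of rings after `s` is independent of the earlier rings and of all marks, so its
indicator factors out with probability `1 - exp (-t)`. -/
theorem integral_past_ringCount (hα : 0 < α) (h : IsBetaEnvironment α P env)
    (hg : ∀ ω, (env ω).IsGood) (ρ₀ : ℤ → ℝ≥0) (f : Config →ᵇ ℝ) (b : ℤ) (s t : ℝ≥0) {G : Ω → ℝ}
    (hG : Measurable[past env s] G) {c : ℝ} (hGc : ∀ ω, |G ω| ≤ c) :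
    ∫ ω, {ω | 1 ≤ (env ω).ringCount b s (s + t : ℝ≥0)}.indicator (fun _ => (1 : ℝ)) ω *
        (G ω * (f (redistribute b ((env ω).nextMark b s) (profile ρ₀ (env ω) s)) -
          f (profile ρ₀ (env ω) s))) ∂P =
      (1 - Real.exp (-t)) * ∫ ω, G ω * bondGenerator α b f (profile ρ₀ (env ω) s) ∂P := by
  have hle := past_le_comap (s : ℝ) env
  have hp := h.measurableEnv.pair
  have hm : MeasurableSpace.comap (fun ω => (stopRing s (env ω).ring, (env ω).mark))
      inferInstance ≤ mΩ :=
    Measurable.comap_le (((measurable_stopRing s).comp hp.fst).prodMk hp.snd)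
  have hY := measurable_mul_sub_redistribute (hG.mono hle le_rfl)
    (measurable_nextMark_comap env b s)
    ((measurable_profile_past (fun ω => (hg ω).unbounded) ρ₀ s.2).mono hle le_rfl) f b
  have hD : MeasurableSet {ω | 1 ≤ (env ω).ringCount b s (s + t : ℝ≥0)} :=
    measurableSet_le measurable_const (h.measurableEnv.ringCount b s (s + t : ℝ≥0))
  have hind : IndepFun
      (fun ω => {ω | 1 ≤ (env ω).ringCount b s (s + t : ℝ≥0)}.indicator (fun _ => (1 : ℝ)) ω)
      (fun ω => G ω * (f (redistribute b ((env ω).nextMark b s)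
        (profile ρ₀ (env ω) s)) - f (profile ρ₀ (env ω) s))) P := by
    have h1 : IndepFun
        (fun ω => {ω | 1 ≤ (env ω).ringCount b s (s + t : ℝ≥0)}.indicator (fun _ => (1 : ℝ)) ω)
        (fun ω => (stopRing s (env ω).ring, (env ω).mark)) P :=
      (h.indepFun_ringCount hg b s t).comp
        (φ := {n : ℕ | 1 ≤ n}.indicator fun _ => (1 : ℝ)) Measurable.of_discrete measurable_id
    rw [IndepFun_iff_Indep] at h1 ⊢
    exact indep_of_indep_of_le_right h1 hY.comap_le
  rw [hind.integral_fun_mul_eq_mul_integral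
      (measurable_const.indicator hD).aestronglyMeasurable
      (hY.mono hm le_rfl).aestronglyMeasurable,
    integral_past_mul_redistribute_nextMark hα h hg ρ₀ f b s hG hGc,
    integral_indicator_const _ hD, h.measureReal_one_le_ringCount, smul_eq_mul, mul_one]

end Forward

/-! ### The averaged profile solves the forward equation -/

section ProfileForward

/-- Either a bond of `W` rings twice, or two bonds of `W` ring. -/
def Environment.MultipleRings (e : Environment) (W : Finset ℤ) (s t : ℝ) : Prop :=
  (∃ b ∈ W, 2 ≤ e.ringCount b s t) ∨
    ∃ b ∈ W, ∃ c ∈ W.erase b, 1 ≤ e.ringCount b s t ∧ 1 ≤ e.ringCount c s t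

/-- The change of `f` when the bond `(b, b+1)` is redistributed according to its next mark. -/
def jump (ρ₀ : ℤ → ℝ≥0) (f : Config → ℝ) (b : ℤ) (s : ℝ) (e : Environment) : ℝ :=
  f (redistribute b (e.nextMark b s) (profile ρ₀ e s)) - f (profile ρ₀ e s)

/-- Without multiple rings at most one bond of the window rings, and only once. At most one term of
the sum is then present, and the mark used is the next one after `s`. -/
theorem Environment.IsGood.local_profile_sub_eq {e : Environment} (he : e.IsGood) {ρ₀ : ℤ → ℝ≥0}
    {M : ℕ} {f : Config → ℝ} (hf : IsLocalOn M f) {s t : ℝ} (hs : 0 ≤ s) (hst : s ≤ t)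
    (h : ¬ e.MultipleRings (windowBonds M) s t) :
    f (profile ρ₀ e t) - f (profile ρ₀ e s) =
      ∑ b ∈ windowBonds M, if 1 ≤ e.ringCount b s t then jump ρ₀ f b s e else 0 := by
  simp only [Environment.MultipleRings, not_or, not_exists, not_and, not_le] at h
  by_cases h0 : ∀ b ∈ windowBonds M, e.ringCount b s t = 0
  · rw [he.local_profile_of_silent hf hs hst fun b hb => he.silent_of_ringCount hst (h0 b hb),
      sub_self, Finset.sum_eq_zero fun b hb => by rw [h0 b hb, if_neg (by omega)]]
  · push Not at h0
    obtain ⟨b, hb, hb0⟩ := h0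
    have hb2 := h.1 b hb
    have hb1 : e.ringCount b s t = 1 := by omega
    have hc : ∀ c ∈ windowBonds M, c ≠ b → e.ringCount c s t = 0 := fun c hcW hcb => by
      have := h.2 b hb c (Finset.mem_erase.2 ⟨hcb, hcW⟩) hb1.ge
      omega
    rw [he.local_profile_of_ringsOnce hf hs hst
      (fun c hcW hcb => he.silent_of_ringCount hst (hc c hcW hcb))
      (he.ringsOnce_of_ringCount hst hb1),
      Finset.sum_eq_single_of_mem b hb fun c hcW hcb => by rw [hc c hcW hcb, if_neg (by omega)],
      if_pos hb1.ge]
    rfl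

variable {Ω : Type*} [mΩ : MeasurableSpace Ω] {P : Measure Ω} {α : ℝ} {env : Ω → Environment}

theorem IsBetaEnvironment.measureReal_multipleRings [IsProbabilityMeasure P]
    (h : IsBetaEnvironment α P env) (W : Finset ℤ) (s t : ℝ≥0) :
    P.real {ω | (env ω).MultipleRings W s (s + t : ℝ≥0)} ≤
      (W.card + W.card * W.card) * (t : ℝ) ^ 2 := by
  have hsub : {ω | (env ω).MultipleRings W s (s + t : ℝ≥0)} =
      (⋃ b ∈ W, {ω | 2 ≤ (env ω).ringCount b s (s + t : ℝ≥0)}) ∪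
      ⋃ b ∈ W, ⋃ c ∈ W.erase b, {ω | 1 ≤ (env ω).ringCount b s (s + t : ℝ≥0) ∧
        1 ≤ (env ω).ringCount c s (s + t : ℝ≥0)} := by
    ext ω
    simp only [Environment.MultipleRings, Set.mem_union, Set.mem_iUnion, Set.mem_ofPred_eq,
      exists_prop]
  rw [hsub, add_mul]
  refine (measureReal_union_le _ _).trans (add_le_add ?_ ?_)
  · refine (measureReal_biUnion_finset_le _ _).trans ?_
    refine (Finset.sum_le_card_nsmul _ _ _ fun b _ =>
      h.measureReal_two_le_ringCount b s t).trans_eq ?_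
    rw [nsmul_eq_mul]
  · refine (measureReal_biUnion_finset_le _ _).trans ?_
    refine (Finset.sum_le_card_nsmul _ _ (W.card * (t : ℝ) ^ 2) fun b _ => ?_).trans_eq ?_
    · refine (measureReal_biUnion_finset_le _ _).trans ?_
      refine (Finset.sum_le_card_nsmul _ _ _ fun c hc =>
        h.measureReal_ringCount_inter (Finset.ne_of_mem_erase hc).symm s t).trans ?_
      rw [nsmul_eq_mul]
      gcongr
      exact Finset.erase_subset _ _
    · rw [nsmul_eq_mul, mul_assoc]

theorem MeasurableEnv.measurableSet_multipleRings (h : MeasurableEnv env) (W : Finset ℤ)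
    (s t : ℝ) : MeasurableSet {ω | (env ω).MultipleRings W s t} := by
  have h1 : ∀ (n : ℕ) b, MeasurableSet {ω | n ≤ (env ω).ringCount b s t} := fun n b =>
    measurableSet_le measurable_const (h.ringCount b s t)
  have h2 : {ω | (env ω).MultipleRings W s t} =
      (⋃ b ∈ W, {ω | 2 ≤ (env ω).ringCount b s t}) ∪
      ⋃ b ∈ W, ⋃ c ∈ W.erase b, ({ω | 1 ≤ (env ω).ringCount b s t} ∩
        {ω | 1 ≤ (env ω).ringCount c s t}) := by
    ext ω
    simp only [Environment.MultipleRings, Set.mem_union, Set.mem_iUnion, Set.mem_ofPred_eq,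
      exists_prop, Set.mem_inter_iff]
  rw [h2]
  exact (W.measurableSet_biUnion fun b _ => h1 2 b).union
    (W.measurableSet_biUnion fun b _ => (W.erase b).measurableSet_biUnion fun c _ =>
      (h1 1 b).inter (h1 1 c))

/-- First order expansion in time of the expectation of a local function of the profile. -/
theorem abs_integral_profile_sub_le [IsProbabilityMeasure P] (hα : 0 < α)
    (h : IsBetaEnvironment α P env) (hg : ∀ ω, (env ω).IsGood) (ρ₀ : ℤ → ℝ≥0) {M : ℕ}
    {f : Config →ᵇ ℝ} (hf : IsLocalOn M f) (s t : ℝ≥0) {G : Ω → ℝ}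
    (hG : Measurable[past env s] G) {c : ℝ} (hGc : ∀ ω, |G ω| ≤ c) :
    |∫ ω, G ω * f (profile ρ₀ (env ω) (s + t : ℝ≥0)) ∂P - ∫ ω, G ω * f (profile ρ₀ (env ω) s) ∂P -
        (1 - Real.exp (-t)) * ∫ ω, G ω * generator α f (profile ρ₀ (env ω) s) ∂P| ≤
      c * (2 * ‖f‖ * (1 + (windowBonds M).card)) *
        (((windowBonds M).card + (windowBonds M).card * (windowBonds M).card) * (t : ℝ) ^ 2) := by
  set W := windowBonds M with hW
  have hm := h.measurableEnv
  have hGm : Measurable G := hG.mono (hm.past_le s) le_rfl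
  have hst : (s : ℝ) ≤ (s + t : ℝ≥0) := NNReal.coe_le_coe.2 le_self_add
  have hfm : ∀ r : ℝ≥0, Measurable fun ω => f (profile ρ₀ (env ω) r) := fun r =>
    f.continuous.measurable.comp (hm.profile ρ₀ r)
  have hD : ∀ b, MeasurableSet {ω | 1 ≤ (env ω).ringCount b s (s + t : ℝ≥0)} := fun b =>
    measurableSet_le measurable_const (hm.ringCount b s (s + t : ℝ≥0))
  have hjm : ∀ b, Measurable fun ω => G ω * jump ρ₀ f b s (env ω) := fun b =>
    measurable_mul_sub_redistribute hGm (hm.nextMark measurable_const measurable_const)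
      (hm.profile ρ₀ s) f b
  have hc : 0 ≤ c := by
    obtain ⟨ω⟩ := P.nonempty_of_neZero
    exact (abs_nonneg _).trans (hGc ω)
  have hjle : ∀ b ω, |jump ρ₀ f b s (env ω)| ≤ 2 * ‖f‖ := fun b ω =>
    norm_sub_redistribute_le f _ _ _
  have hint : ∀ {F : Ω → ℝ} {d : ℝ}, Measurable F → (∀ ω, |F ω| ≤ d) →
      Integrable (fun ω => G ω * F ω) P := fun {F d} hF hd => by
    refine Integrable.of_bound (C := c * d) (hGm.mul hF).aestronglyMeasurable
      (ae_of_all _ fun ω => ?_)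
    rw [norm_mul]
    exact mul_le_mul (hGc ω) (hd ω) (norm_nonneg _) hc
  have hint1 : ∀ r : ℝ≥0, Integrable (fun ω => G ω * f (profile ρ₀ (env ω) r)) P := fun r =>
    hint (hfm r) fun ω => f.norm_coe_le_norm _
  set I : ℤ → Ω → ℝ := fun b =>
    {ω | 1 ≤ (env ω).ringCount b s (s + t : ℝ≥0)}.indicator fun _ => (1 : ℝ) with hI
  have hI1 : ∀ b ω, |I b ω| ≤ 1 := fun b ω => by
    simp only [hI, Set.indicator_apply]
    split_ifs <;> simp
  have hint2 : ∀ b, Integrable (fun ω => I b ω * (G ω * jump ρ₀ f b s (env ω))) P := fun b => by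
    refine Integrable.of_bound (C := 1 * (c * (2 * ‖f‖)))
      ((measurable_const.indicator (hD b)).mul (hjm b)).aestronglyMeasurable
      (ae_of_all _ fun ω => ?_)
    rw [norm_mul, norm_mul]
    exact mul_le_mul (hI1 b ω) (mul_le_mul (hGc ω) (hjle b ω) (norm_nonneg _) hc)
      (by positivity) one_pos.le
  have hgen : (1 - Real.exp (-t)) * ∫ ω, G ω * generator α f (profile ρ₀ (env ω) s) ∂P =
      ∑ b ∈ W, ∫ ω, I b ω * (G ω * jump ρ₀ f b s (env ω)) ∂P := by
    have h1 : ∀ η, generator α f η = ∑ b ∈ W, bondGenerator α b f η := fun η => by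
      rw [generator_eq_sum hf]
      refine Finset.sum_subset (fun b hb => ?_) fun b _ hb => bondGenerator_eq_zero hf hb η
      rw [hW, windowBonds, Finset.mem_Icc]
      rw [Finset.mem_Ico] at hb
      omega
    simp only [h1, Finset.mul_sum]
    have h2 : ∀ b, Integrable
        (fun ω => G ω * bondGenerator α b f (profile ρ₀ (env ω) s)) P := fun b =>
      hint ((continuous_bondGenerator hα b f).measurable.comp (hm.profile ρ₀ s))
        fun ω => abs_bondGenerator_le hα b f _
    rw [integral_finsetSum _ fun b _ => h2 b, Finset.mul_sum]
    exact Finset.sum_congr rfl fun b _ =>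
      (integral_past_ringCount hα h hg ρ₀ f b s t hG hGc).symm
  -- The first-order term is exact, so the whole error is this remainder. It vanishes unless there
  -- are multiple rings, where it is at most `K`; that event has probability `O(t²)`.
  set R : Ω → ℝ := fun ω => G ω * f (profile ρ₀ (env ω) (s + t : ℝ≥0)) -
    G ω * f (profile ρ₀ (env ω) s) - ∑ b ∈ W, I b ω * (G ω * jump ρ₀ f b s (env ω)) with hR
  have hRint : ∫ ω, R ω ∂P = ∫ ω, G ω * f (profile ρ₀ (env ω) (s + t : ℝ≥0)) ∂P -
      ∫ ω, G ω * f (profile ρ₀ (env ω) s) ∂P -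
        (1 - Real.exp (-t)) * ∫ ω, G ω * generator α f (profile ρ₀ (env ω) s) ∂P := by
    rw [hgen, ← integral_finsetSum _ fun b _ => hint2 b, ← integral_sub (hint1 _) (hint1 _)]
    exact integral_sub ((hint1 _).sub (hint1 _)) (integrable_finsetSum _ fun b _ => hint2 b)
  rw [← hRint]
  set B := {ω | (env ω).MultipleRings W s (s + t : ℝ≥0)} with hB
  have hBm : MeasurableSet B := hm.measurableSet_multipleRings W s (s + t : ℝ≥0)
  set K := c * (2 * ‖f‖ * (1 + (W.card : ℝ))) with hK
  have hK0 : 0 ≤ K := by positivity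
  have hRle : ∀ ω, ‖R ω‖ ≤ B.indicator (fun _ => K) ω := by
    intro ω
    have hRω : R ω = G ω * (f (profile ρ₀ (env ω) (s + t : ℝ≥0)) - f (profile ρ₀ (env ω) s) -
        ∑ b ∈ W, if 1 ≤ (env ω).ringCount b s (s + t : ℝ≥0) then jump ρ₀ f b s (env ω)
          else 0) := by
      simp only [hR, hI, Set.indicator_apply, Set.mem_ofPred_eq]
      rw [mul_sub, mul_sub, Finset.mul_sum]
      congr 1
      refine Finset.sum_congr rfl fun b _ => ?_
      split_ifs <;> ring
    rw [hRω, norm_mul]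
    by_cases hω : ω ∈ B
    · rw [Set.indicator_of_mem hω]
      refine mul_le_mul (hGc ω) ?_ (norm_nonneg _) hc
      refine (norm_sub_le _ _).trans ?_
      rw [mul_add, mul_one]
      refine add_le_add ((dist_eq_norm _ _).symm.trans_le (f.dist_le_two_norm _ _)) ?_
      refine (norm_sum_le _ _).trans ?_
      refine (Finset.sum_le_card_nsmul _ _ (2 * ‖f‖) fun b _ => ?_).trans_eq ?_
      · split_ifs
        · exact hjle b ω
        · simp
      · rw [nsmul_eq_mul, mul_comm]
    · have h1 := (hg ω).local_profile_sub_eq (ρ₀ := ρ₀) hf s.coe_nonneg hst hω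
      rw [← hW] at h1
      rw [Set.indicator_of_notMem hω, sub_eq_zero.2 h1, norm_zero, mul_zero]
  calc |∫ ω, R ω ∂P| ≤ ∫ ω, B.indicator (fun _ => K) ω ∂P :=
        norm_integral_le_of_norm_le ((integrable_const K).indicator hBm) (ae_of_all _ hRle)
    _ = K * P.real B := by rw [integral_indicator_const _ hBm, smul_eq_mul, mul_comm]
    _ ≤ _ := mul_le_mul_of_nonneg_left (h.measureReal_multipleRings W s t) hK0

/-- Replacing `1 - exp (-t)` by `t` costs at most `t²` times the bound `c‖𝓛f‖` when `t ≤ 1`. The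
constant is uniform in `s` and in the weight. -/
theorem IsBetaEnvironment.exists_expansion [IsProbabilityMeasure P] (hα : 0 < α)
    (h : IsBetaEnvironment α P env) (hg : ∀ ω, (env ω).IsGood) (ρ₀ : ℤ → ℝ≥0) {M : ℕ}
    {f : Config →ᵇ ℝ} (hf : IsLocalOn M f) (c : ℝ) :
    ∃ C : ℝ, ∀ s t : ℝ≥0, t ≤ 1 → ∀ G : Ω → ℝ, Measurable[past env s] G → (∀ ω, |G ω| ≤ c) →
      |∫ ω, G ω * f (profile ρ₀ (env ω) (s + t : ℝ≥0)) ∂P -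
        ∫ ω, G ω * f (profile ρ₀ (env ω) s) ∂P -
        t * ∫ ω, G ω * generator α f (profile ρ₀ (env ω) s) ∂P| ≤ C * (t : ℝ) ^ 2 := by
  obtain ⟨g, hgen, -, hgn⟩ := exists_generator hα hf
  refine ⟨c * (2 * ‖f‖ * (1 + (windowBonds M).card)) *
    ((windowBonds M).card + (windowBonds M).card * (windowBonds M).card) + c * ‖g‖,
    fun s t ht G hG hGc => ?_⟩
  have h1 := abs_integral_profile_sub_le hα h hg ρ₀ hf s t hG hGc
  have h2 : |∫ ω, G ω * generator α f (profile ρ₀ (env ω) s) ∂P| ≤ c * ‖g‖ :=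
    abs_integral_mul_le hGc fun ω => by rw [← hgen]; exact g.norm_coe_le_norm _
  set L := ∫ ω, G ω * generator α f (profile ρ₀ (env ω) s) ∂P
  set Δ := ∫ ω, G ω * f (profile ρ₀ (env ω) (s + t : ℝ≥0)) ∂P -
    ∫ ω, G ω * f (profile ρ₀ (env ω) s) ∂P
  have h3 : |1 - Real.exp (-t) - t| ≤ (t : ℝ) ^ 2 := by
    have h4 := Real.abs_exp_sub_one_sub_id_le (x := -(t : ℝ)) (by
      rw [abs_neg, abs_of_nonneg (NNReal.coe_nonneg t)]; exact_mod_cast ht)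
    rw [neg_sq] at h4
    rwa [← abs_neg, show -(1 - Real.exp (-(t : ℝ)) - t) = Real.exp (-t) - 1 - -t by ring]
  have h5 : Δ - t * L = (Δ - (1 - Real.exp (-t)) * L) + (1 - Real.exp (-t) - t) * L := by ring
  rw [h5]
  refine (abs_add_le _ _).trans ?_
  rw [add_mul]
  refine add_le_add (h1.trans_eq (by ring)) ?_
  rw [abs_mul, mul_comm]
  exact mul_le_mul h2 h3 (abs_nonneg _) ((abs_nonneg _).trans h2)

/-- The profile averaged over the walks solves the same forward equation as the KMP process. -/
theorem IsBetaEnvironment.solvesForward_profile [IsProbabilityMeasure P] (hα : 0 < α)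
    (h : IsBetaEnvironment α P env) (hg : ∀ ω, (env ω).IsGood) (ρ₀ : ℤ → ℝ≥0) :
    SolvesForward α P (fun t : ℝ≥0 => past env t) (fun t ω => profile ρ₀ (env ω) t) where
  mono s t hst := past_mono env (NNReal.coe_le_coe.2 hst)
  adapted t := measurable_profile_past (fun ω => (hg ω).unbounded) ρ₀ t.2
  lipschitz M f hf c := by
    obtain ⟨C, hC⟩ := h.exists_expansion hα hg ρ₀ hf c
    obtain ⟨g, hgen, -, hgn⟩ := exists_generator hα hf
    -- For `t ≤ 1` the expansion is absorbed by the first two terms; for `t ≥ 1` the trivial bound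
    -- `2c‖f‖` is at most the third term times `t`.
    refine ⟨|C| + c * ‖g‖ + 2 * (c * ‖f‖), fun s t G hG hGc => ?_⟩
    have hc : 0 ≤ c := by
      obtain ⟨ω⟩ := P.nonempty_of_neZero
      exact (abs_nonneg _).trans (hGc ω)
    have hL : |∫ ω, G ω * generator α f (profile ρ₀ (env ω) s) ∂P| ≤ c * ‖g‖ :=
      abs_integral_mul_le hGc fun ω => by rw [← hgen]; exact g.norm_coe_le_norm _
    have hb : ∀ r : ℝ≥0, |∫ ω, G ω * f (profile ρ₀ (env ω) r) ∂P| ≤ c * ‖f‖ := fun r =>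
      abs_integral_mul_le hGc fun ω => f.norm_coe_le_norm _
    have ht0 : (0 : ℝ) ≤ t := t.2
    have hg0 : 0 ≤ c * ‖g‖ := by positivity
    have hf0 : 0 ≤ c * ‖f‖ := by positivity
    rcases le_total t 1 with ht | ht
    · have ht1 : (t : ℝ) ≤ 1 := by exact_mod_cast ht
      have h1 := abs_le.1 (hC s t ht G hG hGc)
      have h2 : C * (t : ℝ) ^ 2 ≤ |C| * t := by
        rw [pow_two]
        exact mul_le_mul (le_abs_self C) (mul_le_of_le_one_left ht0 ht1) (by positivity)
          (abs_nonneg C)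
      have h3 := mul_le_mul_of_nonneg_left (abs_le.1 hL).2 ht0
      have h4 := mul_le_mul_of_nonneg_left (abs_le.1 hL).1 ht0
      have h5 : 0 ≤ 2 * (c * ‖f‖) * (t : ℝ) := by positivity
      rw [abs_le]
      constructor <;> nlinarith
    · have ht1 : (1 : ℝ) ≤ t := by exact_mod_cast ht
      have h1 : |∫ ω, G ω * f (profile ρ₀ (env ω) (s + t : ℝ≥0)) ∂P -
          ∫ ω, G ω * f (profile ρ₀ (env ω) s) ∂P| ≤ 2 * (c * ‖f‖) := by
        refine (abs_sub _ _).trans ?_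
        linarith [hb (s + t), hb s]
      refine h1.trans ?_
      have h2 : 0 ≤ (|C| + c * ‖g‖) * t := by positivity
      nlinarith
  deriv M f hf c s G hG hGc := by
    obtain ⟨C, hC⟩ := h.exists_expansion hα hg ρ₀ hf c
    rw [tendsto_iff_norm_sub_tendsto_zero]
    have hlim : Tendsto (fun t : ℝ => C * t) (𝓝[>] 0) (𝓝 0) := by
      have : Tendsto (fun t : ℝ => C * t) (𝓝 0) (𝓝 (C * 0)) := tendsto_const_nhds.mul tendsto_id
      rw [mul_zero] at this
      exact this.mono_left nhdsWithin_le_nhds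
    refine squeeze_zero' (Eventually.of_forall fun _ => norm_nonneg _) ?_ hlim
    filter_upwards [self_mem_nhdsWithin, mem_nhdsWithin_of_mem_nhds (gt_mem_nhds one_pos)]
      with t ht ht1
    have ht0 : (0 : ℝ) < t := ht
    have h1 := hC s t.toNNReal (by rw [← Real.toNNReal_one]; exact Real.toNNReal_le_toNNReal ht1.le)
      G hG hGc
    rw [Real.coe_toNNReal t ht0.le] at h1
    have h2 : ∀ Δ L : ℝ, t⁻¹ * Δ - L = t⁻¹ * (Δ - t * L) := fun Δ L => by field_simp
    rw [h2, norm_mul, norm_inv, Real.norm_eq_abs, Real.norm_eq_abs, abs_of_pos ht0]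
    calc t⁻¹ * _ ≤ t⁻¹ * (C * t ^ 2) := mul_le_mul_of_nonneg_left h1 (by positivity)
      _ = C * t := by field_simp

end ProfileForward

end KMP

end

theorem mainTheorem4 {Ω Ω₁ : Type*} [MeasurableSpace Ω] [MeasurableSpace Ω₁]
    (P : Measure Ω) [IsProbabilityMeasure P] (P₁ : Measure Ω₁) [IsProbabilityMeasure P₁]
    (α : ℝ) (hα : 0 < α)
    (env : Ω → KMP.Environment) (henv : KMP.IsBetaEnvironment α P env)
    (ρ₀ : ℤ → ℝ≥0) (hρ₀ : BddAbove (Set.range ρ₀))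
    (η : Ω₁ → KMP.SkorokhodSpace KMP.Config) (hη : KMP.IsKMPProcess α P₁ η)
    (hη₀ : ∀ᵐ ω ∂P₁, η ω 0 = ρ₀) :
    ∃ ρ : Ω → KMP.SkorokhodSpace KMP.Config,
      (∀ᵐ ω ∂P, ∀ (t : ℝ≥0) (x : ℤ),
        HasSum (fun y : ℤ => (ρ₀ y : ℝ) * KMP.quenchedKernel (env ω) 0 t y x) (ρ ω t x : ℝ)) ∧
      IdentDistrib η ρ P₁ P := by
  -- The process must have càdlàg paths for every `ω`, hence the version of the environment that is
  -- good everywhere; the series is compared with the original one almost surely.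
  obtain ⟨env', henv', hae, hgood⟩ := henv.exists_isGood
  have hρ := henv'.solvesForward_profile hα hgood ρ₀
  refine ⟨fun ω => ⟨fun t => KMP.profile ρ₀ (env' ω) t, (hgood ω).isCadlag_profile ρ₀⟩, ?_, ?_⟩
  · filter_upwards [hae] with ω hω t x
    rw [hω]
    exact (hgood ω).hasSum_profile ρ₀ t.coe_nonneg x
  · refine KMP.identDistrib_skorokhodSpace hη.measurable_eval
      (fun t => henv'.measurableEnv.profile ρ₀ t) fun J g => ?_
    refine (hη.solvesForward hα).integral_prod_eq hα hρ hη₀ (ae_of_all _ fun ω => ?_) J g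
    exact (hgood ω).profile_zero
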